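/- Notation. Let $d\ge 1$. A weight sequence is a sequence $M=(M_p)_{p\in\mathbb N}$ of positive numbers with $M_0=M_1=1$, $M_p^{1/p}\to\infty$ and $M_p^2\le M_{p-1}M_{p+1}$ for $p\geq 1$; put $M_\alpha=M_{|\alpha|}$ for $\alpha\in\mathbb N^d$, $\nu_M(t)=\sup_{p}\log(t^p/M_p)$ for $t\ge0$, $\nu_M(x)=\nu_M(|x|)$ for $x\in\mathbb R^d$, and $V_n=\{z\in\mathbb C^d : |\operatorname{Im}z|<n\}$. For $h>0$ and $n\in\mathbb N$ define - $\mathcal K^{M,h}(\mathbb R^d)=\{\varphi\in C^\infty(\mathbb R^d): \sup_{\alpha,x}h^{|\alpha|}|\partial^\alpha\varphi(x)|e^{n|x|}/M_\alpha<\infty\ \forall n\in\mathbb N\}$, $\ \mathcal K^{(M)}=\varprojlim_{h\to\infty}\mathcal K^{M,h}$, $\ \mathcal K^{\{M\}}=\varinjlim_{h\to0^+}\mathcal K^{M,h}$; - $\mathcal U^{M,h}(\mathbb C^d)=\{\varphi\in\mathcal O(\mathbb C^d): \sup_{z\in V_n}|\varphi(z)|e^{\nu_M(h\operatorname{Re}z)}<\infty\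 \forall n\in\mathbb N\}$, $\ \mathcal U^{(M)}=\varprojlim_{h\to\infty}\mathcal U^{M,h}$, $\ \mathcal U^{\{M\}}=\varinjlim_{h\to0^+}\mathcal U^{M,h}$; - $\mathcal P^{M,h}(\mathbb C^d)=\{P\in\mathcal O(\mathbb C^d): \sup_{z\in V_n}|P(z)|e^{-\nu_M(h\operatorname{Re}z)}<\infty\ \forall n\in\mathbb N\}$; - $\mathcal O_C^{M,h}(\mathbb R^d)=\varinjlim_{n\in\mathbb N}\mathcal O_C^{M,h,n}(\mathbb R^d)$, where $\mathcal O_C^{M,h,n}(\mathbb R^d)=\{\varphi\in C^\infty(\mathbb R^d): \sup_{\alpha,x}h^{|\alpha|}|\partial^\alpha\varphi(x)|e^{-n|x|}/M_\alpha<\infty\}$; $\ \mathcal O'^{M,h}_C(\mathbb R^d)$ is its strong dual. All spaces carry the topology of the displayed seminorms, and the limits are locally convex limits. For a locally convex space $E$ put $\mathcal K'^{(M)}(\mathbb R^d;E)=\mathcal L(\mathcal K^{(M)}(\mathbb R^d),E)$ and $\mathcal U'^{(M)}(\mathbb C^d;E)=\mathcal L(\mathcal U^{(M)}(\mathbb C^d),E)$.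 Let $\mathcal F(\varphi)(\xi)=\int_{\mathbb R^d}\varphi(x)e^{-2\pi i x\cdot\xi}\,dx$ (with $\xi\in\mathbb C^d$ for $\varphi\in\mathcal K^{(M)}(\mathbb R^d)$, and $\xi\in\mathbb R^d$ for $\varphi\in\mathcal U^{\{M\}}(\mathbb C^d)$), $\check\varphi(x)=\varphi(-x)$, and, for $g\in\mathcal O'^{M,h}_C(\mathbb R^d)$ and $\varphi\in\mathcal K^{(M)}(\mathbb R^d)$, $(g*\varphi)(x)=\langle g(t),\varphi(x-t)\rangle$. By duality, $\langle P\cdot\mathbf f,\varphi\rangle=\langle\mathbf f,P\cdot\varphi\rangle$ and $\langle\mathcal F(\mathbf f),\varphi\rangle=\langle\mathbf f,\mathcal F(\varphi)\rangle$ for $\mathbf f\in\mathcal U'^{(M)}(\mathbb C^d;E)$, and $\langle g*\mathbf g,\varphi\rangle=\langle\mathbf g,(g*\check\varphi)\check{\ }\rangle$ for $\mathbf g\in\mathcal K'^{(M)}(\mathbb R^d;E)$. Proposition. Let $d\ge1$ and let $M$ be a weight sequence such that, for some constants $C_0,H\ge1$, $M_{p+q}\le C_0H^{p+q}M_pM_q$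 for all $p,q\in\mathbb N$. Assume $\mathcal K^{(M)}(\mathbb R^d)\ne\{0\}$. Then multiplication by $P\in\mathcal P^{M,h}(\mathbb C^d)$ on $\mathcal U^{(M)}(\mathbb C^d)$, the maps $\varphi\mapsto\check\varphi$ on $\mathcal K^{(M)}(\mathbb R^d)$ and $\mathcal F:\mathcal K^{(M)}(\mathbb R^d)\to\mathcal U^{(M)}(\mathbb C^d)$, and the convolution operators below are well defined and continuous, and there are continuous linear maps $$\widetilde{\mathcal F}_h:\mathcal P^{M,h}(\mathbb C^d)\to\mathcal O'^{M,2\sqrt d Hh/\pi}_C(\mathbb R^d),\qquad h>0,$$ such that the following hold. 1. For all $h>0$, $P\in\mathcal P^{M,h}(\mathbb C^d)$, every sequentially complete locally convex Hausdorff space $E$ over $\mathbb C$ and every $\mathbf f\in\mathcal U'^{(M)}(\mathbb C^d;E)$, $$\mathcal F(P\cdot\mathbf f)=\widetilde{\mathcal F}_h(P)*\mathcal F(\mathbf f).$$ 2. Put $h'=2\sqrt dHh/\pi$ and $k'=2\sqrt dHk/\pi$. For all $0<k<h$ the following maps are well defined, linear and continuous: the Fourier transform $\mathcal F:\mathcal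 U^{\{M\}}(\mathbb C^d)\to\mathcal K^{\{M\}}(\mathbb R^d)$; the inclusions $\mathcal U^{\{M\}}(\mathbb C^d)\subseteq\mathcal P^{M,k}(\mathbb C^d)\subseteq\mathcal P^{M,h}(\mathbb C^d)$ and $\mathcal O^{M,h'}_C(\mathbb R^d)\subseteq\mathcal O^{M,k'}_C(\mathbb R^d)$; the transpose $\rho:\mathcal O'^{M,k'}_C(\mathbb R^d)\to\mathcal O'^{M,h'}_C(\mathbb R^d)$ of the latter; and the maps $\iota_{k'}:\mathcal K^{\{M\}}(\mathbb R^d)\to\mathcal O'^{M,k'}_C(\mathbb R^d)$ and $\iota_{h'}:\mathcal K^{\{M\}}(\mathbb R^d)\to\mathcal O'^{M,h'}_C(\mathbb R^d)$ given by $\varphi\mapsto(\psi\mapsto\int_{\mathbb R^d}\varphi(x)\psi(x)\,dx)$. Moreover $$\widetilde{\mathcal F}_k|_{\mathcal U^{\{M\}}}=\iota_{k'}\circ\mathcal F,\qquad \widetilde{\mathcal F}_h|_{\mathcal P^{M,k}}=\rho\circ\widetilde{\mathcal F}_k,\qquad \rho\circ\iota_{k'}=\iota_{h'}.$$ -/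

import Mathlib

open Real Filter Topology MeasureTheory
open scoped ContDiff FourierTransform

/-! # Weight sequences -/

/-- `M` is a weight sequence: positive, `M 0 = M 1 = 1`, `M p ^ (1 / p) → ∞`, log-convex. -/
structure IsWeightSequence (M : ℕ → ℝ) : Prop where
  pos : ∀ p, 0 < M p
  zero : M 0 = 1
  one : M 1 = 1
  root_tendsto : Tendsto (fun p : ℕ => M p ^ (1 / (p : ℝ))) atTop atTop
  log_convex : ∀ p, M (p + 1) ^ 2 ≤ M p * M (p + 2)

/-- Condition `(M.2)` with the constants `C₀, H ≥ 1`. -/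
structure ConditionM2 (M : ℕ → ℝ) (C₀ H : ℝ) : Prop where
  one_le_C₀ : 1 ≤ C₀
  one_le_H : 1 ≤ H
  le : ∀ p q, M (p + q) ≤ C₀ * H ^ (p + q) * M p * M q

/-- The associated function `ν_M(t) = sup_p log (t ^ p / M p)`, for `t ≥ 0`.  At `t = 0` the terms
with `p ≥ 1` are `0` by convention instead of `-∞`; the term `p = 0` equals `0`, so the supremum
has the right value. -/
noncomputable def assocFun (M : ℕ → ℝ) (t : ℝ) : ℝ :=
  ⨆ p : ℕ, Real.log (t ^ p / M p)

/-! # Locally convex spaces given by suprema of linear functionals -/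

section LocallyConvex

variable {V : Type} [AddCommGroup V] [Module ℂ V]

/-- The vectors `v` such that `sup_j |ℓ i j v| < ∞` for every `i`. -/
def boundedSubmodule {I : Type} {J : I → Type} (l : ∀ i, J i → V →ₗ[ℂ] ℂ) : Submodule ℂ V where
  carrier := {v | ∀ i, BddAbove (Set.range fun j => ‖l i j v‖)}
  zero_mem' := fun i => ⟨0, by rintro _ ⟨j, rfl⟩; simp⟩
  add_mem' := by
    intro v w hv hw i
    obtain ⟨a, ha⟩ := hv i
    obtain ⟨b, hb⟩ := hw i
    refine ⟨a + b, ?_⟩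
    rintro _ ⟨j, rfl⟩
    have h1 := ha ⟨j, rfl⟩
    have h2 := hb ⟨j, rfl⟩
    simp only [map_add] at *
    exact (norm_add_le _ _).trans (add_le_add h1 h2)
  smul_mem' := by
    intro c v hv i
    obtain ⟨a, ha⟩ := hv i
    refine ⟨‖c‖ * a, ?_⟩
    rintro _ ⟨j, rfl⟩
    have h1 := ha ⟨j, rfl⟩
    simp only [map_smul, norm_smul] at *
    exact mul_le_mul_of_nonneg_left h1 (norm_nonneg c)

/-- The space of all `v` such that every `p_i(v) = sup_j |ℓ i j v|` is finite, endowed below with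
the locally convex topology generated by the seminorms `p_i`. -/
def SupSpace {I : Type} {J : I → Type} (l : ∀ i, J i → V →ₗ[ℂ] ℂ) : Type :=
  ↥(boundedSubmodule l)

namespace SupSpace

variable {I : Type} {J : I → Type} (l : ∀ i, J i → V →ₗ[ℂ] ℂ)

noncomputable instance : AddCommGroup (SupSpace l) :=
  inferInstanceAs (AddCommGroup ↥(boundedSubmodule l))

noncomputable instance : Module ℂ (SupSpace l) :=
  inferInstanceAs (Module ℂ ↥(boundedSubmodule l))

variable {l} in
/-- The underlying vector. -/
def val : SupSpace l →ₗ[ℂ] V := (boundedSubmodule l).subtype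

/-- The seminorm `p_i(v) = sup_j |ℓ i j v|`. -/
noncomputable def seminorm (i : I) : Seminorm ℂ (SupSpace l) :=
  Seminorm.of (fun v => ⨆ j, ‖l i j v.val‖)
    (by
      intro v w
      have hv : BddAbove (Set.range fun j => ‖l i j v.val‖) := v.2 i
      have hw : BddAbove (Set.range fun j => ‖l i j w.val‖) := w.2 i
      refine Real.iSup_le (fun j => ?_)
        (add_nonneg (Real.iSup_nonneg fun _ => norm_nonneg _)
          (Real.iSup_nonneg fun _ => norm_nonneg _))
      rw [map_add, map_add]
      exact (norm_add_le _ _).trans (add_le_add (le_ciSup hv j) (le_ciSup hw j)))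
    (by
      intro c v
      rw [Real.mul_iSup_of_nonneg (norm_nonneg c)]
      simp only [map_smul, norm_smul])

noncomputable instance [Nonempty I] : TopologicalSpace (SupSpace l) :=
  (SeminormFamily.moduleFilterBasis (𝕜 := ℂ) (seminorm l)).topology

theorem withSeminorms [Nonempty I] : WithSeminorms (seminorm l) := ⟨rfl⟩

instance [Nonempty I] : IsTopologicalAddGroup (SupSpace l) := (withSeminorms l).topologicalAddGroup

instance [Nonempty I] : ContinuousSMul ℂ (SupSpace l) := (withSeminorms l).continuousSMul

end SupSpace

/-- The span in `V` of a family of spaces `SupSpace (l a)`, endowed below with the locally convex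
inductive limit topology.  For a nested family, as in all cases below, the span is the union. -/
def IndSpace {A I : Type} {J : I → Type} (l : A → ∀ i, J i → V →ₗ[ℂ] ℂ) : Type :=
  ↥(⨆ a, boundedSubmodule (l a))

namespace IndSpace

variable {A I : Type} {J : I → Type} (l : A → ∀ i, J i → V →ₗ[ℂ] ℂ)

noncomputable instance : AddCommGroup (IndSpace l) :=
  inferInstanceAs (AddCommGroup ↥(⨆ a, boundedSubmodule (l a)))

noncomputable instance : Module ℂ (IndSpace l) :=
  inferInstanceAs (Module ℂ ↥(⨆ a, boundedSubmodule (l a)))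

variable {l} in
/-- The underlying vector. -/
def val : IndSpace l →ₗ[ℂ] V := (⨆ a, boundedSubmodule (l a)).subtype

/-- The inclusion of a step into the inductive limit. -/
def ofStep (a : A) : SupSpace (l a) →ₗ[ℂ] IndSpace l :=
  Submodule.inclusion (le_iSup (fun a => boundedSubmodule (l a)) a)

variable [Nonempty I]

/-- The seminorms on the union whose restriction to every step is continuous. -/
def StepSeminorm : Type :=
  {p : Seminorm ℂ (IndSpace l) // ∀ a, Continuous fun v : SupSpace (l a) => p (ofStep l a v)}

instance : Nonempty (StepSeminorm l) :=
  ⟨⟨0, fun _ => continuous_const⟩⟩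

/-- The family of all seminorms on the union whose restriction to every step is continuous. -/
def seminormFamily : SeminormFamily ℂ (IndSpace l) (StepSeminorm l) := fun p => p.1

/-- The inductive limit topology, i.e. the finest locally convex topology for which the inclusions
of the steps are continuous: it is generated by all seminorms that are continuous on every step. -/
noncomputable instance : TopologicalSpace (IndSpace l) :=
  (seminormFamily l).moduleFilterBasis.topology

theorem withSeminorms : WithSeminorms (seminormFamily l) := ⟨rfl⟩

instance : IsTopologicalAddGroup (IndSpace l) := (withSeminorms l).topologicalAddGroup

instance : ContinuousSMul ℂ (IndSpace l) := (withSeminorms l).continuousSMul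

end IndSpace

end LocallyConvex

/-! # Smooth functions on `ℝ^d` and entire functions on `ℂ^d` -/

/-- The space `C^∞(ℝ^d)` of smooth complex-valued functions. -/
def smoothSubmodule (d : ℕ) : Submodule ℂ (EuclideanSpace ℝ (Fin d) → ℂ) where
  carrier := {φ | ContDiff ℝ ∞ φ}
  zero_mem' := by
    change ContDiff ℝ ∞ (fun _ => (0 : ℂ))
    exact contDiff_const
  add_mem' := by
    intro f g hf hg
    change ContDiff ℝ ∞ (fun x => f x + g x)
    exact ContDiff.add hf hg
  smul_mem' := by
    intro c f hf
    change ContDiff ℝ ∞ (fun x => c • f x)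
    exact ContDiff.const_smul c hf

/-- `C^∞(ℝ^d)` as a type. -/
abbrev SmoothFun (d : ℕ) : Type := ↥(smoothSubmodule d)

theorem SmoothFun.contDiff {d : ℕ} (φ : SmoothFun d) : ContDiff ℝ ∞ φ.1 := φ.2

/-- The partial derivative `∂_i` on `C^∞(ℝ^d)`. -/
noncomputable def partialDeriv {d : ℕ} (i : Fin d) : Module.End ℂ (SmoothFun d) where
  toFun φ := ⟨fun x => fderiv ℝ φ.1 x (EuclideanSpace.single i 1),
    (φ.contDiff.fderiv_right (m := ∞) (by simp)).clm_apply contDiff_const⟩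
  map_add' φ ψ := by
    ext x
    have h1 : DifferentiableAt ℝ φ.1 x :=
      φ.contDiff.differentiable (by simp) x
    have h2 : DifferentiableAt ℝ ψ.1 x :=
      ψ.contDiff.differentiable (by simp) x
    change fderiv ℝ (φ.1 + ψ.1) x _ = fderiv ℝ φ.1 x _ + fderiv ℝ ψ.1 x _
    rw [fderiv_add h1 h2]
    rfl
  map_smul' c φ := by
    ext x
    have h1 : DifferentiableAt ℝ φ.1 x :=
      φ.contDiff.differentiable (by simp) x
    change fderiv ℝ (c • φ.1) x _ = c • fderiv ℝ φ.1 x _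
    rw [fderiv_const_smul h1]
    rfl

/-- The derivative `∂^α = ∂_0^{α_0} ⋯ ∂_{d-1}^{α_{d-1}}` on `C^∞(ℝ^d)`, for a multi-index `α`. -/
noncomputable def multiDeriv {d : ℕ} (α : Fin d → ℕ) : Module.End ℂ (SmoothFun d) :=
  ((List.finRange d).map fun i => partialDeriv i ^ α i).prod

/-- The functional `φ ↦ ∂^α φ(x)` on `C^∞(ℝ^d)`. -/
noncomputable def evalDeriv {d : ℕ} (α : Fin d → ℕ) (x : EuclideanSpace ℝ (Fin d)) :
    SmoothFun d →ₗ[ℂ] ℂ :=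
  (LinearMap.proj x ∘ₗ (smoothSubmodule d).subtype) ∘ₗ multiDeriv α

/-- The space `𝒪(ℂ^d)` of entire functions. -/
def entireSubmodule (d : ℕ) : Submodule ℂ (EuclideanSpace ℂ (Fin d) → ℂ) where
  carrier := {φ | Differentiable ℂ φ}
  zero_mem' := differentiable_const 0
  add_mem' := fun h1 h2 => Differentiable.add h1 h2
  smul_mem' := fun c _ h => Differentiable.const_smul h c

/-- `𝒪(ℂ^d)` as a type. -/
abbrev EntireFun (d : ℕ) : Type := ↥(entireSubmodule d)

/-- The functional `φ ↦ φ(z)` on `𝒪(ℂ^d)`. -/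
def evalEntire {d : ℕ} (z : EuclideanSpace ℂ (Fin d)) : EntireFun d →ₗ[ℂ] ℂ :=
  LinearMap.proj z ∘ₗ (entireSubmodule d).subtype

/-- `Re z ∈ ℝ^d` for `z ∈ ℂ^d`. -/
noncomputable def reVec {d : ℕ} (z : EuclideanSpace ℂ (Fin d)) : EuclideanSpace ℝ (Fin d) :=
  WithLp.toLp 2 fun i => (z i).re

/-- `Im z ∈ ℝ^d` for `z ∈ ℂ^d`. -/
noncomputable def imVec {d : ℕ} (z : EuclideanSpace ℂ (Fin d)) : EuclideanSpace ℝ (Fin d) :=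
  WithLp.toLp 2 fun i => (z i).im

/-- The inclusion `ℝ^d ⊆ ℂ^d`. -/
noncomputable def ofRealVec {d : ℕ} (x : EuclideanSpace ℝ (Fin d)) : EuclideanSpace ℂ (Fin d) :=
  WithLp.toLp 2 fun i => (x i : ℂ)

/-- The tube domain `V_L = ℝ^d + i B(0, L)`. -/
def tube (d : ℕ) (L : ℝ) : Set (EuclideanSpace ℂ (Fin d)) := {z | ‖imVec z‖ < L}

/-! # The function spaces -/

section Spaces

variable (d : ℕ) (M : ℕ → ℝ)

/-- `φ ↦ h ^ |α| ∂^α φ(x) e^{c|x|} / M_{|α|}`. -/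
noncomputable def weightedDeriv (h c : ℝ)
    (j : (Fin d → ℕ) × EuclideanSpace ℝ (Fin d)) : SmoothFun d →ₗ[ℂ] ℂ :=
  ((h ^ (∑ i, j.1 i) * Real.exp (c * ‖j.2‖) / M (∑ i, j.1 i) : ℝ) : ℂ) • evalDeriv j.1 j.2

/-- The Fréchet space `𝒦^{M,h}(ℝ^d)`, with the seminorms
`sup_{α, x} h ^ |α| |∂^α φ(x)| e^{n|x|} / M_{|α|}`, `n ∈ ℕ`. -/
abbrev KStep (h : ℝ) : Type :=
  SupSpace fun n : ℕ => weightedDeriv d M h (n : ℝ)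

/-- `𝒦^{(M)}(ℝ^d)`, the projective limit of the spaces `𝒦^{M,h}(ℝ^d)` as `h → ∞`. -/
abbrev KBeurling : Type :=
  SupSpace fun i : Set.Ioi (0 : ℝ) × ℕ => weightedDeriv d M (i.1 : ℝ) (i.2 : ℝ)

/-- `𝒦^{{M}}(ℝ^d)`, the inductive limit of the spaces `𝒦^{M,h}(ℝ^d)` as `h → 0⁺`. -/
abbrev KRoumieu : Type :=
  IndSpace fun (h : Set.Ioi (0 : ℝ)) (n : ℕ) => weightedDeriv d M (h : ℝ) (n : ℝ)

/-- The Banach space `𝒪_C^{M,h,n}(ℝ^d)`, with the norm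
`sup_{α, x} h ^ |α| |∂^α φ(x)| e^{-n|x|} / M_{|α|}`. -/
abbrev OCStep (h : ℝ) (n : ℕ) : Type :=
  SupSpace fun _ : Unit => weightedDeriv d M h (-(n : ℝ))

/-- `𝒪_C^{M,h}(ℝ^d)`, the inductive limit of the spaces `𝒪_C^{M,h,n}(ℝ^d)`, `n ∈ ℕ`. -/
abbrev OC (h : ℝ) : Type :=
  IndSpace fun (n : ℕ) (_ : Unit) => weightedDeriv d M h (-(n : ℝ))

/-- `φ ↦ φ(z) e^{ν_M(h Re z)}` for `z` in the tube `V_L`. -/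
noncomputable def weightedDecay (h L : ℝ) (z : ↥(tube d L)) : EntireFun d →ₗ[ℂ] ℂ :=
  ((Real.exp (assocFun M (h * ‖reVec z.1‖)) : ℝ) : ℂ) • evalEntire z.1

/-- `φ ↦ φ(z) e^{-ν_M(h Re z)}` for `z` in the tube `V_L`. -/
noncomputable def weightedGrowth (h L : ℝ) (z : ↥(tube d L)) : EntireFun d →ₗ[ℂ] ℂ :=
  ((Real.exp (-assocFun M (h * ‖reVec z.1‖)) : ℝ) : ℂ) • evalEntire z.1

/-- The Fréchet space `𝒰^{M,h}(ℂ^d)`, with the seminorms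
`sup_{z ∈ V_n} |φ(z)| e^{ν_M(h Re z)}`, `n ∈ ℕ`. -/
abbrev UStep (h : ℝ) : Type :=
  SupSpace fun n : ℕ => weightedDecay d M h (n : ℝ)

/-- `𝒰^{(M)}(ℂ^d)`, the projective limit of the spaces `𝒰^{M,h}(ℂ^d)` as `h → ∞`. -/
abbrev UBeurling : Type :=
  SupSpace fun i : Set.Ioi (0 : ℝ) × ℕ => weightedDecay d M (i.1 : ℝ) (i.2 : ℝ)

/-- `𝒰^{{M}}(ℂ^d)`, the inductive limit of the spaces `𝒰^{M,h}(ℂ^d)` as `h → 0⁺`. -/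
abbrev URoumieu : Type :=
  IndSpace fun (h : Set.Ioi (0 : ℝ)) (n : ℕ) => weightedDecay d M (h : ℝ) (n : ℝ)

/-- The Fréchet space `𝒫^{M,h}(ℂ^d)`, with the seminorms
`sup_{z ∈ V_n} |φ(z)| e^{-ν_M(h Re z)}`, `n ∈ ℕ`. -/
abbrev PSpace (h : ℝ) : Type :=
  SupSpace fun n : ℕ => weightedGrowth d M h (n : ℝ)

/-- `𝒪'_C^{M,h}(ℝ^d)`, the dual of `𝒪_C^{M,h}(ℝ^d)` with the topology of uniform convergence on
bounded sets (the strong dual). -/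
abbrev OCDual (h : ℝ) : Type := StrongDual ℂ (OC d M h)

end Spaces

/-! # Multiplication, Fourier transform and convolution

Each of the following properties determines the operator `A` uniquely. -/

section Operators

variable {d : ℕ} {M : ℕ → ℝ}

/-- `A` is the Fourier transform `𝒦^{(M)}(ℝ^d) → 𝒰^{(M)}(ℂ^d)`,
`φ ↦ ∫ φ(x) e^{-2πi x·z} dx`. -/
def IsFourierBeurling (A : KBeurling d M →L[ℂ] UBeurling d M) : Prop :=
  ∀ (φ : KBeurling d M) (z : EuclideanSpace ℂ (Fin d)),
    (A φ).val.1 z = ∫ x : EuclideanSpace ℝ (Fin d),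
      φ.val.1 x * Complex.exp (-(2 * (π : ℂ) * Complex.I) * ∑ j, (x j : ℂ) * z j)

/-- `A` is the Fourier transform `𝒰^{{M}}(ℂ^d) → 𝒦^{{M}}(ℝ^d)`,
`φ ↦ ∫_{ℝ^d} φ(x) e^{-2πi x·ξ} dx`. -/
def IsFourierRoumieu (A : URoumieu d M →L[ℂ] KRoumieu d M) : Prop :=
  ∀ (φ : URoumieu d M) (ξ : EuclideanSpace ℝ (Fin d)),
    (A φ).val.1 ξ = 𝓕 (fun x : EuclideanSpace ℝ (Fin d) => φ.val.1 (ofRealVec x)) ξ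

/-- `A` is the reflection `φ ↦ φ(-·)` of `𝒦^{(M)}(ℝ^d)`. -/
def IsReflection (A : KBeurling d M →L[ℂ] KBeurling d M) : Prop :=
  ∀ (φ : KBeurling d M) (x : EuclideanSpace ℝ (Fin d)), (A φ).val.1 x = φ.val.1 (-x)

/-- `A` is the multiplication operator `φ ↦ P · φ` on `𝒰^{(M)}(ℂ^d)`. -/
def IsMultiplication {h : ℝ} (P : PSpace d M h) (A : UBeurling d M →L[ℂ] UBeurling d M) : Prop :=
  ∀ (φ : UBeurling d M) (z : EuclideanSpace ℂ (Fin d)), (A φ).val.1 z = P.val.1 z * φ.val.1 z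

/-- `A` is the convolution operator `φ ↦ g ∗ φ` on `𝒦^{(M)}(ℝ^d)`, where
`(g ∗ φ)(x) = ⟨g(t), φ(x - t)⟩`; here `φ(x - ·)` is required to belong to `𝒪_C^{M,h}(ℝ^d)`. -/
def IsConvolution {h : ℝ} (g : OCDual d M h) (A : KBeurling d M →L[ℂ] KBeurling d M) : Prop :=
  ∀ (φ : KBeurling d M) (x : EuclideanSpace ℝ (Fin d)),
    ∃ χ : OC d M h, (∀ t, χ.val.1 t = φ.val.1 (x - t)) ∧ (A φ).val.1 x = g χ

/-- `A` is the inclusion `𝒦^{{M}}(ℝ^d) → 𝒪'_C^{M,h}(ℝ^d)`, `φ ↦ (ψ ↦ ∫ φ(x) ψ(x) dx)`, where the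
integral is required to converge absolutely. -/
def IsDualInclusion {h : ℝ} (A : KRoumieu d M →L[ℂ] OCDual d M h) : Prop :=
  ∀ (φ : KRoumieu d M) (ψ : OC d M h),
    Integrable (fun x : EuclideanSpace ℝ (Fin d) => φ.val.1 x * ψ.val.1 x) ∧
      A φ ψ = ∫ x : EuclideanSpace ℝ (Fin d), φ.val.1 x * ψ.val.1 x

end Operators

/-! # Continuous maps between the locally convex spaces -/

section Constructors

variable {V V' : Type} [AddCommGroup V] [Module ℂ V] [AddCommGroup V'] [Module ℂ V']

namespace SupSpace

variable {I : Type} {J : I → Type} {l : ∀ i, J i → V →ₗ[ℂ] ℂ}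
variable {I' : Type} {J' : I' → Type} {l' : ∀ i, J' i → V' →ₗ[ℂ] ℂ}

/-! The point is to give a meaning to the Fourier transform of `P`, which may grow like `e^{ν_M(h Re
z)}`. Formally `⟨F(P), ψ⟩ = ∫ P · F(ψ)`, but `ψ ∈ 𝒪_C` grows exponentially and has no classical
transform. Therefore `ψ` is localised. Fix a window `χ` in the class of `𝒦^{(M)}` with integral one
(a normalised `|φ|²`, `φ ≠ 0`). Then `ψ = ∫ ψ χ(t - ·) dt`, and the transform of `P` is defined on
`ψ` by `∫ (∫ P(ξ) F(ψ χ(t - ·))(ξ) dξ) dt`, which is `windowPairing`.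

Convergence in `ξ`: integration by parts along one coordinate shows that `F(ψ χ(t - ·))` decays like
`e^{-ν_M(2Hh|Re z|)}` on horizontal strips. The index `2√d H h / π` is made for this: `√d` pays for
the choice of a coordinate, the `2` in `2√d` is matched with the Leibniz rule and monotonicity of
`ν_M`, and `H` comes from (M.2) in the form `e^{2ν_M(t)} ≤ C₀ e^{ν_M(Ht)}`. The product with `P`
then still decays like `e^{-ν_M(h|Re z|)}`, faster than every power
(`IsWindow.exists_norm_mul_laplace_windowed_le`).

Convergence in `t`: the inner integrand is entire, so the integral over `ℝ^d` may be moved to `ℝ^d +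
iη` (`integral_shift_eq`). With `η` opposite to `t` and of suitable length this gains more than the
exponential growth of `ψ` and leaves `e^{-|t|}` (`IsWindow.exists_norm_windowIntegral_le`). The
bounds are linear in a seminorm of `P` and in the norm of `ψ` in a step; since bounded sets of `𝒪_C`
are bounded in a step, they also give continuity into the strong dual.

The identities follow from Fubini and `∫ χ = 1`. On exponentially decaying `φ` the pairing is `∫ P ·
F(φ)`; applied to `φ(x - ·)` this says `g ∗ φ = F(P · F(φˇ))` with `g` the transform of `P`, so that
the convolution operator is a composition of known continuous maps, and the exchange formula is
Fourier inversion on `𝒰^{(M)}`. For `P ∈ 𝒰^{{M}}`, Parseval for each fixed `t` turns the pairing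
into `∫ F(P) ψ`. The pairing does not involve `h`, so compatibility with `ρ` is immediate. -/

theorem val_mem (v : SupSpace l) : v.val ∈ boundedSubmodule l := v.2

theorem val_injective : Function.Injective (val : SupSpace l → V) := Subtype.val_injective

/-- The vector of `SupSpace l` with a given underlying vector. -/
def mk (v : V) (hv : v ∈ boundedSubmodule l) : SupSpace l := ⟨v, hv⟩

theorem norm_le_seminorm (v : SupSpace l) (i : I) (j : J i) :
    ‖l i j v.val‖ ≤ seminorm l i v :=
  le_ciSup (f := fun j => ‖l i j v.val‖) (v.2 i) j

theorem seminorm_le {v : SupSpace l} {i : I} {C : ℝ} (hC : 0 ≤ C)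
    (h : ∀ j, ‖l i j v.val‖ ≤ C) : seminorm l i v ≤ C :=
  Real.iSup_le h hC

theorem mem_boundedSubmodule {v : V} (h : ∀ i, ∃ C, ∀ j, ‖l i j v‖ ≤ C) :
    v ∈ boundedSubmodule l := fun i => by
  obtain ⟨C, hC⟩ := h i
  exact ⟨C, by rintro _ ⟨j, rfl⟩; exact hC j⟩

theorem continuous_seminorm [Nonempty I] (i : I) : Continuous (seminorm l i) :=
  (withSeminorms l).continuous_seminorm i

theorem continuous_of_bound [Nonempty I] {F ι : Type*} [AddCommGroup F] [Module ℂ F]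
    [TopologicalSpace F] {q : SeminormFamily ℂ F ι} (hq : WithSeminorms q) (f : SupSpace l →ₗ[ℂ] F)
    (h : ∀ k, ∃ i C, ∀ v, q k (f v) ≤ C * seminorm l i v) : Continuous f := by
  refine (withSeminorms l).continuous_of_isBounded hq f fun k => ?_
  obtain ⟨i, C, hC⟩ := h k
  refine ⟨{i}, C.toNNReal, fun v => ?_⟩
  rw [Finset.sup_singleton]
  refine (hC v).trans ?_
  change C * _ ≤ ((C.toNNReal : NNReal) : ℝ) * _
  exact mul_le_mul_of_nonneg_right (Real.le_coe_toNNReal C) (apply_nonneg _ _)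

/-- A linear map into the ambient space which satisfies the relevant estimates, as a continuous
linear map. -/
noncomputable def lift [Nonempty I] [Nonempty I'] (T : SupSpace l →ₗ[ℂ] V')
    (h : ∀ i', ∃ i C, ∀ v j', ‖l' i' j' (T v)‖ ≤ C * seminorm l i v) :
    SupSpace l →L[ℂ] SupSpace l' where
  toLinearMap := T.codRestrict (boundedSubmodule l') fun v => mem_boundedSubmodule fun i' => by
    obtain ⟨i, C, hC⟩ := h i'
    exact ⟨_, hC v⟩
  cont := continuous_of_bound (withSeminorms l') _ fun i' => by
    obtain ⟨i, C, hC⟩ := h i'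
    refine ⟨i, |C|, fun v => seminorm_le (by positivity) fun j' => (hC v j').trans ?_⟩
    exact mul_le_mul_of_nonneg_right (le_abs_self C) (apply_nonneg _ _)

@[simp] theorem val_lift [Nonempty I] [Nonempty I'] (T : SupSpace l →ₗ[ℂ] V')
    (h : ∀ i', ∃ i C, ∀ v j', ‖l' i' j' (T v)‖ ≤ C * seminorm l i v) (v : SupSpace l) :
    (lift T h v).val = T v := rfl

end SupSpace

namespace IndSpace

variable {A I : Type} {J : I → Type} {l : A → ∀ i, J i → V →ₗ[ℂ] ℂ}
variable {A' I' : Type} {J' : I' → Type}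

@[simp] theorem val_ofStep (a : A) (v : SupSpace (l a)) : (ofStep l a v).val = v.val := rfl

theorem exists_ofStep [Nonempty A] (h : Directed (· ≤ ·) fun a => boundedSubmodule (l a))
    (v : IndSpace l) : ∃ a w, v = ofStep l a w := by
  obtain ⟨a, ha⟩ := (Submodule.mem_iSup_of_directed _ h).1 v.2
  exact ⟨a, ⟨v.1, ha⟩, rfl⟩

/-- The underlying space is a span of the steps, so steps and sums suffice and no directedness is
needed. -/
theorem induction [Nonempty A] {p : IndSpace l → Prop} (step : ∀ a w, p (ofStep l a w))
    (add : ∀ v w, p v → p w → p (v + w)) (v : IndSpace l) : p v := by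
  obtain ⟨v, hv⟩ := v
  induction hv using Submodule.iSup_induction' with
  | mem a x hx => exact step a ⟨x, hx⟩
  | zero => exact step (Classical.arbitrary A) 0
  | add x y hx hy h1 h2 => exact add _ _ h1 h2

variable [Nonempty I]

/-- The pullback of a seminorm of the target along `f` is itself one of the seminorms generating the
inductive limit topology, so it is bounded by itself with constant 1. -/
theorem continuous_of_steps {F ι : Type*} [AddCommGroup F] [Module ℂ F]
    [TopologicalSpace F] {q : SeminormFamily ℂ F ι} (hq : WithSeminorms q)
    (f : IndSpace l →ₗ[ℂ] F)
    (h : ∀ a k, Continuous fun v : SupSpace (l a) => q k (f (ofStep l a v))) :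
    Continuous f := by
  refine (withSeminorms l).continuous_of_isBounded hq f fun k => ?_
  let p : StepSeminorm l := ⟨(q k).comp f, fun a => h a k⟩
  refine ⟨{p}, 1, ?_⟩
  rw [Finset.sup_singleton, one_smul]
  exact le_rfl

theorem continuous_of_bound {F ι : Type*} [AddCommGroup F] [Module ℂ F]
    [TopologicalSpace F] {q : SeminormFamily ℂ F ι} (hq : WithSeminorms q)
    (f : IndSpace l →ₗ[ℂ] F)
    (h : ∀ a k, ∃ i C, ∀ v, q k (f (ofStep l a v)) ≤ C * SupSpace.seminorm (l a) i v) :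
    Continuous f := by
  refine continuous_of_steps hq f fun a k => ?_
  obtain ⟨i, C, hC⟩ := h a k
  have h1 : Continuous (C.toNNReal • SupSpace.seminorm (l a) i : Seminorm ℂ (SupSpace (l a))) :=
    (SupSpace.continuous_seminorm (l := l a) i).const_smul C.toNNReal
  refine Seminorm.continuous_of_le (p := ((q k).comp f).comp (ofStep l a)) h1 fun v => ?_
  refine (hC v).trans ?_
  change C * _ ≤ ((C.toNNReal : NNReal) : ℝ) * _
  exact mul_le_mul_of_nonneg_right (Real.le_coe_toNNReal C) (apply_nonneg _ _)

variable [Nonempty A]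

/-- A linear map into the ambient space of a `SupSpace` which satisfies the relevant estimates on
every step, as a continuous linear map. -/
noncomputable def liftSup [Nonempty I'] {l' : ∀ i, J' i → V' →ₗ[ℂ] ℂ} (T : IndSpace l →ₗ[ℂ] V')
    (h : ∀ a i', ∃ i C, ∀ v j', ‖l' i' j' (T (ofStep l a v))‖ ≤ C * SupSpace.seminorm (l a) i v) :
    IndSpace l →L[ℂ] SupSpace l' where
  toLinearMap := T.codRestrict (boundedSubmodule l') fun v => by
    refine induction (p := fun v => T v ∈ boundedSubmodule l') (fun a w => ?_) (fun v w hv hw => ?_) v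
    · refine SupSpace.mem_boundedSubmodule fun i' => ?_
      obtain ⟨i, C, hC⟩ := h a i'
      exact ⟨_, hC w⟩
    · rw [map_add]
      exact add_mem hv hw
  cont := continuous_of_bound (SupSpace.withSeminorms l') _ fun a i' => by
    obtain ⟨i, C, hC⟩ := h a i'
    refine ⟨i, |C|, fun v => SupSpace.seminorm_le (by positivity) fun j' => (hC v j').trans ?_⟩
    exact mul_le_mul_of_nonneg_right (le_abs_self C) (apply_nonneg _ _)

@[simp] theorem val_liftSup [Nonempty I'] {l' : ∀ i, J' i → V' →ₗ[ℂ] ℂ} (T : IndSpace l →ₗ[ℂ] V')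
    (h : ∀ a i', ∃ i C, ∀ v j', ‖l' i' j' (T (ofStep l a v))‖ ≤ C * SupSpace.seminorm (l a) i v)
    (v : IndSpace l) : (liftSup T h v).val = T v := rfl

/-- A linear map into the ambient space of an `IndSpace` which satisfies the relevant estimates on
every step, as a continuous linear map. -/
noncomputable def lift [Nonempty I'] {l' : A' → ∀ i, J' i → V' →ₗ[ℂ] ℂ} (T : IndSpace l →ₗ[ℂ] V')
    (h : ∀ a, ∃ a', ∀ i', ∃ i C, ∀ v j',
      ‖l' a' i' j' (T (ofStep l a v))‖ ≤ C * SupSpace.seminorm (l a) i v) :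
    IndSpace l →L[ℂ] IndSpace l' where
  toLinearMap := T.codRestrict (⨆ a, boundedSubmodule (l' a)) fun v => by
    refine induction (p := fun v => T v ∈ ⨆ a, boundedSubmodule (l' a)) (fun a w => ?_)
      (fun v w hv hw => ?_) v
    · obtain ⟨a', h'⟩ := h a
      refine le_iSup (fun a => boundedSubmodule (l' a)) a' ?_
      refine SupSpace.mem_boundedSubmodule fun i' => ?_
      obtain ⟨i, C, hC⟩ := h' i'
      exact ⟨_, hC w⟩
    · rw [map_add]
      exact add_mem hv hw
  cont := continuous_of_steps (withSeminorms l') _ fun a p => by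
    obtain ⟨a', h'⟩ := h a
    exact (p.2 a').comp (SupSpace.lift (T ∘ₗ ofStep l a) h').continuous

@[simp] theorem val_lift [Nonempty I'] {l' : A' → ∀ i, J' i → V' →ₗ[ℂ] ℂ} (T : IndSpace l →ₗ[ℂ] V')
    (h : ∀ a, ∃ a', ∀ i', ∃ i C, ∀ v j',
      ‖l' a' i' j' (T (ofStep l a v))‖ ≤ C * SupSpace.seminorm (l a) i v)
    (v : IndSpace l) : (lift T h v).val = T v := rfl

/-- A bounded subset of an inductive limit of weighted sup-normed spaces, with weights that
decrease along the sequence and have bounded quotients at every point, is bounded in a step. -/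
theorem exists_bound_of_isVonNBounded {J : Type} {l : ℕ → Unit → J → V →ₗ[ℂ] ℂ}
    (h1 : ∀ n m j, ∃ K, ∀ v, ‖l n () j v‖ ≤ K * ‖l m () j v‖)
    (h2 : ∀ m n j, m ≤ n → ∀ v, ‖l n () j v‖ ≤ ‖l m () j v‖) {B : Set (IndSpace l)}
    (hB : Bornology.IsVonNBounded ℂ B) :
    ∃ n C, ∀ v ∈ B, ∀ j, ‖l n () j v.val‖ ≤ C := by
  by_contra! hcon
  choose v hvB j hj using fun n : ℕ => hcon n n
  choose K hK using h1
  -- If the claim fails, `v n` violates the bound `n` in step `n` at some point `j n`. Evaluation at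
  -- these countably many points is a continuous map into bounded sequences: on step `a` the terms
  -- with `n ≥ a` are controlled by monotonicity of the weights, the finitely many with `n < a` by
  -- the quotients `K`. The image of `B` is then bounded, a contradiction.
  let T : IndSpace l →L[ℂ] SupSpace (fun (_ : Unit) n => l n () (j n)) :=
    liftSup val fun a _ => ⟨(), 1 + ∑ n ∈ Finset.range a, |K n a (j n)|, fun w n => by
      rw [val_ofStep]
      have h0 : 0 ≤ SupSpace.seminorm (l a) () w := apply_nonneg _ _
      rcases le_or_gt a n with hn | hn
      · refine (h2 a n (j n) hn w.val).trans ((SupSpace.norm_le_seminorm w () (j n)).trans ?_)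
        exact le_mul_of_one_le_left h0
          (le_add_of_nonneg_right (Finset.sum_nonneg fun _ _ => abs_nonneg _))
      · refine (hK n a (j n) w.val).trans (mul_le_mul ((le_abs_self _).trans ?_)
          (SupSpace.norm_le_seminorm w () (j n)) (norm_nonneg _) (by positivity))
        refine (Finset.single_le_sum (f := fun n => |K n a (j n)|) (fun _ _ => abs_nonneg _)
          (Finset.mem_range.2 hn)).trans (by linarith)⟩
  have hTB : Bornology.IsVonNBounded ℂ (T '' B) := hB.image T
  obtain ⟨r, -, hr⟩ := (WithSeminorms.image_isVonNBounded_iff_seminorm_bounded _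
    (SupSpace.withSeminorms _)).1 hTB ()
  obtain ⟨n, hn⟩ := exists_nat_gt r
  have h3 := hr (v n) (hvB n)
  have h4 := SupSpace.norm_le_seminorm (T (v n)) () n
  have h5 : ‖l n () (j n) (v n).val‖ ≤ SupSpace.seminorm _ () (T (v n)) := h4
  linarith [hj n]

end IndSpace

end Constructors

/-- Neighbourhoods of zero in the strong dual are given by a bounded set `B` and a radius, so one
continuous seminorm for each `B` is enough. -/
theorem StrongDual.continuous_of_bound {X Y : Type*} [AddCommGroup X] [Module ℂ X]
    [TopologicalSpace X] [IsTopologicalAddGroup X] [AddCommGroup Y] [Module ℂ Y]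
    [TopologicalSpace Y] (f : X →ₗ[ℂ] StrongDual ℂ Y)
    (h : ∀ B : Set Y, Bornology.IsVonNBounded ℂ B → ∃ p : Seminorm ℂ X, Continuous p ∧
      ∀ x, ∀ y ∈ B, ‖f x y‖ ≤ p x) : Continuous f := by
  refine continuous_of_continuousAt_zero f ?_
  rw [ContinuousAt, map_zero, (ContinuousLinearMap.hasBasis_nhds_zero_of_basis
    Metric.nhds_basis_ball).tendsto_right_iff]
  rintro ⟨B, ε⟩ ⟨hB, hε⟩
  obtain ⟨p, hp, hpB⟩ := h B hB
  have h0 : ∀ᶠ x in 𝓝 (0 : X), p x < ε := by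
    have := hp.tendsto 0
    rw [map_zero] at this
    exact this.eventually_lt_const hε
  filter_upwards [h0] with x hx y hy
  rw [mem_ball_zero_iff]
  exact (hpB x y hy).trans_lt hx



/-! # Weight sequences and their associated functions -/

namespace IsWeightSequence

variable {M : ℕ → ℝ} (hM : IsWeightSequence M)
include hM

/-- By log-convexity `M (p + 1) / M p` is nondecreasing; since `M 0 = 1`, multiplying the comparison
of these quotients `q` times gives the claim. -/
theorem mul_le (p q : ℕ) : M p * M q ≤ M (p + q) := by
  have hmono : Monotone fun p => M (p + 1) / M p := by
    refine monotone_nat_of_le_succ fun p => ?_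
    rw [div_le_div_iff₀ (hM.pos p) (hM.pos (p + 1))]
    have := hM.log_convex p
    rw [pow_two] at this
    linarith [mul_comm (M p) (M (p + 2))]
  induction q with
  | zero => simp [hM.zero]
  | succ q ih =>
    have h1 : M (q + 1) = M q * (M (q + 1) / M q) := by field_simp [(hM.pos q).ne']
    have h2 : M (p + q + 1) = M (p + q) * (M (p + q + 1) / M (p + q)) := by
      field_simp [(hM.pos (p + q)).ne']
    rw [h1, ← add_assoc, h2, ← mul_assoc]
    exact mul_le_mul ih (hmono (Nat.le_add_left q p))
      (div_nonneg (hM.pos _).le (hM.pos _).le) (hM.pos _).le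

/-- From some index on `M p ^ (1 / p) ≥ a`; the finitely many other terms are absorbed in `C`. This
makes the supremum defining `ν_M` finite. -/
theorem exists_pow_le {a : ℝ} (ha : 0 ≤ a) : ∃ C, 1 ≤ C ∧ ∀ p, a ^ p ≤ C * M p := by
  obtain ⟨N, hN⟩ := eventually_atTop.1
    -- The condition `p ≥ 1` is needed for `(M p ^ (1 / p)) ^ p = M p`.
    ((hM.root_tendsto.eventually_ge_atTop a).and (eventually_ge_atTop 1))
  have h0 : ∀ p, 0 ≤ a ^ p / M p := fun p => div_nonneg (pow_nonneg ha p) (hM.pos p).le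
  refine ⟨1 + ∑ p ∈ Finset.range N, a ^ p / M p,
    le_add_of_nonneg_right (Finset.sum_nonneg fun p _ => h0 p), fun p => ?_⟩
  rw [← div_le_iff₀ (hM.pos p)]
  rcases lt_or_ge p N with hp | hp
  · exact (Finset.single_le_sum (f := fun p => a ^ p / M p) (fun p _ => h0 p)
      (Finset.mem_range.2 hp)).trans (by linarith)
  · obtain ⟨h1, h2⟩ := hN p hp
    have h3 : a ^ p ≤ M p := by
      have := pow_le_pow_left₀ ha h1 p
      rwa [← Real.rpow_natCast (M p ^ _), ← Real.rpow_mul (hM.pos p).le, one_div,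
        inv_mul_cancel₀ (by positivity), Real.rpow_one] at this
    have h4 : a ^ p / M p ≤ 1 := (div_le_one (hM.pos p)).2 h3
    exact h4.trans (le_add_of_nonneg_right (Finset.sum_nonneg fun p _ => h0 p))

theorem bddAbove_log {t : ℝ} (ht : 0 ≤ t) :
    BddAbove (Set.range fun p : ℕ => Real.log (t ^ p / M p)) := by
  obtain ⟨C, hC, h⟩ := hM.exists_pow_le ht
  refine ⟨Real.log C, ?_⟩
  rintro _ ⟨p, rfl⟩
  -- For `t = 0` and `p ≥ 1` the quotient is zero and `Real.log 0 = 0`; the bound still holds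
  -- because `C ≥ 1`.
  rcases (div_nonneg (pow_nonneg ht p) (hM.pos p).le).eq_or_lt with h0 | h0
  · simpa [← h0] using Real.log_nonneg hC
  · exact Real.log_le_log h0 ((div_le_iff₀ (hM.pos p)).2 (h p))

theorem assocFun_nonneg {t : ℝ} (ht : 0 ≤ t) : 0 ≤ assocFun M t := by
  have := le_ciSup (hM.bddAbove_log ht) 0
  simpa [hM.zero, assocFun] using this

/-- Together with `mul_exp_assocFun_le` this characterises `e^{ν_M(t)}` as the least `A` with `t ^ p
≤ A * M p` for all `p`, so that later estimates can be made with powers instead of logarithms. -/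
theorem pow_le {t : ℝ} (ht : 0 ≤ t) (p : ℕ) : t ^ p ≤ M p * Real.exp (assocFun M t) := by
  rw [mul_comm, ← div_le_iff₀ (hM.pos p)]
  rcases (div_nonneg (pow_nonneg ht p) (hM.pos p).le).eq_or_lt with h0 | h0
  · rw [← h0]; exact (Real.exp_pos _).le
  · rw [← Real.log_le_iff_le_exp h0]
    exact le_ciSup (hM.bddAbove_log ht) p

theorem mul_exp_assocFun_le {X A t : ℝ} (hX : 0 ≤ X) (ht : 0 ≤ t)
    (h : ∀ p, X * t ^ p ≤ A * M p) : X * Real.exp (assocFun M t) ≤ A := by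
  have hXA : X ≤ A := by simpa [hM.zero] using h 0
  rcases hX.eq_or_lt with rfl | hX
  · simpa using hXA
  have hA : 1 ≤ A / X := (one_le_div hX).2 hXA
  rw [mul_comm, ← le_div_iff₀ hX, ← Real.le_log_iff_exp_le (by linarith)]
  refine ciSup_le fun p => ?_
  rcases (div_nonneg (pow_nonneg ht p) (hM.pos p).le).eq_or_lt with h0 | h0
  · simpa [← h0] using Real.log_nonneg hA
  · refine Real.log_le_log h0 ?_
    rw [div_le_div_iff₀ (hM.pos p) hX, mul_comm]
    exact h p

theorem assocFun_mono {s t : ℝ} (hs : 0 ≤ s) (hst : s ≤ t) : assocFun M s ≤ assocFun M t := by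
  rw [← Real.exp_le_exp]
  have := hM.mul_exp_assocFun_le (X := 1) (A := Real.exp (assocFun M t)) zero_le_one hs fun p => by
    rw [one_mul, mul_comm]
    exact (pow_le_pow_left₀ hs hst p).trans (hM.pow_le (hs.trans hst) p)
  rwa [one_mul] at this

/-- Decay like `e^{-ν_M(ht)}` beats every power; with `k = d + 1` it gives integrability over `ℝ^d`.
-/
theorem exists_one_add_pow_le {h : ℝ} (hh : 0 < h) (k : ℕ) :
    ∃ C, 0 < C ∧ ∀ t, 0 ≤ t → (1 + t) ^ k ≤ C * Real.exp (assocFun M (h * t)) := by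
  refine ⟨2 ^ (k - 1) * (1 + M k / h ^ k), mul_pos (by positivity)
    (add_pos zero_lt_one (div_pos (hM.pos k) (by positivity))), fun t ht => ?_⟩
  have h1 := add_pow_le zero_le_one ht k
  have h2 : (1 : ℝ) ≤ Real.exp (assocFun M (h * t)) :=
    Real.one_le_exp (hM.assocFun_nonneg (by positivity))
  have h3 : t ^ k ≤ M k / h ^ k * Real.exp (assocFun M (h * t)) := by
    have := hM.pow_le (t := h * t) (by positivity) k
    rw [mul_pow] at this
    rw [div_mul_eq_mul_div, le_div_iff₀ (by positivity)]
    linarith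
  refine h1.trans ?_
  rw [one_pow, mul_assoc]
  refine mul_le_mul_of_nonneg_left ?_ (by positivity)
  rw [add_mul, one_mul]
  exact add_le_add h2 h3

end IsWeightSequence

namespace ConditionM2

variable {M : ℕ → ℝ} {C₀ H : ℝ} (hM2 : ConditionM2 M C₀ H) (hM : IsWeightSequence M)
include hM2 hM

/-- (M.2) bounds `t ^ p * t ^ q = H ^ (-(p + q)) * (H * t) ^ (p + q)` by `C₀ * M p * M q *
e^{ν_M(Ht)}`; now take the suprema over `p` and `q` separately. -/
theorem exp_mul_exp_le {t : ℝ} (ht : 0 ≤ t) :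
    Real.exp (assocFun M t) * Real.exp (assocFun M t) ≤ C₀ * Real.exp (assocFun M (H * t)) := by
  have hH : 0 < H := zero_lt_one.trans_le hM2.one_le_H
  refine hM.mul_exp_assocFun_le (Real.exp_pos _).le ht fun q => ?_
  rw [mul_comm]
  refine hM.mul_exp_assocFun_le (by positivity) ht fun p => ?_
  have h1 := hM.pow_le (t := H * t) (by positivity) (p + q)
  have h2 := hM2.le p q
  have h3 : (H * t) ^ (p + q) ≤ C₀ * H ^ (p + q) * M p * M q * Real.exp (assocFun M (H * t)) :=
    h1.trans (mul_le_mul_of_nonneg_right h2 (Real.exp_pos _).le)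
  rw [mul_pow] at h3
  refine le_of_mul_le_mul_left (a := H ^ (p + q)) ?_ (by positivity)
  calc H ^ (p + q) * (t ^ q * t ^ p) = H ^ (p + q) * t ^ (p + q) := by ring
    _ ≤ _ := h3
    _ = _ := by ring

/-- By `exp_mul_exp_le` already `H * t` suffices; the weaker form with `2 * H` is the one that
arises from `dualIndex`. -/
theorem exp_mul_exp_neg_le {t : ℝ} (ht : 0 ≤ t) :
    Real.exp (assocFun M t) * Real.exp (-assocFun M (2 * H * t)) ≤
      C₀ * Real.exp (-assocFun M t) := by
  have hH := hM2.one_le_H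
  have h1 := hM2.exp_mul_exp_le hM ht
  have h2 : Real.exp (assocFun M (H * t)) ≤ Real.exp (assocFun M (2 * H * t)) :=
    Real.exp_le_exp.2 (hM.assocFun_mono (by positivity) (by nlinarith [mul_nonneg (zero_le_one.trans hH) ht]))
  rw [Real.exp_neg, Real.exp_neg, ← div_eq_mul_inv, ← div_eq_mul_inv,
    div_le_div_iff₀ (Real.exp_pos _) (Real.exp_pos _)]
  exact h1.trans (mul_le_mul_of_nonneg_left h2 (zero_le_one.trans hM2.one_le_C₀))

/-- Used to bound derivatives of order `p` of a Fourier integral at height `b`, where `(1 + t) ^ k`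
provides integrability. The `2 ^ p` comes from splitting `(t + b) ^ p`, the `H ^ p` from (M.2)
applied to `t ^ (p + k)`, and the powers of `b` are negligible since `M p` grows faster than
geometrically. -/
theorem exists_add_pow_mul_le {h : ℝ} (hh : 0 < h) {b : ℝ} (hb : 0 ≤ b) (k : ℕ) :
    ∃ C, 0 < C ∧ ∀ (p : ℕ) (t : ℝ), 0 ≤ t →
      (t + b) ^ p * (1 + t) ^ k ≤ C * (2 * H / h) ^ p * M p * Real.exp (assocFun M (h * t)) := by
  have hH : 1 ≤ H := hM2.one_le_H
  have hH0 : 0 < H := zero_lt_one.trans_le hH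
  have hC0 : 0 < C₀ := zero_lt_one.trans_le hM2.one_le_C₀
  obtain ⟨C₁, hC₁, h1⟩ := hM.exists_one_add_pow_le hh k
  -- The base is chosen so that `b ^ p` equals its `p`-th power times `(H / h) ^ p`.
  obtain ⟨C₂, hC₂, h2⟩ := hM.exists_pow_le (a := b * h / H) (by positivity)
  have hMk := hM.pos k
  refine ⟨2 ^ k * (1 + C₀ * H ^ k * M k / h ^ k) + C₂ * C₁, by positivity, fun p t ht => ?_⟩
  have hMp := hM.pos p
  set e := Real.exp (assocFun M (h * t)) with he
  have hexp : 0 < e := Real.exp_pos _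
  have hb2 : b ^ p ≤ C₂ * (H / h) ^ p * M p := by
    have := h2 p
    have h3 : b ^ p = (b * h / H) ^ p * (H / h) ^ p := by
      rw [← mul_pow]; congr 1; field_simp
    rw [h3]
    calc _ ≤ C₂ * M p * (H / h) ^ p := mul_le_mul_of_nonneg_right this (by positivity)
      _ = _ := by ring
  have ht2 : ∀ q, t ^ q ≤ M q / h ^ q * e := fun q => by
    have := hM.pow_le (t := h * t) (by positivity) q
    rw [mul_pow] at this
    rw [div_mul_eq_mul_div, le_div_iff₀ (by positivity)]
    linarith
  have hHp : 1 ≤ H ^ p := one_le_pow₀ hH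
  have h4 : t ^ p ≤ (H / h) ^ p * M p * e := by
    refine (ht2 p).trans ?_
    rw [div_pow, div_mul_eq_mul_div, div_mul_eq_mul_div, div_mul_eq_mul_div]
    gcongr
    nlinarith
  have h5 : t ^ (p + k) ≤ (H / h) ^ p * M p * (C₀ * H ^ k * M k / h ^ k) * e := by
    refine (ht2 (p + k)).trans ?_
    have := hM2.le p k
    calc M (p + k) / h ^ (p + k) * e ≤ (C₀ * H ^ (p + k) * M p * M k) / h ^ (p + k) * e := by
          gcongr
      _ = _ := by rw [div_pow, pow_add, pow_add]; field_simp
  have h6 : (t + b) ^ p ≤ 2 ^ p * (t ^ p + b ^ p) :=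
    (add_pow_le ht hb p).trans (mul_le_mul_of_nonneg_right
      (pow_le_pow_right₀ one_le_two (Nat.sub_le p 1)) (by positivity))
  have h7 : (1 + t) ^ k ≤ 2 ^ k * (1 + t ^ k) := by
    have := add_pow_le zero_le_one ht k
    rw [one_pow] at this
    exact this.trans (mul_le_mul_of_nonneg_right
      (pow_le_pow_right₀ one_le_two (Nat.sub_le k 1)) (by positivity))
  calc (t + b) ^ p * (1 + t) ^ k ≤ 2 ^ p * (t ^ p + b ^ p) * (1 + t) ^ k := by gcongr
    _ = 2 ^ p * (t ^ p * (1 + t) ^ k + b ^ p * (1 + t) ^ k) := by ring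
    _ ≤ 2 ^ p * (t ^ p * (2 ^ k * (1 + t ^ k)) + (C₂ * (H / h) ^ p * M p) * (C₁ * e)) := by
      gcongr
      exact h1 t ht
    _ = 2 ^ p * (2 ^ k * (t ^ p + t ^ (p + k)) + (C₂ * (H / h) ^ p * M p) * (C₁ * e)) := by ring
    _ ≤ 2 ^ p * (2 ^ k * ((H / h) ^ p * M p * e +
          (H / h) ^ p * M p * (C₀ * H ^ k * M k / h ^ k) * e) +
          (C₂ * (H / h) ^ p * M p) * (C₁ * e)) := by gcongr
    _ = _ := by rw [mul_div_assoc 2 H h, mul_pow]; ring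

end ConditionM2


/-! # Derivatives of smooth functions -/

section Multi

variable {d : ℕ}

/-- Both products run over the coordinates in the same order, so partial derivatives need not be
commuted. Used for reflections (`D i = -∂_i`) and for the Fourier transform (`D i` multiplication by
`-2πi x_i`). -/
theorem multiDeriv_intertwine {W : Type*} [AddCommGroup W] [Module ℂ W] (T : W →ₗ[ℂ] SmoothFun d)
    (D : Fin d → Module.End ℂ W) (h : ∀ i w, partialDeriv i (T w) = T (D i w)) (α : Fin d → ℕ)
    (w : W) :
    multiDeriv α (T w) = T (((List.finRange d).map fun i => D i ^ α i).prod w) := by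
  have hp : ∀ i n w, (partialDeriv i ^ n) (T w) = T ((D i ^ n) w) := fun i n => by
    induction n with
    | zero => intro w; rfl
    | succ n ih => intro w; rw [pow_succ, Module.End.mul_apply, h, ih, pow_succ]; rfl
  have hl : ∀ (L : List (Fin d)) w, (L.map fun i => partialDeriv i ^ α i).prod (T w) =
      T ((L.map fun i => D i ^ α i).prod w) := fun L => by
    induction L with
    | nil => intro w; rfl
    | cons a L ih =>
      intro w
      rw [List.map_cons, List.prod_cons, Module.End.mul_apply, ih, hp, List.map_cons,
        List.prod_cons]
      rfl
  exact hl _ w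

theorem List.prod_map_smul_end {W ι : Type*} [AddCommGroup W] [Module ℂ W] (c : ι → ℂ)
    (D : ι → Module.End ℂ W) (L : List ι) :
    (L.map fun i => c i • D i).prod = (L.map c).prod • (L.map D).prod := by
  induction L with
  | nil => simp
  | cons a L ih => simp only [List.map_cons, List.prod_cons, ih, smul_mul_smul_comm]

/-- Passes from multi-index seminorms to pure coordinate derivatives, which are all that the decay
of Fourier–Laplace transforms requires. -/
theorem multiDeriv_single (j : Fin d) (p : ℕ) :
    multiDeriv (Pi.single j p : Fin d → ℕ) = partialDeriv j ^ p := by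
  rw [multiDeriv, List.prod_map_eq_pow_single j]
  · rw [List.count_eq_one_of_mem (List.nodup_finRange d) (List.mem_finRange j), pow_one,
      Pi.single_eq_same]
  · intro i hi _
    rw [Pi.single_eq_of_ne hi, pow_zero]

theorem norm_weightedDeriv_le_iff {M : ℕ → ℝ} (hM : IsWeightSequence M) {h : ℝ} (hh : 0 < h)
    (c S : ℝ) (α : Fin d → ℕ) (x : EuclideanSpace ℝ (Fin d)) (u : SmoothFun d) :
    ‖weightedDeriv d M h c (α, x) u‖ ≤ S ↔ ‖(multiDeriv α u).1 x‖ ≤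
      S * Real.exp (-c * ‖x‖) * h⁻¹ ^ (∑ i, α i) * M (∑ i, α i) := by
  have hMp := hM.pos (∑ i, α i)
  have h1 : weightedDeriv d M h c (α, x) u =
      ((h ^ (∑ i, α i) * Real.exp (c * ‖x‖) / M (∑ i, α i) : ℝ) : ℂ) * (multiDeriv α u).1 x := rfl
  rw [h1, norm_mul, Complex.norm_real, Real.norm_of_nonneg (by positivity), neg_mul, Real.exp_neg,
    inv_pow, div_mul_eq_mul_div, div_le_iff₀ hMp]
  have he := Real.exp_pos (c * ‖x‖)
  have hhp : 0 < h ^ (∑ i, α i) := by positivity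
  rw [← mul_le_mul_iff_right₀ (mul_pos hhp he) (b := ‖(multiDeriv α u).1 x‖)]
  have h2 : h ^ (∑ i, α i) * Real.exp (c * ‖x‖) * (S * (Real.exp (c * ‖x‖))⁻¹ *
    (h ^ (∑ i, α i))⁻¹ * M (∑ i, α i)) = S * M (∑ i, α i) := by field_simp
  rw [h2]

end Multi

/-! ### Products, conjugates and reflections, and bounds for coordinate derivatives. -/

namespace SmoothFun

variable {d : ℕ}

@[ext] theorem ext' {u v : SmoothFun d} (h : ∀ x, u.1 x = v.1 x) : u = v :=
  Subtype.ext (funext h)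

theorem continuous (u : SmoothFun d) : Continuous u.1 := u.contDiff.continuous

theorem differentiable (u : SmoothFun d) : Differentiable ℝ u.1 :=
  u.contDiff.differentiable (by simp)

/-- The product of two smooth functions. -/
def mul (u v : SmoothFun d) : SmoothFun d := ⟨fun x => u.1 x * v.1 x, ContDiff.mul u.contDiff v.contDiff⟩

/-- The complex conjugate of a smooth function. -/
noncomputable def conj (u : SmoothFun d) : SmoothFun d :=
  ⟨fun x => (starRingEnd ℂ) (u.1 x), Complex.conjCLE.contDiff.comp u.contDiff⟩

/-- The operator `u ↦ u(x - ·)`. -/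
def reflect (x : EuclideanSpace ℝ (Fin d)) : SmoothFun d →ₗ[ℂ] SmoothFun d where
  toFun u := ⟨fun t => u.1 (x - t), ContDiff.comp u.contDiff (contDiff_const.sub contDiff_id)⟩
  map_add' _ _ := rfl
  map_smul' _ _ := rfl

@[simp] theorem mul_apply (u v : SmoothFun d) (x : EuclideanSpace ℝ (Fin d)) :
    (mul u v).1 x = u.1 x * v.1 x := rfl

@[simp] theorem reflect_apply (x t : EuclideanSpace ℝ (Fin d)) (u : SmoothFun d) :
    (reflect x u).1 t = u.1 (x - t) := rfl

theorem partialDeriv_mul (i : Fin d) (u v : SmoothFun d) :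
    partialDeriv i (mul u v) = mul (partialDeriv i u) v + mul u (partialDeriv i v) := by
  ext x
  change fderiv ℝ (u.1 * v.1) x _ = fderiv ℝ u.1 x _ * v.1 x + u.1 x * fderiv ℝ v.1 x _
  rw [fderiv_mul (u.differentiable x) (v.differentiable x)]
  simp only [add_apply, smul_apply, smul_eq_mul]
  ring

theorem partialDeriv_conj (i : Fin d) (u : SmoothFun d) :
    partialDeriv i (conj u) = conj (partialDeriv i u) := by
  ext x
  change fderiv ℝ (Complex.conjCLE ∘ u.1) x _ = (starRingEnd ℂ) (fderiv ℝ u.1 x _)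
  rw [ContinuousLinearEquiv.comp_fderiv]
  rfl

theorem partialDeriv_reflect (i : Fin d) (x : EuclideanSpace ℝ (Fin d)) (u : SmoothFun d) :
    partialDeriv i (reflect x u) = reflect x ((-1 : ℂ) • partialDeriv i u) := by
  ext t
  change fderiv ℝ (fun t => u.1 (x - t)) t _ = (-1 : ℂ) • fderiv ℝ u.1 (x - t) _
  have h1 : HasFDerivAt (fun t => u.1 (x - t))
      ((fderiv ℝ u.1 (x - t)).comp (-ContinuousLinearMap.id ℝ _)) t :=
    (u.differentiable (x - t)).hasFDerivAt.comp t ((hasFDerivAt_id t).const_sub x)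
  rw [h1.fderiv]
  simp

theorem multiDeriv_reflect (α : Fin d → ℕ) (x : EuclideanSpace ℝ (Fin d)) (u : SmoothFun d) :
    multiDeriv α (reflect x u) = (-1 : ℂ) ^ (∑ i, α i) • reflect x (multiDeriv α u) := by
  rw [multiDeriv_intertwine (reflect x) (fun i => (-1 : ℂ) • partialDeriv i)
    (fun i w => partialDeriv_reflect i x w)]
  simp only [smul_pow]
  rw [List.prod_map_smul_end, LinearMap.smul_apply, map_smul, ← Fin.prod_univ_def,
    Finset.prod_pow_eq_pow_sum]
  rfl

theorem norm_multiDeriv_reflect (α : Fin d → ℕ) (x t : EuclideanSpace ℝ (Fin d))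
    (u : SmoothFun d) :
    ‖(multiDeriv α (reflect x u)).1 t‖ = ‖(multiDeriv α u).1 (x - t)‖ := by
  rw [multiDeriv_reflect]
  change ‖(-1 : ℂ) ^ (∑ i, α i) * (multiDeriv α u).1 (x - t)‖ = _
  simp

/-- The derivatives of `u` along the coordinate axes satisfy
`|∂_j ^ p u(x)| ≤ B(x) r ^ p M_p`. -/
def DirBound (M : ℕ → ℝ) (u : SmoothFun d) (r : ℝ) (B : EuclideanSpace ℝ (Fin d) → ℝ) : Prop :=
  ∀ j p x, ‖((partialDeriv j ^ p) u).1 x‖ ≤ B x * r ^ p * M p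

namespace DirBound

variable {M : ℕ → ℝ} {u v : SmoothFun d} {r : ℝ} {B B' : EuclideanSpace ℝ (Fin d) → ℝ}

/-- The Leibniz rule yields `2 ^ p` terms counted with multiplicity, each bounded using `M a * M b ≤
M (a + b)`; hence the ratio doubles. -/
theorem mul (hM : IsWeightSequence M) (hr : 0 ≤ r) (hu : DirBound M u r B)
    (hv : DirBound M v r B') : DirBound M (u.mul v) (2 * r) (fun x => B x * B' x) := by
  intro j p x
  -- The induction is on the derivatives still to be distributed; `a` and `b` count those which have
  -- already fallen on `u` and `v`.
  have key : ∀ p a b, ‖((partialDeriv j ^ p)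
      (((partialDeriv j ^ a) u).mul ((partialDeriv j ^ b) v))).1 x‖ ≤
      B x * B' x * (2 * r) ^ p * r ^ (a + b) * M (p + (a + b)) := by
    intro p
    induction p with
    | zero =>
      intro a b
      have h1 := hu j a x
      have h2 := hv j b x
      have hB : 0 ≤ B x * B' x := by
        have h3 := (norm_nonneg _).trans (hu j 0 x)
        have h4 := (norm_nonneg _).trans (hv j 0 x)
        simp only [pow_zero, mul_one, hM.zero] at h3 h4
        positivity
      rw [pow_zero, Module.End.one_apply, mul_apply, norm_mul, zero_add, pow_zero, mul_one]
      calc _ ≤ (B x * r ^ a * M a) * (B' x * r ^ b * M b) :=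
            mul_le_mul h1 h2 (norm_nonneg _) ((norm_nonneg _).trans h1)
        _ = B x * B' x * r ^ (a + b) * (M a * M b) := by ring
        _ ≤ _ := by
          gcongr
          exact hM.mul_le a b
    | succ p ih =>
      intro a b
      rw [pow_succ, Module.End.mul_apply, partialDeriv_mul, map_add]
      have e1 : partialDeriv j ((partialDeriv j ^ a) u) = (partialDeriv j ^ (a + 1)) u := by
        rw [pow_succ']; rfl
      have e2 : partialDeriv j ((partialDeriv j ^ b) v) = (partialDeriv j ^ (b + 1)) v := by
        rw [pow_succ']; rfl
      rw [e1, e2]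
      refine (norm_add_le _ _).trans ((add_le_add (ih (a + 1) b) (ih a (b + 1))).trans_eq ?_)
      rw [show p + (a + 1 + b) = p + 1 + (a + b) by ring,
        show p + (a + (b + 1)) = p + 1 + (a + b) by ring]
      ring
  simpa using key p 0 0

theorem conj (hu : DirBound M u r B) : DirBound M u.conj r B := fun j p x => by
  have h : (partialDeriv j ^ p) u.conj = ((partialDeriv j ^ p) u).conj := by
    induction p with
    | zero => rfl
    | succ p ih => rw [pow_succ', Module.End.mul_apply, ih, partialDeriv_conj]; rfl
  rw [h]
  exact (RCLike.norm_conj _).trans_le (hu j p x)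

theorem reflect (hu : DirBound M u r B) (x : EuclideanSpace ℝ (Fin d)) :
    DirBound M (reflect x u) r (fun t => B (x - t)) := fun j p t => by
  rw [← multiDeriv_single, norm_multiDeriv_reflect, multiDeriv_single]
  exact hu j p (x - t)

theorem of_weightedDeriv (hM : IsWeightSequence M) {h c S : ℝ} (hh : 0 < h)
    (hu : ∀ j, ‖weightedDeriv d M h c j u‖ ≤ S) :
    DirBound M u h⁻¹ (fun x => S * Real.exp (-c * ‖x‖)) := fun j p x => by
  have := (norm_weightedDeriv_le_iff hM hh c S (Pi.single j p) x u).1 (hu _)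
  rwa [multiDeriv_single, Finset.sum_pi_single', if_pos (Finset.mem_univ j)] at this

end DirBound

end SmoothFun


/-! # The Fourier–Laplace transform -/

section Coordinates

variable {d : ℕ}

@[simp] theorem ofRealVec_apply (x : EuclideanSpace ℝ (Fin d)) (i : Fin d) :
    ofRealVec x i = (x i : ℂ) := rfl

@[simp] theorem reVec_apply (z : EuclideanSpace ℂ (Fin d)) (i : Fin d) :
    reVec z i = (z i).re := rfl

@[simp] theorem imVec_apply (z : EuclideanSpace ℂ (Fin d)) (i : Fin d) :
    imVec z i = (z i).im := rfl

theorem ofRealVec_add (x y : EuclideanSpace ℝ (Fin d)) :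
    ofRealVec (x + y) = ofRealVec x + ofRealVec y := by
  ext i; simp

theorem ofRealVec_smul (r : ℝ) (x : EuclideanSpace ℝ (Fin d)) :
    ofRealVec (r • x) = (r : ℂ) • ofRealVec x := by
  ext i; simp

@[simp] theorem reVec_shift (x η : EuclideanSpace ℝ (Fin d)) (w : ℂ) :
    reVec (ofRealVec x + w • ofRealVec η) = x + w.re • η := by
  ext i; simp

@[simp] theorem imVec_shift (x η : EuclideanSpace ℝ (Fin d)) (w : ℂ) :
    imVec (ofRealVec x + w • ofRealVec η) = w.im • η := by
  ext i; simp

@[simp] theorem reVec_ofRealVec (x : EuclideanSpace ℝ (Fin d)) : reVec (ofRealVec x) = x := by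
  ext i; simp

@[simp] theorem imVec_ofRealVec (x : EuclideanSpace ℝ (Fin d)) : imVec (ofRealVec x) = 0 := by
  ext i; simp

theorem eq_ofRealVec_add (z : EuclideanSpace ℂ (Fin d)) :
    z = ofRealVec (reVec z) + Complex.I • ofRealVec (imVec z) := by
  ext i
  simp only [PiLp.add_apply, PiLp.smul_apply, ofRealVec_apply, reVec_apply, imVec_apply,
    smul_eq_mul, mul_comm Complex.I]
  exact (Complex.re_add_im _).symm

theorem continuous_ofRealVec : Continuous (ofRealVec (d := d)) :=
  (PiLp.continuous_toLp 2 _).comp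
    (continuous_pi fun i => Complex.continuous_ofReal.comp (EuclideanSpace.proj i).continuous)

theorem norm_ofRealVec (x : EuclideanSpace ℝ (Fin d)) : ‖ofRealVec x‖ = ‖x‖ := by
  simp [EuclideanSpace.norm_eq]

theorem norm_le_re_add_im (z : EuclideanSpace ℂ (Fin d)) : ‖z‖ ≤ ‖reVec z‖ + ‖imVec z‖ := by
  conv_lhs => rw [eq_ofRealVec_add z]
  refine (norm_add_le _ _).trans_eq ?_
  rw [norm_smul, norm_ofRealVec, norm_ofRealVec, Complex.norm_I, one_mul]

theorem norm_imVec_le (z : EuclideanSpace ℂ (Fin d)) : ‖imVec z‖ ≤ ‖z‖ := by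
  rw [EuclideanSpace.norm_eq, EuclideanSpace.norm_eq]
  refine Real.sqrt_le_sqrt (Finset.sum_le_sum fun i _ => ?_)
  exact pow_le_pow_left₀ (norm_nonneg _) (Complex.abs_im_le_norm (z i)) 2

theorem imVec_add (z w : EuclideanSpace ℂ (Fin d)) : imVec (z + w) = imVec z + imVec w := by
  ext i; simp

/-- Take the largest coordinate; this is the origin of `√d` in the indices. -/
theorem exists_norm_le_sqrt_mul (hd : 0 < d) (x : EuclideanSpace ℝ (Fin d)) :
    ∃ j, ‖x‖ ≤ √(d : ℝ) * |x j| := by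
  have : Nonempty (Fin d) := ⟨⟨0, hd⟩⟩
  obtain ⟨j, -, hj⟩ := Finset.exists_max_image Finset.univ (fun i => |x i|) Finset.univ_nonempty
  refine ⟨j, ?_⟩
  rw [EuclideanSpace.norm_eq, ← Real.sqrt_sq (abs_nonneg (x j)), ← Real.sqrt_mul (Nat.cast_nonneg d)]
  refine Real.sqrt_le_sqrt ?_
  calc ∑ i, ‖x i‖ ^ 2 ≤ ∑ _i : Fin d, |x j| ^ 2 :=
        Finset.sum_le_sum fun i hi => pow_le_pow_left₀ (norm_nonneg _) (hj i hi) 2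
    _ = _ := by simp

end Coordinates

/-! ### Exponential decay and integrability. -/

section Decay

variable {d : ℕ}

theorem integrable_inv_one_add_norm_pow :
    Integrable fun x : EuclideanSpace ℝ (Fin d) => ((1 + ‖x‖) ^ (d + 1))⁻¹ := by
  have h := integrable_one_add_norm (E := EuclideanSpace ℝ (Fin d)) (μ := volume)
    (r := (d : ℝ) + 1) (by simp)
  refine h.congr (Eventually.of_forall fun x => ?_)
  have h0 : (0 : ℝ) ≤ 1 + ‖x‖ := by positivity
  simp only
  rw [Real.rpow_neg h0, ← Nat.cast_succ, Real.rpow_natCast]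

theorem exists_one_add_pow_le_exp (k : ℕ) {c : ℝ} (hc : 0 < c) :
    ∃ C, 0 < C ∧ ∀ t : ℝ, 0 ≤ t → (1 + t) ^ k ≤ C * Real.exp (c * t) := by
  refine ⟨k.factorial / c ^ k * Real.exp c, by positivity, fun t ht => ?_⟩
  have h := Real.pow_div_factorial_le_exp (c * (1 + t)) (by positivity) k
  rw [div_le_iff₀ (by positivity), mul_pow, mul_add, mul_one, Real.exp_add] at h
  rw [div_mul_eq_mul_div, div_mul_eq_mul_div, le_div_iff₀ (by positivity)]
  linarith

theorem integrable_exp_neg_mul_norm {c : ℝ} (hc : 0 < c) :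
    Integrable fun x : EuclideanSpace ℝ (Fin d) => Real.exp (-c * ‖x‖) := by
  obtain ⟨C, hC, h⟩ := exists_one_add_pow_le_exp (d + 1) hc
  refine (integrable_inv_one_add_norm_pow.const_mul C).mono'
    (by fun_prop) (Eventually.of_forall fun x => ?_)
  rw [Real.norm_of_nonneg (Real.exp_pos _).le, neg_mul, Real.exp_neg, ← div_eq_mul_inv,
    le_div_iff₀ (by positivity), inv_mul_le_iff₀ (Real.exp_pos _), mul_comm (Real.exp _)]
  exact h _ (norm_nonneg x)

/-- Continuous functions decaying faster than every exponential. -/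
structure ExpDecay {F : Type*} [NormedAddCommGroup F] (u : EuclideanSpace ℝ (Fin d) → F) : Prop where
  continuous : Continuous u
  exists_bound : ∀ c : ℝ, ∃ A, 0 ≤ A ∧ ∀ x, ‖u x‖ ≤ A * Real.exp (-c * ‖x‖)

namespace ExpDecay

variable {F : Type*} [NormedAddCommGroup F] {u : EuclideanSpace ℝ (Fin d) → F}

theorem of_norm_le_exp {G : Type*} [NormedAddCommGroup G] {v : EuclideanSpace ℝ (Fin d) → G}
    (hu : ExpDecay u) (hv : Continuous v) {K c : ℝ}
    (h : ∀ x, ‖v x‖ ≤ K * Real.exp (c * ‖x‖) * ‖u x‖) : ExpDecay v :=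
  ⟨hv, fun c' => by
    obtain ⟨A, hA, hb⟩ := hu.exists_bound (c' + c)
    refine ⟨|K| * A, by positivity, fun x => (h x).trans ?_⟩
    calc K * Real.exp (c * ‖x‖) * ‖u x‖ ≤
          |K| * Real.exp (c * ‖x‖) * (A * Real.exp (-(c' + c) * ‖x‖)) :=
          mul_le_mul (mul_le_mul_of_nonneg_right (le_abs_self K) (Real.exp_pos _).le) (hb x)
            (norm_nonneg _) (by positivity)
      _ = |K| * A * (Real.exp (c * ‖x‖) * Real.exp (-(c' + c) * ‖x‖)) := by ring
      _ = _ := by rw [← Real.exp_add]; ring_nf⟩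

theorem integrable (hu : ExpDecay u) : Integrable u := by
  obtain ⟨A, -, h⟩ := hu.exists_bound 1
  exact ((integrable_exp_neg_mul_norm one_pos).const_mul A).mono' hu.continuous.aestronglyMeasurable
    (Eventually.of_forall h)

end ExpDecay

end Decay

/-! ### The Laplace kernel, holomorphy and decay of transforms. -/

section Laplace

variable {d : ℕ}

/-- The kernel `e^{-2πi x·z}`. -/
noncomputable def laplaceKernel (x : EuclideanSpace ℝ (Fin d)) (z : EuclideanSpace ℂ (Fin d)) : ℂ :=
  Complex.exp (-(2 * (π : ℂ) * Complex.I) * ∑ j, (x j : ℂ) * z j)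

/-- The Fourier–Laplace transform. -/
noncomputable def laplace (u : EuclideanSpace ℝ (Fin d) → ℂ) (z : EuclideanSpace ℂ (Fin d)) : ℂ :=
  ∫ x, u x * laplaceKernel x z

/-- The exact value is kept beside the bound that follows, since contour shifts exploit the sign of
`x · Im z`. -/
theorem norm_laplaceKernel (x : EuclideanSpace ℝ (Fin d)) (z : EuclideanSpace ℂ (Fin d)) :
    ‖laplaceKernel x z‖ = Real.exp (2 * π * inner ℝ x (imVec z)) := by
  rw [laplaceKernel, Complex.norm_exp]
  congr 1
  rw [show -(2 * (π : ℂ) * Complex.I) * ∑ j, (x j : ℂ) * z j =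
    ((2 * π : ℝ) : ℂ) * (-(Complex.I * ∑ j, (x j : ℂ) * z j)) by push_cast; ring,
    Complex.re_ofReal_mul]
  congr 1
  simp [PiLp.inner_apply, mul_comm]

theorem norm_laplaceKernel_le (x : EuclideanSpace ℝ (Fin d)) (z : EuclideanSpace ℂ (Fin d)) :
    ‖laplaceKernel x z‖ ≤ Real.exp (2 * π * ‖imVec z‖ * ‖x‖) := by
  rw [norm_laplaceKernel, Real.exp_le_exp, mul_assoc (2 * π), mul_comm ‖imVec z‖]
  exact mul_le_mul_of_nonneg_left (real_inner_le_norm _ _) (by positivity)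

theorem continuous_laplaceKernel :
    Continuous fun p : EuclideanSpace ℝ (Fin d) × EuclideanSpace ℂ (Fin d) =>
      laplaceKernel p.1 p.2 := by
  unfold laplaceKernel
  fun_prop

theorem laplaceKernel_ofRealVec (x y : EuclideanSpace ℝ (Fin d)) :
    laplaceKernel x (ofRealVec y) = ((Real.fourierChar (-(inner ℝ x y)) : Circle) : ℂ) := by
  rw [laplaceKernel, Real.fourierChar_apply]
  congr 1
  have : ∑ j, (x j : ℂ) * ofRealVec y j = ((inner ℝ x y : ℝ) : ℂ) := by
    rw [PiLp.inner_apply]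
    push_cast
    exact Finset.sum_congr rfl fun j _ => by simp [mul_comm]
  rw [this]
  push_cast
  ring

theorem laplace_ofRealVec (u : EuclideanSpace ℝ (Fin d) → ℂ) (y : EuclideanSpace ℝ (Fin d)) :
    laplace u (ofRealVec y) = 𝓕 u y := by
  rw [Real.fourier_eq, laplace]
  refine integral_congr_ae (Eventually.of_forall fun x => ?_)
  simp only [laplaceKernel_ofRealVec, Circle.smul_def, smul_eq_mul, mul_comm]

/-- The linear form `z ↦ x·z`. -/
noncomputable def pairingCLM (x : EuclideanSpace ℝ (Fin d)) : EuclideanSpace ℂ (Fin d) →L[ℂ] ℂ :=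
  ∑ j, (x j : ℂ) • EuclideanSpace.proj j

theorem pairingCLM_apply (x : EuclideanSpace ℝ (Fin d)) (z : EuclideanSpace ℂ (Fin d)) :
    pairingCLM x z = ∑ j, (x j : ℂ) * z j := by
  simp [pairingCLM]

theorem norm_pairingCLM_le (x : EuclideanSpace ℝ (Fin d)) : ‖pairingCLM x‖ ≤ d * ‖x‖ := by
  refine ContinuousLinearMap.opNorm_le_bound _ (by positivity) fun z => ?_
  rw [pairingCLM_apply]
  refine (norm_sum_le _ _).trans ?_
  calc ∑ j, ‖(x j : ℂ) * z j‖ ≤ ∑ _j : Fin d, ‖x‖ * ‖z‖ := by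
        refine Finset.sum_le_sum fun j _ => ?_
        rw [norm_mul, Complex.norm_real]
        exact mul_le_mul (PiLp.norm_apply_le x j) (PiLp.norm_apply_le z j) (norm_nonneg _)
          (norm_nonneg _)
    _ = _ := by simp [mul_assoc]

theorem continuous_pairingCLM : Continuous (pairingCLM (d := d)) := by
  unfold pairingCLM
  fun_prop

theorem hasFDerivAt_laplaceKernel (x : EuclideanSpace ℝ (Fin d)) (z : EuclideanSpace ℂ (Fin d)) :
    HasFDerivAt (laplaceKernel x)
      ((laplaceKernel x z * -(2 * (π : ℂ) * Complex.I)) • pairingCLM x) z := by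
  have h : laplaceKernel x = fun z => Complex.exp (-(2 * (π : ℂ) * Complex.I) * pairingCLM x z) := by
    ext z; rw [pairingCLM_apply]; rfl
  rw [h]
  have := ((pairingCLM x).hasFDerivAt (x := z)).const_mul (-(2 * (π : ℂ) * Complex.I))
  rw [mul_smul]
  exact this.cexp

namespace ExpDecay

variable {u : EuclideanSpace ℝ (Fin d) → ℂ}

theorem mul_laplaceKernel (hu : ExpDecay u) (z : EuclideanSpace ℂ (Fin d)) :
    ExpDecay fun x => u x * laplaceKernel x z := by
  refine hu.of_norm_le_exp (K := 1) (c := 2 * π * ‖imVec z‖)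
    (hu.continuous.mul (continuous_laplaceKernel.comp (.prodMk_left z))) fun x => ?_
  rw [norm_mul, mul_comm, one_mul]
  exact mul_le_mul_of_nonneg_right (norm_laplaceKernel_le x z) (norm_nonneg _)

theorem differentiable_laplace (hu : ExpDecay u) : Differentiable ℂ (laplace u) := by
  intro z₀
  set R : ℝ := 2 * π * (‖imVec z₀‖ + 1)
  -- `R` is the exponent of the kernel on the unit ball around `z₀`. Of the surplus 2, one unit pays
  -- for the factor `‖x‖ ≤ e^{‖x‖}` from differentiation, the other leaves the integrable
  -- `e^{-‖x‖}`.
  obtain ⟨A, hA, hb⟩ := hu.exists_bound (R + 2)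
  refine (hasFDerivAt_integral_of_dominated_of_fderiv_le (𝕜 := ℂ) (μ := volume)
    (F := fun z x => u x * laplaceKernel x z)
    (F' := fun z x => u x • ((laplaceKernel x z * -(2 * (π : ℂ) * Complex.I)) • pairingCLM x))
    (bound := fun x => A * (2 * π * d) * Real.exp (-1 * ‖x‖))
    (s := Metric.ball z₀ 1) (Metric.ball_mem_nhds _ one_pos)
    (Eventually.of_forall fun z => (hu.mul_laplaceKernel z).continuous.aestronglyMeasurable)
    (hu.mul_laplaceKernel z₀).integrable ?_ (Eventually.of_forall fun x z hz => ?_)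
    ((integrable_exp_neg_mul_norm one_pos).const_mul _)
    (Eventually.of_forall fun x z _ =>
      (hasFDerivAt_laplaceKernel x z).const_mul (u x))).differentiableAt
  · have h1 : Continuous fun x => laplaceKernel x z₀ :=
      continuous_laplaceKernel.comp (.prodMk_left z₀)
    exact (hu.continuous.smul ((h1.mul continuous_const).smul
      continuous_pairingCLM)).aestronglyMeasurable
  · have hz' : ‖imVec z‖ ≤ ‖imVec z₀‖ + 1 := by
      have h1 : imVec z = imVec z₀ + imVec (z - z₀) := by rw [← imVec_add]; simp
      rw [h1]
      refine (norm_add_le _ _).trans ?_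
      have := norm_imVec_le (z - z₀)
      rw [mem_ball_iff_norm] at hz
      linarith
    have hk : ‖laplaceKernel x z‖ ≤ Real.exp (R * ‖x‖) := by
      refine (norm_laplaceKernel_le x z).trans (Real.exp_le_exp.2 ?_)
      simp only [R]
      gcongr
    have hx : ‖x‖ ≤ Real.exp ‖x‖ := by linarith [Real.add_one_le_exp ‖x‖]
    rw [norm_smul, norm_smul, norm_mul, norm_neg, norm_mul, norm_mul, Complex.norm_I,
      Complex.norm_real, Real.norm_of_nonneg pi_pos.le]
    calc ‖u x‖ * (‖laplaceKernel x z‖ * (‖(2 : ℂ)‖ * π * 1) * ‖pairingCLM x‖) ≤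
          (A * Real.exp (-(R + 2) * ‖x‖)) *
            (Real.exp (R * ‖x‖) * (2 * π * 1) * (d * Real.exp ‖x‖)) := by
          gcongr
          · exact hb x
          · simp
          · exact (norm_pairingCLM_le x).trans (by gcongr)
      _ = A * (2 * π * d) * (Real.exp (-(R + 2) * ‖x‖) * Real.exp (R * ‖x‖) * Real.exp ‖x‖) := by
          ring
      _ = _ := by rw [← Real.exp_add, ← Real.exp_add]; ring_nf

end ExpDecay

theorem fderiv_laplaceKernel_left (z : EuclideanSpace ℂ (Fin d)) (x : EuclideanSpace ℝ (Fin d))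
    (j : Fin d) : DifferentiableAt ℝ (fun x => laplaceKernel x z) x ∧
    fderiv ℝ (fun x => laplaceKernel x z) x (EuclideanSpace.single j 1) =
      -(2 * (π : ℂ) * Complex.I) * z j * laplaceKernel x z := by
  let T : EuclideanSpace ℝ (Fin d) →L[ℝ] ℂ :=
    ∑ i, (Complex.ofRealCLM.comp (EuclideanSpace.proj i : _ →L[ℝ] ℝ)).smulRight (z i)
  have hT : ∀ x, T x = ∑ j, (x j : ℂ) * z j := fun x => by
    simp [T]
  have h : (fun x => laplaceKernel x z) =
      fun x => Complex.exp (-(2 * (π : ℂ) * Complex.I) * T x) := by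
    ext x; rw [hT]; rfl
  have h2 := ((T.hasFDerivAt (x := x)).const_mul (-(2 * (π : ℂ) * Complex.I))).cexp
  rw [← h] at h2
  refine ⟨h2.differentiableAt, ?_⟩
  rw [h2.fderiv]
  have h3 : T (EuclideanSpace.single j 1) = z j := by
    rw [hT, Finset.sum_eq_single j]
    · simp
    · intro i _ hi; simp [hi]
    · simp
  simp only [smul_apply, h3, smul_eq_mul, hT, laplaceKernel]
  ring

theorem laplace_partialDeriv {u : SmoothFun d} {j : Fin d} (hu : ExpDecay u.1)
    (hu' : ExpDecay (partialDeriv j u).1) (z : EuclideanSpace ℂ (Fin d)) :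
    laplace (partialDeriv j u).1 z = 2 * (π : ℂ) * Complex.I * z j * laplace u.1 z := by
  have h := integral_mul_fderiv_eq_neg_fderiv_mul_of_integrable (μ := volume)
    (f := fun x => laplaceKernel x z) (g := u.1) (v := EuclideanSpace.single j (1 : ℝ))
    (by
      simp only [(fderiv_laplaceKernel_left z _ j).2, mul_assoc]
      exact (((hu.mul_laplaceKernel z).integrable.const_mul (z j)).const_mul
        (-(2 * ((π : ℂ) * Complex.I)))).congr (Eventually.of_forall fun x => by ring))
    ((hu'.mul_laplaceKernel z).integrable.congr (Eventually.of_forall fun x => mul_comm _ _))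
    ((hu.mul_laplaceKernel z).integrable.congr (Eventually.of_forall fun x => mul_comm _ _))
    (fun x _ => (fderiv_laplaceKernel_left z x j).1) (fun x _ => u.differentiable x)
  have h1 : laplace (partialDeriv j u).1 z =
      ∫ x, laplaceKernel x z * fderiv ℝ u.1 x (EuclideanSpace.single j 1) :=
    integral_congr_ae (Eventually.of_forall fun x => mul_comm _ _)
  rw [h1, h, laplace, ← integral_const_mul, ← integral_neg]
  refine integral_congr_ae (Eventually.of_forall fun x => ?_)
  simp only [(fderiv_laplaceKernel_left z _ j).2]
  ring

variable {M : ℕ → ℝ}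

/-- The derivatives of `u` along the coordinate axes decay faster than every exponential. -/
def SmoothFun.DirExpDecay (u : SmoothFun d) : Prop := ∀ j p, ExpDecay ((partialDeriv j ^ p) u).1

theorem SmoothFun.DirExpDecay.expDecay {u : SmoothFun d} (hu : u.DirExpDecay) (hd : 0 < d) :
    ExpDecay u.1 := hu ⟨0, hd⟩ 0

theorem SmoothFun.DirBound.mono_right {u : SmoothFun d} {r : ℝ}
    {B B' : EuclideanSpace ℝ (Fin d) → ℝ} (hM : IsWeightSequence M) (hr : 0 ≤ r)
    (hu : u.DirBound M r B) (h : ∀ x, B x ≤ B' x) : u.DirBound M r B' := fun j p x => by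
  have := hM.pos p
  refine (hu j p x).trans ?_
  gcongr
  exact h x

theorem SmoothFun.DirExpDecay.of_dirBound (hM : IsWeightSequence M) {u : SmoothFun d}
    (h : ∀ c : ℝ, ∃ A r, 0 ≤ r ∧ u.DirBound M r fun x => A * Real.exp (-c * ‖x‖)) :
    u.DirExpDecay := fun j p => ⟨SmoothFun.continuous _, fun c => by
  obtain ⟨A, r, hr, hA⟩ := h c
  have := hM.pos p
  refine ⟨|A| * r ^ p * M p, by positivity, fun x => (hA j p x).trans ?_⟩
  calc A * Real.exp (-c * ‖x‖) * r ^ p * M p ≤ |A| * Real.exp (-c * ‖x‖) * r ^ p * M p := by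
        gcongr; exact le_abs_self A
    _ = _ := by ring⟩

/-- The Fourier–Laplace transform of an ultradifferentiable function decays like the associated
function in the real directions. -/
theorem SmoothFun.DirBound.norm_laplace_mul_exp_le {u : SmoothFun d} {r : ℝ}
    {B : EuclideanSpace ℝ (Fin d) → ℝ} (hu : u.DirBound M r B) (hu' : u.DirExpDecay)
    (hM : IsWeightSequence M) (hr : 0 < r) (hd : 0 < d) (z : EuclideanSpace ℂ (Fin d))
    (hBz : Integrable fun x => B x * Real.exp (2 * π * inner ℝ x (imVec z))) :
    ‖laplace u.1 z‖ * Real.exp (assocFun M (2 * π / (√(d : ℝ) * r) * ‖reVec z‖)) ≤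
      ∫ x, B x * Real.exp (2 * π * inner ℝ x (imVec z)) := by
  set K := ∫ x, B x * Real.exp (2 * π * inner ℝ x (imVec z)) with hK
  have hdr : 0 < √(d : ℝ) := Real.sqrt_pos.2 (by exact_mod_cast hd)
  -- Only derivatives along the largest coordinate of `Re z` are used: `p` integrations by parts
  -- produce `(2πi z_j) ^ p`, and `|z_j| ≥ ‖Re z‖ / √d`. As this works for every `p`, the supremum
  -- defining `ν_M` appears.
  obtain ⟨j, hj⟩ := exists_norm_le_sqrt_mul hd (reVec z)
  refine hM.mul_exp_assocFun_le (norm_nonneg _) (by positivity) fun p => ?_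
  have h1 : ∀ p, laplace ((partialDeriv j ^ p) u).1 z =
      (2 * (π : ℂ) * Complex.I * z j) ^ p * laplace u.1 z := fun p => by
    induction p with
    | zero => simp
    | succ p ih =>
      have h2 := hu' j (p + 1)
      rw [pow_succ', Module.End.mul_apply] at h2 ⊢
      rw [laplace_partialDeriv (hu' j p) h2, ih]
      ring
  have h3 : ‖laplace ((partialDeriv j ^ p) u).1 z‖ ≤ r ^ p * M p * K := by
    rw [hK, ← integral_const_mul]
    refine norm_integral_le_of_norm_le (hBz.const_mul _) (Eventually.of_forall fun x => ?_)
    rw [norm_mul, norm_laplaceKernel]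
    calc _ ≤ B x * r ^ p * M p * Real.exp (2 * π * inner ℝ x (imVec z)) :=
          mul_le_mul_of_nonneg_right (hu j p x) (Real.exp_pos _).le
      _ = _ := by ring
  rw [h1, norm_mul, norm_pow, norm_mul, norm_mul, norm_mul, Complex.norm_I, Complex.norm_real,
    Real.norm_of_nonneg pi_pos.le, Complex.norm_ofNat, mul_one] at h3
  have h4 : ‖reVec z‖ ≤ √(d : ℝ) * ‖z j‖ := hj.trans (by
    gcongr; exact Complex.abs_re_le_norm (z j))
  have h5 : 2 * π / (√(d : ℝ) * r) * ‖reVec z‖ ≤ (2 * π * ‖z j‖) / r := by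
    rw [div_mul_eq_mul_div, div_le_div_iff₀ (by positivity) hr]
    calc 2 * π * ‖reVec z‖ * r ≤ 2 * π * (√(d : ℝ) * ‖z j‖) * r := by gcongr
      _ = _ := by ring
  calc ‖laplace u.1 z‖ * (2 * π / (√(d : ℝ) * r) * ‖reVec z‖) ^ p ≤
        ‖laplace u.1 z‖ * ((2 * π * ‖z j‖) / r) ^ p := by gcongr
    _ = ((2 * π * ‖z j‖) ^ p * ‖laplace u.1 z‖) / r ^ p := by rw [div_pow]; ring
    _ ≤ (r ^ p * M p * K) / r ^ p := by gcongr
    _ = K * M p := by field_simp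

end Laplace

/-! ### The identity theorem and shifts of the domain of integration. -/

section Contour

variable {d : ℕ}

theorem Differentiable.eq_of_eq_on_real {f g : ℂ → ℂ} (hf : Differentiable ℂ f)
    (hg : Differentiable ℂ g) (h : ∀ r : ℝ, f r = g r) : f = g := by
  refine AnalyticOnNhd.eq_of_frequently_eq (z₀ := 0)
    (fun z _ => hf.analyticAt z) (fun z _ => hg.analyticAt z) ?_
  have h1 : Tendsto (fun r : ℝ => (r : ℂ)) (𝓝[≠] 0) (𝓝[≠] 0) := by
    refine tendsto_nhdsWithin_iff.2 ⟨?_, ?_⟩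
    · have := Complex.continuous_ofReal.tendsto 0
      rw [Complex.ofReal_zero] at this
      exact this.mono_left nhdsWithin_le_nhds
    · filter_upwards [self_mem_nhdsWithin] with r hr
      simpa using hr
  exact h1.frequently (Eventually.of_forall fun r => h r).frequently

/-- Restrict to the complex line `w ↦ Re z + w Im z`: it is real for real `w` and passes through `z`
at `w = i`. -/
theorem eq_of_eq_on_ofRealVec {f g : EuclideanSpace ℂ (Fin d) → ℂ} (hf : Differentiable ℂ f)
    (hg : Differentiable ℂ g) (h : ∀ x, f (ofRealVec x) = g (ofRealVec x)) : f = g := by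
  ext z
  have hl : Differentiable ℂ fun w : ℂ => ofRealVec (reVec z) + w • ofRealVec (imVec z) := by
    fun_prop
  have := Differentiable.eq_of_eq_on_real (hf.comp hl) (hg.comp hl) fun r => by
    simp only [Function.comp_apply]
    rw [← ofRealVec_smul, ← ofRealVec_add]
    exact h _
  have h2 := congr_fun this Complex.I
  simp only [Function.comp_apply] at h2
  rwa [← eq_ofRealVec_add] at h2

/-- Shifting the domain of integration of an entire function in imaginary directions. -/
theorem integral_shift_eq {Q : EuclideanSpace ℂ (Fin d) → ℂ} (hQ : Differentiable ℂ Q)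
    (hb : ∀ L : ℝ, ∃ C, 0 ≤ C ∧ ∀ z, ‖imVec z‖ ≤ L → ‖Q z‖ ≤ C * ((1 + ‖reVec z‖) ^ (d + 1))⁻¹)
    (η : EuclideanSpace ℝ (Fin d)) :
    ∫ x, Q (ofRealVec x + Complex.I • ofRealVec η) = ∫ x, Q (ofRealVec x) := by
  -- `Φ` is entire, and constant on the real axis by translation invariance of Lebesgue measure; so
  -- it is constant, and `w = i` gives the claim. This avoids shifting one variable at a time by
  -- Cauchy's theorem.
  set Φ : ℂ → ℂ := fun w => ∫ x, Q (ofRealVec x + w • ofRealVec η) with hΦ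
  have hbound : ∀ R : ℝ, 0 ≤ R → ∃ C, 0 ≤ C ∧ ∀ w : ℂ, ‖w‖ ≤ R → ∀ x,
      ‖Q (ofRealVec x + w • ofRealVec η)‖ ≤ C * ((1 + ‖x‖) ^ (d + 1))⁻¹ := fun R hR => by
    obtain ⟨C, hC, h⟩ := hb (R * ‖η‖)
    refine ⟨C * (1 + R * ‖η‖) ^ (d + 1), by positivity, fun w hw x => ?_⟩
    have h1 := h (ofRealVec x + w • ofRealVec η) (by
      rw [imVec_shift, norm_smul]
      gcongr
      exact (Complex.abs_im_le_norm w).trans hw)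
    rw [reVec_shift] at h1
    refine h1.trans ?_
    rw [mul_assoc]
    refine mul_le_mul_of_nonneg_left ?_ hC
    rw [← div_eq_mul_inv, le_div_iff₀ (by positivity), inv_mul_le_iff₀ (by positivity), ← mul_pow]
    refine pow_le_pow_left₀ (by positivity) ?_ _
    have h2 : ‖x‖ ≤ ‖x + w.re • η‖ + R * ‖η‖ := by
      have h3 := norm_sub_le (x + w.re • η) (w.re • η)
      rw [add_sub_cancel_right, norm_smul] at h3
      refine h3.trans ?_
      gcongr
      exact (Complex.abs_re_le_norm w).trans hw
    nlinarith [norm_nonneg (x + w.re • η), mul_nonneg hR (norm_nonneg η)]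
  have hcont : ∀ w : ℂ, Continuous fun x => Q (ofRealVec x + w • ofRealVec η) := fun w =>
    hQ.continuous.comp (continuous_ofRealVec.add continuous_const)
  have hint : ∀ w : ℂ, Integrable fun x => Q (ofRealVec x + w • ofRealVec η) := fun w => by
    obtain ⟨C, -, h⟩ := hbound ‖w‖ (norm_nonneg w)
    exact (integrable_inv_one_add_norm_pow.const_mul C).mono' (hcont w).aestronglyMeasurable
      (Eventually.of_forall fun x => h w le_rfl x)
  have hdiff : ∀ x, Differentiable ℂ fun w : ℂ => Q (ofRealVec x + w • ofRealVec η) := fun x =>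
    hQ.comp (by fun_prop)
  have hΦd : Differentiable ℂ Φ := fun w₀ => by
    -- One unit for the ball in which `w` varies, one for the circle in Cauchy's estimate of the
    -- derivative.
    obtain ⟨C, hC, h⟩ := hbound (‖w₀‖ + 2) (by positivity)
    refine (hasDerivAt_integral_of_dominated_loc_of_deriv_le (𝕜 := ℂ) (μ := volume)
      (F := fun w x => Q (ofRealVec x + w • ofRealVec η))
      (F' := fun w x => deriv (fun w : ℂ => Q (ofRealVec x + w • ofRealVec η)) w)
      (bound := fun x => C * ((1 + ‖x‖) ^ (d + 1))⁻¹)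
      (Metric.ball_mem_nhds w₀ one_pos) (Eventually.of_forall fun w =>
        (hcont w).aestronglyMeasurable) (hint w₀) ?_ (Eventually.of_forall fun x w hw => ?_)
      (integrable_inv_one_add_norm_pow.const_mul C)
      (Eventually.of_forall fun x w _ => (hdiff x w).hasDerivAt)).2.differentiableAt
    · have h1 : Continuous (Function.uncurry fun (x : EuclideanSpace ℝ (Fin d)) (w : ℂ) =>
          Q (ofRealVec x + w • ofRealVec η)) :=
        hQ.continuous.comp ((continuous_ofRealVec.comp continuous_fst).add
          (continuous_snd.smul continuous_const))
      exact ((measurable_deriv_with_param h1).comp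
        (measurable_id.prodMk measurable_const)).aestronglyMeasurable
    · have := Complex.norm_deriv_le_of_forall_mem_sphere_norm_le (c := w) (R := 1) one_pos
        (hdiff x).diffContOnCl (C := C * ((1 + ‖x‖) ^ (d + 1))⁻¹) fun w' hw' => h w' ?_ x
      · simpa using this
      · rw [mem_sphere_iff_norm] at hw'
        rw [mem_ball_iff_norm] at hw
        calc ‖w'‖ = ‖w₀ + (w - w₀) + (w' - w)‖ := by congr 1; ring
          _ ≤ ‖w₀‖ + ‖w - w₀‖ + ‖w' - w‖ := norm_add₃_le
          _ ≤ _ := by linarith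
  have h0 : Φ = fun _ => ∫ x, Q (ofRealVec x) :=
    hΦd.eq_of_eq_on_real (differentiable_const _) fun r => by
      simp only [hΦ, ← ofRealVec_smul, ← ofRealVec_add]
      exact integral_add_right_eq_self (fun x => Q (ofRealVec x)) (r • η)
  exact congr_fun h0 Complex.I

end Contour


/-! # The Fourier transforms between the spaces of entire and of smooth functions -/

section Weights

variable {d : ℕ} {M : ℕ → ℝ}

theorem norm_weightedDecay_le_iff (h L S : ℝ) (z : ↥(tube d L)) (φ : EntireFun d) :
    ‖weightedDecay d M h L z φ‖ ≤ S ↔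
      ‖φ.1 z.1‖ ≤ S * Real.exp (-assocFun M (h * ‖reVec z.1‖)) := by
  have h1 : weightedDecay d M h L z φ =
      ((Real.exp (assocFun M (h * ‖reVec z.1‖)) : ℝ) : ℂ) * φ.1 z.1 := rfl
  rw [h1, norm_mul, Complex.norm_real, Real.norm_of_nonneg (Real.exp_pos _).le, Real.exp_neg,
    ← div_eq_mul_inv, le_div_iff₀ (Real.exp_pos _), mul_comm]

theorem norm_weightedGrowth_le_iff (h L S : ℝ) (z : ↥(tube d L)) (φ : EntireFun d) :
    ‖weightedGrowth d M h L z φ‖ ≤ S ↔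
      ‖φ.1 z.1‖ ≤ S * Real.exp (assocFun M (h * ‖reVec z.1‖)) := by
  have h1 : weightedGrowth d M h L z φ =
      ((Real.exp (-assocFun M (h * ‖reVec z.1‖)) : ℝ) : ℂ) * φ.1 z.1 := rfl
  rw [h1, norm_mul, Complex.norm_real, Real.norm_of_nonneg (Real.exp_pos _).le, Real.exp_neg,
    inv_mul_le_iff₀ (Real.exp_pos _), mul_comm S]

/-- `η = -a x / ‖x‖` is the direction in which the kernel gains `e^{-2πa‖x‖}`. At `x = 0` division
by zero gives `η = 0`, which is still correct. -/
theorem exists_norm_le_inner_eq {a : ℝ} (ha : 0 ≤ a) (x : EuclideanSpace ℝ (Fin d)) :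
    ∃ η : EuclideanSpace ℝ (Fin d), ‖η‖ ≤ a ∧ inner ℝ x η = -(a * ‖x‖) := by
  refine ⟨-(a / ‖x‖) • x, ?_, ?_⟩
  · rw [norm_smul, norm_neg, Real.norm_of_nonneg (by positivity)]
    rcases eq_or_ne x 0 with rfl | hx
    · simpa using ha
    · rw [div_mul_cancel₀ _ (norm_ne_zero_iff.2 hx)]
  · rw [inner_smul_right, real_inner_self_eq_norm_sq]
    rcases eq_or_ne x 0 with rfl | hx
    · simp
    · have := norm_ne_zero_iff.2 hx
      field_simp

end Weights

/-! ### Fourier transforms of rapidly decreasing functions. -/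

section Rapid

variable {d : ℕ}

/-- Continuous functions decaying faster than every power. -/
def rapidSubmodule (d : ℕ) : Submodule ℂ (EuclideanSpace ℝ (Fin d) → ℂ) where
  carrier := {u | Continuous u ∧ ∀ k : ℕ, ∃ C, 0 ≤ C ∧ ∀ x, (1 + ‖x‖) ^ k * ‖u x‖ ≤ C}
  zero_mem' := ⟨continuous_zero, fun k => ⟨0, le_rfl, fun x => by simp⟩⟩
  add_mem' := fun {u v} hu hv => ⟨hu.1.add hv.1, fun k => by
    obtain ⟨A, hA, h1⟩ := hu.2 k
    obtain ⟨B, hB, h2⟩ := hv.2 k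
    refine ⟨A + B, add_nonneg hA hB, fun x => le_trans ?_ (add_le_add (h1 x) (h2 x))⟩
    rw [← mul_add]
    exact mul_le_mul_of_nonneg_left (norm_add_le _ _) (by positivity)⟩
  smul_mem' := fun c u hu => ⟨hu.1.const_smul c, fun k => by
    obtain ⟨A, hA, h1⟩ := hu.2 k
    refine ⟨‖c‖ * A, by positivity, fun x => ?_⟩
    rw [Pi.smul_apply, norm_smul, mul_left_comm]
    exact mul_le_mul_of_nonneg_left (h1 x) (norm_nonneg c)⟩

variable {u : EuclideanSpace ℝ (Fin d) → ℂ}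

theorem integrable_pow_mul_of_mem_rapid (hu : u ∈ rapidSubmodule d) (k : ℕ) :
    Integrable fun x => ‖x‖ ^ k * ‖u x‖ := by
  obtain ⟨C, hC, h⟩ := hu.2 (k + (d + 1))
  refine (integrable_inv_one_add_norm_pow.const_mul C).mono'
    ((continuous_norm.pow k).mul hu.1.norm).aestronglyMeasurable (Eventually.of_forall fun x => ?_)
  rw [norm_mul, norm_norm, norm_pow, norm_norm, ← div_eq_mul_inv, le_div_iff₀ (by positivity)]
  refine le_trans ?_ (h x)
  rw [pow_add _ k (d + 1), mul_right_comm]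
  refine mul_le_mul_of_nonneg_right (mul_le_mul_of_nonneg_right ?_ (by positivity))
    (norm_nonneg _)
  exact pow_le_pow_left₀ (norm_nonneg x) (by linarith) k

theorem integrable_of_mem_rapid (hu : u ∈ rapidSubmodule d) : Integrable u := by
  have := integrable_pow_mul_of_mem_rapid hu 0
  simp only [pow_zero, one_mul] at this
  exact (integrable_norm_iff hu.1.aestronglyMeasurable).1 this

/-- The Fourier transform on rapidly decreasing functions. -/
noncomputable def fourierRapid (d : ℕ) : ↥(rapidSubmodule d) →ₗ[ℂ] SmoothFun d where
  toFun u := ⟨𝓕 u.1, Real.contDiff_fourier (N := ⊤) fun n _ =>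
    integrable_pow_mul_of_mem_rapid u.2 n⟩
  map_add' u v := by
    ext x
    change 𝓕 (u.1 + v.1) x = 𝓕 u.1 x + 𝓕 v.1 x
    simp only [Real.fourier_eq, Pi.add_apply, smul_add]
    exact integral_add
      ((Real.fourierIntegral_convergent_iff x).2 (integrable_of_mem_rapid u.2))
      ((Real.fourierIntegral_convergent_iff x).2 (integrable_of_mem_rapid v.2))
  map_smul' c u := by
    ext x
    change 𝓕 (c • u.1) x = c • 𝓕 u.1 x
    simp only [Real.fourier_eq, Pi.smul_apply, smul_comm _ c]
    exact integral_smul c _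

theorem fourierRapid_apply (u : ↥(rapidSubmodule d)) (x : EuclideanSpace ℝ (Fin d)) :
    (fourierRapid d u).1 x = 𝓕 u.1 x := rfl

/-- Multiplication by `-2πi x_j` on rapidly decreasing functions. -/
noncomputable def mulCoord (j : Fin d) : Module.End ℂ ↥(rapidSubmodule d) where
  toFun u := ⟨fun x => -(2 * (π : ℂ) * Complex.I) * (x j : ℂ) * u.1 x,
    (by have := u.2.1; fun_prop), fun k => by
      obtain ⟨C, hC, h⟩ := u.2.2 (k + 1)
      refine ⟨2 * π * C, by positivity, fun x => ?_⟩
      have hx : ‖x j‖ ≤ 1 + ‖x‖ := (PiLp.norm_apply_le x j).trans (by linarith)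
      rw [norm_mul, norm_mul, norm_neg, norm_mul, norm_mul, Complex.norm_I, Complex.norm_real,
        Complex.norm_real, Real.norm_of_nonneg pi_pos.le, Complex.norm_ofNat, mul_one]
      calc (1 + ‖x‖) ^ k * (2 * π * ‖x j‖ * ‖u.1 x‖) ≤
            (1 + ‖x‖) ^ k * (2 * π * (1 + ‖x‖) * ‖u.1 x‖) := by gcongr
        _ = 2 * π * ((1 + ‖x‖) ^ (k + 1) * ‖u.1 x‖) := by ring
        _ ≤ _ := by gcongr; exact h x⟩
  map_add' u v := by
    ext x
    exact mul_add _ _ _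
  map_smul' c u := by
    ext x
    exact mul_left_comm _ _ _

theorem partialDeriv_fourierRapid (j : Fin d) (u : ↥(rapidSubmodule d)) :
    partialDeriv j (fourierRapid d u) = fourierRapid d (mulCoord j u) := by
  ext ξ
  have h0 := integrable_of_mem_rapid u.2
  have h1 : Integrable fun x => ‖x‖ * ‖u.1 x‖ := by
    simpa using integrable_pow_mul_of_mem_rapid u.2 1
  change fderiv ℝ (𝓕 u.1) ξ _ = 𝓕 (mulCoord j u).1 ξ
  have h2 : Integrable (VectorFourier.fourierSMulRight (innerSL ℝ) u.1) := by
    refine (h1.const_mul (2 * π * ‖innerSL ℝ (E := EuclideanSpace ℝ (Fin d))‖)).mono'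
      h0.1.fourierSMulRight (Eventually.of_forall fun x => ?_)
    rw [← mul_assoc]
    exact VectorFourier.norm_fourierSMulRight_le _ _ x
  rw [Real.fderiv_fourier h0 h1, Real.fourier_continuousLinearMap_apply h2]
  refine congrArg (fun f : EuclideanSpace ℝ (Fin d) → ℂ => 𝓕 f ξ) (funext fun x => ?_)
  have h3 : innerSL ℝ x (EuclideanSpace.single j 1) = x j := by
    rw [innerSL_apply_apply, EuclideanSpace.inner_single_right]
    simp
  rw [VectorFourier.fourierSMulRight_apply, h3]
  simp [mulCoord, mul_assoc]

theorem multiDeriv_fourierRapid (α : Fin d → ℕ) (u : ↥(rapidSubmodule d))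
    (ξ : EuclideanSpace ℝ (Fin d)) :
    (multiDeriv α (fourierRapid d u)).1 ξ =
      𝓕 (fun x => (∏ j, (-(2 * (π : ℂ) * Complex.I) * (x j : ℂ)) ^ α j) * u.1 x) ξ := by
  rw [multiDeriv_intertwine (fourierRapid d) mulCoord partialDeriv_fourierRapid, fourierRapid_apply]
  refine congrArg (fun f : EuclideanSpace ℝ (Fin d) → ℂ => 𝓕 f ξ) (funext fun x => ?_)
  rw [Fin.prod_univ_def]
  have hp : ∀ j n (u : ↥(rapidSubmodule d)), ((mulCoord j ^ n) u).1 x =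
      (-(2 * (π : ℂ) * Complex.I) * (x j : ℂ)) ^ n * u.1 x := fun j n => by
    induction n with
    | zero => intro u; simp
    | succ n ih =>
      intro u
      rw [pow_succ, Module.End.mul_apply, ih, pow_succ]
      exact (mul_assoc _ _ _).symm
  generalize List.finRange d = L
  induction L with
  | nil => simp
  | cons j L ih =>
    rw [List.map_cons, List.prod_cons, Module.End.mul_apply, hp, ih, List.map_cons, List.prod_cons]
    exact (mul_assoc _ _ _).symm

end Rapid

/-! ### Fourier transforms of restrictions of entire functions. -/

section FourierEntire

variable {d : ℕ} {M : ℕ → ℝ}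

/-- Restriction of entire functions to `ℝ^d`. -/
noncomputable def realRestrict (d : ℕ) : EntireFun d →ₗ[ℂ] (EuclideanSpace ℝ (Fin d) → ℂ) where
  toFun φ x := φ.1 (ofRealVec x)
  map_add' _ _ := rfl
  map_smul' _ _ := rfl

theorem differentiable_entire (φ : EntireFun d) : Differentiable ℂ φ.1 := φ.2

theorem realRestrict_mem_rapid (hM : IsWeightSequence M) {h : ℝ} (hh : 0 < h) {φ : EntireFun d}
    (hφ : φ ∈ boundedSubmodule fun n : ℕ => weightedDecay d M h (n : ℝ)) :
    realRestrict d φ ∈ rapidSubmodule d := by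
  refine ⟨(differentiable_entire φ).continuous.comp continuous_ofRealVec, fun k => ?_⟩
  obtain ⟨S, hS⟩ := hφ 1
  obtain ⟨C, hC, hk⟩ := hM.exists_one_add_pow_le hh k
  refine ⟨C * |S|, by positivity, fun x => ?_⟩
  have hx : ofRealVec x ∈ tube d ((1 : ℕ) : ℝ) := by simp [tube]
  have h1 := (norm_weightedDecay_le_iff h _ S ⟨_, hx⟩ φ).1 (hS ⟨_, rfl⟩)
  rw [reVec_ofRealVec] at h1
  calc (1 + ‖x‖) ^ k * ‖φ.1 (ofRealVec x)‖ ≤ (C * Real.exp (assocFun M (h * ‖x‖))) *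
        (|S| * Real.exp (-assocFun M (h * ‖x‖))) :=
        mul_le_mul (hk _ (norm_nonneg x)) (h1.trans (by gcongr; exact le_abs_self S))
          (norm_nonneg _) (by positivity)
    _ = C * |S| * (Real.exp (assocFun M (h * ‖x‖)) * Real.exp (-assocFun M (h * ‖x‖))) := by ring
    _ = C * |S| := by rw [← Real.exp_add, add_neg_cancel, Real.exp_zero, mul_one]

/-- The Fourier transform of an entire function with fast decay in the real directions is
ultradifferentiable and decays exponentially. -/
theorem exists_norm_multiDeriv_fourierRapid_le {C₀ H : ℝ} (hM : IsWeightSequence M)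
    (hM2 : ConditionM2 M C₀ H) {h : ℝ} (hh : 0 < h) (n : ℕ) :
    ∃ C, ∀ (v : UStep d M h) (hv : realRestrict d v.val ∈ rapidSubmodule d) (α : Fin d → ℕ)
      (ξ : EuclideanSpace ℝ (Fin d)),
      ‖(multiDeriv α (fourierRapid d ⟨_, hv⟩)).1 ξ‖ ≤ C * SupSpace.seminorm _ (n + 1) v *
        Real.exp (-n * ‖ξ‖) * (4 * π * H / h) ^ (∑ i, α i) * M (∑ i, α i) := by
  have hH : 0 < H := zero_lt_one.trans_le hM2.one_le_H
  -- Here `b = n` bounds the imaginary part on the shifted domain.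
  obtain ⟨C, hC, hCb⟩ := hM2.exists_add_pow_mul_le hM hh (Nat.cast_nonneg (α := ℝ) n) (d + 1)
  set J : ℝ := ∫ x : EuclideanSpace ℝ (Fin d), ((1 + ‖x‖) ^ (d + 1))⁻¹ with hJ
  refine ⟨C * J, fun v hv α ξ => ?_⟩
  set p := ∑ i, α i with hp
  -- The integrand of `∂^α F(v)(ξ)`, extended holomorphically in the variable of integration.
  let Q : EuclideanSpace ℂ (Fin d) → ℂ := fun z =>
    (∏ j, (-(2 * (π : ℂ) * Complex.I) * z j) ^ α j) * v.val.1 z * laplaceKernel ξ z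
  have hQd : Differentiable ℂ Q := by
    have h1 : Differentiable ℂ (laplaceKernel ξ) := fun z =>
      (hasFDerivAt_laplaceKernel ξ z).differentiableAt
    have h2 := differentiable_entire v.val
    have h3 : ∀ j, Differentiable ℂ fun z : EuclideanSpace ℂ (Fin d) =>
        (-(2 * (π : ℂ) * Complex.I) * z j) ^ α j := fun j => by fun_prop
    have h4 : Differentiable ℂ fun z : EuclideanSpace ℂ (Fin d) =>
        ∏ j, (-(2 * (π : ℂ) * Complex.I) * z j) ^ α j := by fun_prop
    exact (h4.mul h2).mul h1
  have hprod : ∀ z : EuclideanSpace ℂ (Fin d),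
      ‖∏ j, (-(2 * (π : ℂ) * Complex.I) * z j) ^ α j‖ ≤
        (2 * π) ^ p * (‖reVec z‖ + ‖imVec z‖) ^ p := fun z => by
    rw [← mul_pow, hp, ← Finset.prod_pow_eq_pow_sum, norm_prod]
    refine Finset.prod_le_prod (fun _ _ => norm_nonneg _) fun j _ => ?_
    rw [norm_pow]
    refine pow_le_pow_left₀ (norm_nonneg _) ?_ _
    rw [norm_mul, norm_neg, norm_mul, norm_mul, Complex.norm_I, Complex.norm_real,
      Real.norm_of_nonneg pi_pos.le, Complex.norm_ofNat, mul_one]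
    exact mul_le_mul_of_nonneg_left ((PiLp.norm_apply_le z j).trans (norm_le_re_add_im z))
      (by positivity)
  have hdecay : ∀ (m : ℕ) (z : EuclideanSpace ℂ (Fin d)), ‖imVec z‖ ≤ m → ‖v.val.1 z‖ ≤
      SupSpace.seminorm _ (m + 1) v * Real.exp (-assocFun M (h * ‖reVec z‖)) := fun m z hz => by
    -- The tubes are open, so the closed strip `|Im z| ≤ m` needs the seminorm of index `m + 1`.
    have hz' : z ∈ tube d ((m + 1 : ℕ) : ℝ) := by
      change ‖imVec z‖ < _
      push_cast
      linarith
    exact (norm_weightedDecay_le_iff h _ _ ⟨z, hz'⟩ v.val).1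
      (SupSpace.norm_le_seminorm v (m + 1) ⟨z, hz'⟩)
  -- Stated for all `m`: every strip is needed to justify the shift, and `m = n` for the final
  -- bound.
  have hQb : ∀ (m : ℕ) (C' : ℝ), (∀ (p : ℕ) (t : ℝ), 0 ≤ t → (t + m) ^ p * (1 + t) ^ (d + 1) ≤
      C' * (2 * H / h) ^ p * M p * Real.exp (assocFun M (h * t))) →
      ∀ z, ‖imVec z‖ ≤ m → ‖Q z‖ ≤ (2 * π) ^ p * (C' * (2 * H / h) ^ p * M p) *
        SupSpace.seminorm _ (m + 1) v * ‖laplaceKernel ξ z‖ * ((1 + ‖reVec z‖) ^ (d + 1))⁻¹ := by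
    intro m C' hC' z hz
    have h1 := hC' p ‖reVec z‖ (norm_nonneg _)
    have h2 : ‖∏ j, (-(2 * (π : ℂ) * Complex.I) * z j) ^ α j‖ ≤
        (2 * π) ^ p * (‖reVec z‖ + m) ^ p := (hprod z).trans (by gcongr)
    have hS : 0 ≤ SupSpace.seminorm _ (m + 1) v := apply_nonneg _ _
    rw [← div_eq_mul_inv, le_div_iff₀ (by positivity)]
    simp only [Q]
    rw [norm_mul, norm_mul]
    calc _ ≤ ((2 * π) ^ p * (‖reVec z‖ + m) ^ p) * (SupSpace.seminorm _ (m + 1) v *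
          Real.exp (-assocFun M (h * ‖reVec z‖))) * ‖laplaceKernel ξ z‖ *
          (1 + ‖reVec z‖) ^ (d + 1) := by
          gcongr
          exact hdecay m z hz
      _ = (2 * π) ^ p * ((‖reVec z‖ + m) ^ p * (1 + ‖reVec z‖) ^ (d + 1)) *
          Real.exp (-assocFun M (h * ‖reVec z‖)) * SupSpace.seminorm _ (m + 1) v *
          ‖laplaceKernel ξ z‖ := by ring
      _ ≤ (2 * π) ^ p * (C' * (2 * H / h) ^ p * M p * Real.exp (assocFun M (h * ‖reVec z‖))) *
          Real.exp (-assocFun M (h * ‖reVec z‖)) * SupSpace.seminorm _ (m + 1) v *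
          ‖laplaceKernel ξ z‖ := by gcongr
      _ = (2 * π) ^ p * (C' * (2 * H / h) ^ p * M p) * SupSpace.seminorm _ (m + 1) v *
          ‖laplaceKernel ξ z‖ * (Real.exp (assocFun M (h * ‖reVec z‖)) *
          Real.exp (-assocFun M (h * ‖reVec z‖))) := by ring
      _ = _ := by rw [← Real.exp_add, add_neg_cancel, Real.exp_zero, mul_one]
  have hMp := hM.pos p
  -- Shifting by `n` against `ξ` makes the kernel `e^{-2πn‖ξ‖}`, more than the required `e^{-n‖ξ‖}`.
  obtain ⟨η, hη, hηξ⟩ := exists_norm_le_inner_eq (Nat.cast_nonneg (α := ℝ) n) ξ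
  have hshift := integral_shift_eq hQd (fun L => by
    obtain ⟨m, hm⟩ := exists_nat_ge L
    obtain ⟨C', hC', hb'⟩ := hM2.exists_add_pow_mul_le hM hh (Nat.cast_nonneg (α := ℝ) m) (d + 1)
    have hS : 0 ≤ SupSpace.seminorm _ (m + 1) v := apply_nonneg _ _
    refine ⟨(2 * π) ^ p * (C' * (2 * H / h) ^ p * M p) * SupSpace.seminorm _ (m + 1) v *
      Real.exp (2 * π * m * ‖ξ‖), by positivity, fun z hz => ?_⟩
    refine (hQb m C' hb' z (hz.trans hm)).trans ?_
    gcongr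
    refine (norm_laplaceKernel_le ξ z).trans (Real.exp_le_exp.2 ?_)
    gcongr
    exact hz.trans hm) η
  have hS : 0 ≤ SupSpace.seminorm _ (n + 1) v := apply_nonneg _ _
  have h1 : (multiDeriv α (fourierRapid d ⟨_, hv⟩)).1 ξ = ∫ x, Q (ofRealVec x) := by
    rw [multiDeriv_fourierRapid, ← laplace_ofRealVec, laplace]
    refine integral_congr_ae (Eventually.of_forall fun x => ?_)
    simp only [Q, laplaceKernel_ofRealVec, ofRealVec_apply, real_inner_comm x ξ]
    rfl
  rw [h1, ← hshift]
  have hJ0 : 0 ≤ J := integral_nonneg fun x => by positivity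
  calc ‖∫ x, Q (ofRealVec x + Complex.I • ofRealVec η)‖ ≤
        ∫ x : EuclideanSpace ℝ (Fin d), (2 * π) ^ p * (C * (2 * H / h) ^ p * M p) *
          SupSpace.seminorm _ (n + 1) v * Real.exp (-n * ‖ξ‖) * ((1 + ‖x‖) ^ (d + 1))⁻¹ := by
        refine norm_integral_le_of_norm_le (integrable_inv_one_add_norm_pow.const_mul _)
          (Eventually.of_forall fun x => ?_)
        have h2 := hQb n C hCb (ofRealVec x + Complex.I • ofRealVec η) (by simpa using hη)
        rw [reVec_shift, Complex.I_re, zero_smul, add_zero] at h2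
        refine h2.trans ?_
        gcongr
        rw [norm_laplaceKernel, imVec_shift, Complex.I_im, one_smul, hηξ]
        refine Real.exp_le_exp.2 ?_
        have h3 : 0 ≤ (n : ℝ) * ‖ξ‖ := by positivity
        nlinarith [pi_gt_three]
    _ = _ := by
        rw [integral_const_mul, ← hJ, show 4 * π * H / h = 2 * π * (2 * H / h) by ring,
          mul_pow (2 * π)]
        ring

variable {C₀ H : ℝ} (hM : IsWeightSequence M) (hM2 : ConditionM2 M C₀ H)

include hM in
theorem realRestrict_mem_rapid_of_roumieu (φ : URoumieu d M) :
    realRestrict d φ.val ∈ rapidSubmodule d := by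
  induction φ using IndSpace.induction with
  | step h w => exact realRestrict_mem_rapid hM h.2 w.2
  | add v w hv hw => rw [map_add, map_add]; exact add_mem hv hw

/-- The restriction of an element of `𝒰^{{M}}` to `ℝ^d`. -/
noncomputable def restrictRoumieu : URoumieu d M →ₗ[ℂ] ↥(rapidSubmodule d) :=
  (realRestrict d ∘ₗ IndSpace.val).codRestrict _ (realRestrict_mem_rapid_of_roumieu hM)

/-- The Fourier transform `𝒰^{{M}}(ℂ^d) → 𝒦^{{M}}(ℝ^d)`. -/
noncomputable def fourierRoumieu : URoumieu d M →L[ℂ] KRoumieu d M :=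
  IndSpace.lift (fourierRapid d ∘ₗ restrictRoumieu hM) fun h => by
    have hH : 0 < H := zero_lt_one.trans_le hM2.one_le_H
    have hh : 0 < (h : ℝ) := h.2
    -- The reciprocal of the ratio `4πH / h` in the preceding estimate. In the Beurling case below,
    -- `4πHh` is likewise chosen so that this ratio becomes `h⁻¹`.
    refine ⟨⟨h / (4 * π * H), Set.mem_Ioi.2 (by positivity)⟩, fun n => ?_⟩
    obtain ⟨C, hC⟩ := exists_norm_multiDeriv_fourierRapid_le hM hM2 hh n (d := d)
    refine ⟨n + 1, C, fun v j => ?_⟩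
    rw [norm_weightedDeriv_le_iff hM (by positivity), inv_div]
    exact hC v _ j.1 j.2

theorem isFourierRoumieu_fourierRoumieu : IsFourierRoumieu (fourierRoumieu (d := d) hM hM2) :=
  fun _ _ => rfl

/-- The step `𝒰^{M,h}` containing `𝒰^{(M)}`. -/
noncomputable def UBeurling.toStep (h : ℝ) (hh : 0 < h) : UBeurling d M →ₗ[ℂ] UStep d M h :=
  (SupSpace.val : UBeurling d M →ₗ[ℂ] EntireFun d).codRestrict _ fun φ n =>
    φ.val_mem (⟨h, hh⟩, n)

/-- The restriction of an element of `𝒰^{(M)}` to `ℝ^d`. -/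
noncomputable def restrictBeurling : UBeurling d M →ₗ[ℂ] ↥(rapidSubmodule d) :=
  (realRestrict d ∘ₗ SupSpace.val).codRestrict _ fun φ =>
    realRestrict_mem_rapid hM one_pos (UBeurling.toStep 1 one_pos φ).val_mem

/-- The Fourier transform `𝒰^{(M)}(ℂ^d) → 𝒦^{(M)}(ℝ^d)`. -/
noncomputable def fourierBeurling : UBeurling d M →L[ℂ] KBeurling d M :=
  SupSpace.lift (fourierRapid d ∘ₗ restrictBeurling hM) fun i => by
    have hH : 0 < H := zero_lt_one.trans_le hM2.one_le_H
    obtain ⟨⟨h, hh⟩, n⟩ := i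
    have hh : 0 < h := hh
    have hh' : 0 < 4 * π * H * h := by positivity
    obtain ⟨C, hC⟩ := exists_norm_multiDeriv_fourierRapid_le hM hM2 hh' n (d := d)
    refine ⟨(⟨4 * π * H * h, hh'⟩, n + 1), C, fun v j => ?_⟩
    rw [norm_weightedDeriv_le_iff hM (by positivity)]
    have := hC (UBeurling.toStep _ hh' v) (restrictBeurling hM v).2 j.1 j.2
    rwa [show 4 * π * H / (4 * π * H * h) = h⁻¹ by field_simp] at this

theorem fourierBeurling_apply (φ : UBeurling d M) (ξ : EuclideanSpace ℝ (Fin d)) :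
    (fourierBeurling hM hM2 φ).val.1 ξ = 𝓕 (fun x => φ.val.1 (ofRealVec x)) ξ := rfl

end FourierEntire


/-! # The Fourier–Laplace transform on `𝒦^{(M)}` -/

section Beurling

variable {d : ℕ} {M : ℕ → ℝ}

theorem KBeurling.dirBound (hM : IsWeightSequence M) (φ : KBeurling d M) {h : ℝ} (hh : 0 < h)
    (n : ℕ) : φ.val.DirBound M h⁻¹ fun x =>
      SupSpace.seminorm _ ((⟨h, hh⟩, n) : Set.Ioi (0 : ℝ) × ℕ) φ * Real.exp (-n * ‖x‖) :=
  .of_weightedDeriv hM hh fun j => φ.norm_le_seminorm (⟨h, hh⟩, n) j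

theorem KBeurling.exists_dirBound (hM : IsWeightSequence M) (φ : KBeurling d M) {r : ℝ}
    (hr : 0 < r) (c : ℝ) : ∃ A, 0 ≤ A ∧ φ.val.DirBound M r fun x => A * Real.exp (-c * ‖x‖) := by
  obtain ⟨n, hn⟩ := exists_nat_ge c
  have h := φ.dirBound hM (inv_pos.2 hr) n
  rw [inv_inv] at h
  have hS := apply_nonneg (SupSpace.seminorm
    (fun i : Set.Ioi (0 : ℝ) × ℕ => weightedDeriv d M (i.1 : ℝ) (i.2 : ℝ))
    (⟨r⁻¹, inv_pos.2 hr⟩, n)) φ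
  refine ⟨_, hS, h.mono_right hM hr.le fun x => ?_⟩
  gcongr

theorem KBeurling.dirExpDecay (hM : IsWeightSequence M) (φ : KBeurling d M) :
    φ.val.DirExpDecay :=
  .of_dirBound hM fun c => by
    obtain ⟨A, -, h⟩ := φ.exists_dirBound hM one_pos c
    exact ⟨A, 1, zero_le_one, h⟩

theorem laplace_add {u v : EuclideanSpace ℝ (Fin d) → ℂ} (hu : ExpDecay u) (hv : ExpDecay v)
    (z : EuclideanSpace ℂ (Fin d)) :
    laplace (fun x => u x + v x) z = laplace u z + laplace v z := by
  simp only [laplace, add_mul]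
  exact integral_add (hu.mul_laplaceKernel z).integrable (hv.mul_laplaceKernel z).integrable

theorem laplace_smul (c : ℂ) (u : EuclideanSpace ℝ (Fin d) → ℂ) (z : EuclideanSpace ℂ (Fin d)) :
    laplace (fun x => c * u x) z = c * laplace u z := by
  simp only [laplace, mul_assoc]
  exact integral_const_mul c _

/-- The Fourier–Laplace transform as a linear map into the entire functions. -/
noncomputable def laplaceEntire (hd : 0 < d) (hM : IsWeightSequence M) :
    KBeurling d M →ₗ[ℂ] EntireFun d where
  toFun φ := ⟨laplace φ.val.1, ((φ.dirExpDecay hM).expDecay hd).differentiable_laplace⟩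
  map_add' φ ψ := Subtype.ext <| funext fun z =>
    laplace_add ((φ.dirExpDecay hM).expDecay hd) ((ψ.dirExpDecay hM).expDecay hd) z
  map_smul' c φ := Subtype.ext <| funext fun z => laplace_smul c φ.val.1 z

/-- The Fourier–Laplace transform `𝒦^{(M)}(ℝ^d) → 𝒰^{(M)}(ℂ^d)`. -/
noncomputable def laplaceBeurling (hd : 0 < d) (hM : IsWeightSequence M) :
    KBeurling d M →L[ℂ] UBeurling d M :=
  SupSpace.lift (laplaceEntire hd hM) fun i => by
    obtain ⟨⟨h, hh⟩, n⟩ := i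
    have hh : 0 < h := hh
    have hds : 0 < √(d : ℝ) := Real.sqrt_pos.2 (by exact_mod_cast hd)
    have hh' : 0 < √(d : ℝ) * h / (2 * π) := by positivity
    -- With `r` the reciprocal of the first index, `2π / (√d r) = h`. In the second, `8n ≥ 2πn`
    -- absorbs the kernel on `V_n` and the 1 leaves `e^{-‖x‖}`.
    refine ⟨(⟨√(d : ℝ) * h / (2 * π), hh'⟩, 8 * n + 1),
      ∫ x : EuclideanSpace ℝ (Fin d), Real.exp (-1 * ‖x‖), fun φ z => ?_⟩
    have hz : ‖imVec z.1‖ < n := z.2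
    have hB := KBeurling.dirBound hM φ hh' (8 * n + 1)
    set S := SupSpace.seminorm (fun i : Set.Ioi (0 : ℝ) × ℕ => weightedDeriv d M (i.1 : ℝ) (i.2 : ℝ))
      (⟨√(d : ℝ) * h / (2 * π), hh'⟩, 8 * n + 1) φ with hS
    have hS0 : 0 ≤ S := apply_nonneg _ _
    have hle : ∀ x : EuclideanSpace ℝ (Fin d), S * Real.exp (-((8 * n + 1 : ℕ) : ℝ) * ‖x‖) *
        Real.exp (2 * π * inner ℝ x (imVec z.1)) ≤ S * Real.exp (-1 * ‖x‖) := fun x => by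
      rw [mul_assoc, ← Real.exp_add]
      gcongr
      have h1 : inner ℝ x (imVec z.1) ≤ ‖x‖ * n :=
        (real_inner_le_norm _ _).trans (by gcongr)
      have h2 : 2 * π * inner ℝ x (imVec z.1) ≤ 2 * π * (‖x‖ * n) := by gcongr
      have h3 : 0 ≤ ‖x‖ * n := by positivity
      push_cast
      nlinarith [pi_le_four]
    have hint : Integrable fun x : EuclideanSpace ℝ (Fin d) => S * Real.exp (-1 * ‖x‖) :=
      (integrable_exp_neg_mul_norm one_pos).const_mul S
    have hint' : Integrable fun x : EuclideanSpace ℝ (Fin d) =>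
        S * Real.exp (-((8 * n + 1 : ℕ) : ℝ) * ‖x‖) * Real.exp (2 * π * inner ℝ x (imVec z.1)) :=
      hint.mono' (by fun_prop) (Eventually.of_forall fun x => by
        rw [Real.norm_of_nonneg (by positivity)]
        exact hle x)
    have h1 := hB.norm_laplace_mul_exp_le (KBeurling.dirExpDecay hM φ) hM (by positivity) hd z.1 hint'
    rw [show 2 * π / (√(d : ℝ) * (√(d : ℝ) * h / (2 * π))⁻¹) = h by field_simp] at h1
    rw [norm_weightedDecay_le_iff, Real.exp_neg, ← div_eq_mul_inv, le_div_iff₀ (Real.exp_pos _)]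
    refine h1.trans ((integral_mono hint' hint hle).trans_eq ?_)
    rw [integral_const_mul, mul_comm]

theorem isFourierBeurling_laplaceBeurling (hd : 0 < d) (hM : IsWeightSequence M) :
    IsFourierBeurling (laplaceBeurling (d := d) hd hM) := fun _ _ => rfl

/-- The reflection of `𝒦^{(M)}(ℝ^d)`. -/
noncomputable def reflectBeurling (hM : IsWeightSequence M) : KBeurling d M →L[ℂ] KBeurling d M :=
  SupSpace.lift (SmoothFun.reflect 0 ∘ₗ SupSpace.val) fun i => ⟨i, 1, fun φ j => by
    rw [norm_weightedDeriv_le_iff hM i.1.2]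
    simp only [LinearMap.comp_apply]
    rw [SmoothFun.norm_multiDeriv_reflect, zero_sub, one_mul, ← norm_neg j.2]
    exact (norm_weightedDeriv_le_iff hM i.1.2 _ _ j.1 (-j.2) φ.val).1
      (φ.norm_le_seminorm i (j.1, -j.2))⟩

theorem isReflection_reflectBeurling (hM : IsWeightSequence M) :
    IsReflection (reflectBeurling (d := d) hM) := fun φ x => by
  change φ.val.1 (0 - x) = _
  rw [zero_sub]

/-- Multiplication by an element of `𝒫^{M,h}` on `𝒰^{(M)}`. -/
noncomputable def mulBeurling (hM : IsWeightSequence M) {C₀ H : ℝ} (hM2 : ConditionM2 M C₀ H)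
    {h : ℝ} (hh : 0 < h) (P : PSpace d M h) : UBeurling d M →L[ℂ] UBeurling d M :=
  SupSpace.lift
    { toFun := fun φ => ⟨fun z => P.val.1 z * φ.val.1 z,
        Differentiable.mul (differentiable_entire P.val) (differentiable_entire φ.val)⟩
      map_add' := fun φ ψ => Subtype.ext <| funext fun z => mul_add _ _ _
      map_smul' := fun c φ => Subtype.ext <| funext fun z => mul_left_comm _ _ _ } fun i => by
    obtain ⟨⟨k, hk⟩, n⟩ := i
    have hk : 0 < k := hk
    have hH : 0 < H := zero_lt_one.trans_le hM2.one_le_H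
    have hC₀ : 0 < C₀ := zero_lt_one.trans_le hM2.one_le_C₀
    -- With this index, (M.2) gives `e^{ν_M(ht)} e^{ν_M(kt)} ≤ C₀ e^{ν_M(H max(h, k) t)}`: the decay
    -- of `φ` absorbs both the growth of `P` and the required weight.
    have hm : 0 < H * max h k := by positivity
    refine ⟨(⟨H * max h k, hm⟩, n), C₀ * SupSpace.seminorm _ n P, fun φ z => ?_⟩
    rw [norm_weightedDecay_le_iff]
    have h1 := (norm_weightedGrowth_le_iff h _ _ z P.val).1 (P.norm_le_seminorm n z)
    have h2 := (norm_weightedDecay_le_iff (H * max h k) _ _ z φ.val).1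
      (φ.norm_le_seminorm (⟨H * max h k, hm⟩, n) z)
    set t := ‖reVec z.1‖
    have ht : 0 ≤ t := norm_nonneg _
    have h3 := hM2.exp_mul_exp_le hM (t := max h k * t) (by positivity)
    rw [← mul_assoc] at h3
    have h4 : Real.exp (assocFun M (h * t)) * Real.exp (assocFun M (k * t)) ≤
        C₀ * Real.exp (assocFun M (H * max h k * t)) := by
      refine le_trans ?_ h3
      gcongr
      · exact hM.assocFun_mono (by positivity) (by gcongr; exact le_max_left _ _)
      · exact hM.assocFun_mono (by positivity) (by gcongr; exact le_max_right _ _)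
    change ‖P.val.1 z.1 * φ.val.1 z.1‖ ≤ _
    rw [norm_mul]
    refine (mul_le_mul h1 h2 (norm_nonneg _) ((norm_nonneg _).trans h1)).trans ?_
    set SP := SupSpace.seminorm (fun n : ℕ => weightedGrowth d M h (n : ℝ)) n P
    set Sφ := SupSpace.seminorm
      (fun i : Set.Ioi (0 : ℝ) × ℕ => weightedDecay d M (i.1 : ℝ) (i.2 : ℝ))
      (⟨H * max h k, hm⟩, n) φ
    have hSP : 0 ≤ SP := apply_nonneg _ _
    have hSφ : 0 ≤ Sφ := apply_nonneg _ _
    have h5 : Real.exp (assocFun M (h * t)) * Real.exp (-assocFun M (H * max h k * t)) ≤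
        C₀ * Real.exp (-assocFun M (k * t)) := by
      rw [Real.exp_neg, Real.exp_neg, ← div_eq_mul_inv, ← div_eq_mul_inv,
        div_le_div_iff₀ (Real.exp_pos _) (Real.exp_pos _)]
      exact h4
    calc _ = SP * Sφ * (Real.exp (assocFun M (h * t)) *
          Real.exp (-assocFun M (H * max h k * t))) := by ring
      _ ≤ SP * Sφ * (C₀ * Real.exp (-assocFun M (k * t))) := by gcongr
      _ = _ := by ring

theorem isMultiplication_mulBeurling (hM : IsWeightSequence M) {C₀ H : ℝ}
    (hM2 : ConditionM2 M C₀ H) {h : ℝ} (hh : 0 < h) (P : PSpace d M h) :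
    IsMultiplication P (mulBeurling hM hM2 hh P) := fun _ _ => rfl

/-- Fourier inversion on `𝒰^{(M)}(ℂ^d)`. -/
theorem laplace_reflect_fourier (hd : 0 < d) (hM : IsWeightSequence M) {C₀ H : ℝ}
    (hM2 : ConditionM2 M C₀ H) (φ : UBeurling d M) :
    laplaceBeurling hd hM (reflectBeurling hM (fourierBeurling hM hM2 φ)) = φ := by
  refine SupSpace.val_injective (Subtype.ext ?_)
  refine eq_of_eq_on_ofRealVec (differentiable_entire _) (differentiable_entire φ.val) fun y => ?_
  change laplace (fun x => 𝓕 (fun x => φ.val.1 (ofRealVec x)) (0 - x)) (ofRealVec y) = _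
  rw [laplace_ofRealVec]
  have hr : (fun x => φ.val.1 (ofRealVec x)) ∈ rapidSubmodule d := (restrictBeurling hM φ).2
  have h2 : Integrable (𝓕 fun x => φ.val.1 (ofRealVec x)) :=
    ((KBeurling.dirExpDecay hM (fourierBeurling hM hM2 φ)).expDecay hd).integrable
  have h3 := congr_fun (Continuous.fourierInv_fourier_eq hr.1 (integrable_of_mem_rapid hr) h2) y
  rw [← h3, Real.fourierInv_eq, Real.fourier_eq, ← integral_neg_eq_self]
  refine integral_congr_ae (Eventually.of_forall fun x => ?_)
  simp

end Beurling


/-! # Windows -/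

section Window

variable {d : ℕ} {M : ℕ → ℝ}

/-- An ultradifferentiable window of integral one. -/
structure IsWindow (M : ℕ → ℝ) (χ : SmoothFun d) : Prop where
  exists_dirBound : ∀ r : ℝ, 0 < r → ∀ c : ℝ, ∃ D, 0 ≤ D ∧
    χ.DirBound M r fun x => D * Real.exp (-c * ‖x‖)
  integral_eq_one : ∫ x, χ.1 x = 1

theorem SmoothFun.DirBound.const_smul {u : SmoothFun d} {r : ℝ} {B : EuclideanSpace ℝ (Fin d) → ℝ}
    (hu : u.DirBound M r B) (a : ℂ) : (a • u).DirBound M r (fun x => ‖a‖ * B x) := fun j p x => by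
  rw [map_smul]
  change ‖a * ((partialDeriv j ^ p) u).1 x‖ ≤ _
  rw [norm_mul, mul_assoc, mul_assoc, ← mul_assoc (B x)]
  exact mul_le_mul_of_nonneg_left (hu j p x) (norm_nonneg a)

/-- A nonzero `φ` may have integral zero, but `|φ|² = φ φ̄` has positive integral, and it keeps the
bounds by the Leibniz estimate. Dividing by the integral gives the window. -/
theorem exists_isWindow (hM : IsWeightSequence M) (hd : 0 < d) (hK : ∃ φ : KBeurling d M, φ ≠ 0) :
    ∃ χ : SmoothFun d, IsWindow M χ := by
  obtain ⟨φ, hφ⟩ := hK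
  set ψ := φ.val.mul φ.val.conj with hψ
  have hb : ∀ r : ℝ, 0 < r → ∀ c : ℝ, ∃ D, 0 ≤ D ∧
      ψ.DirBound M r fun x => D * Real.exp (-c * ‖x‖) := fun r hr c => by
    -- In the product the ratios double and the exponents add.
    obtain ⟨A, hA, h⟩ := φ.exists_dirBound hM (half_pos hr) (c / 2)
    refine ⟨A * A, mul_nonneg hA hA, ?_⟩
    have h2 := h.mul hM (half_pos hr).le h.conj
    rw [mul_div_cancel₀ _ two_ne_zero] at h2
    refine h2.mono_right hM hr.le fun x => le_of_eq ?_
    rw [mul_mul_mul_comm, ← Real.exp_add]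
    ring_nf
  have hψx : ∀ x, ψ.1 x = ((‖φ.val.1 x‖ ^ 2 : ℝ) : ℂ) := fun x => by
    push_cast
    exact Complex.mul_conj' _
  have hdec : ExpDecay ψ.1 := (SmoothFun.DirExpDecay.of_dirBound hM fun c => by
    obtain ⟨A, -, h⟩ := hb 1 one_pos c
    exact ⟨A, 1, zero_le_one, h⟩).expDecay hd
  obtain ⟨x₀, hx₀⟩ : ∃ x, φ.val.1 x ≠ 0 := by
    by_contra! hcon
    exact hφ (SupSpace.val_injective (Subtype.ext (funext hcon)))
  have hint : Integrable fun x => ‖φ.val.1 x‖ ^ 2 := by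
    have := hdec.integrable.norm
    refine this.congr (Eventually.of_forall fun x => ?_)
    simp only [hψx]
    rw [Complex.norm_real, Real.norm_of_nonneg (by positivity)]
  have hpos : 0 < ∫ x, ‖φ.val.1 x‖ ^ 2 := by
    have hc : Continuous fun x => ‖φ.val.1 x‖ ^ 2 := φ.val.continuous.norm.pow 2
    rw [integral_pos_iff_support_of_nonneg (fun x => by positivity) hint]
    exact hc.isOpen_support.measure_pos _ ⟨x₀, by simpa using hx₀⟩
  set a : ℝ := ∫ x, ‖φ.val.1 x‖ ^ 2 with ha
  refine ⟨((a : ℂ)⁻¹) • ψ, fun r hr c => ?_, ?_⟩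
  · obtain ⟨D, hD, h⟩ := hb r hr c
    refine ⟨‖((a : ℂ)⁻¹)‖ * D, by positivity, (h.const_smul _).mono_right hM hr.le fun x => ?_⟩
    rw [mul_assoc]
  · change ∫ x, (a : ℂ)⁻¹ * ψ.1 x = 1
    rw [integral_const_mul]
    simp only [hψx]
    rw [integral_complex_ofReal, ← ha, inv_mul_cancel₀]
    exact_mod_cast hpos.ne'

namespace IsWindow

variable {χ : SmoothFun d}

theorem dirExpDecay (hχ : IsWindow M χ) (hM : IsWeightSequence M) : χ.DirExpDecay :=
  .of_dirBound hM fun c => by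
    obtain ⟨A, -, h⟩ := hχ.exists_dirBound 1 one_pos c
    exact ⟨A, 1, zero_le_one, h⟩

end IsWindow

/-- `ψ` is ultradifferentiable of exponential growth. -/
def ExpGrowth (M : ℕ → ℝ) (r : ℝ) (ψ : SmoothFun d) : Prop :=
  ∃ A c, 0 ≤ A ∧ ψ.DirBound M r fun x => A * Real.exp (c * ‖x‖)

/-- The product of `ψ` with the window reflected at `t`. -/
def windowed (χ ψ : SmoothFun d) (t : EuclideanSpace ℝ (Fin d)) : SmoothFun d :=
  ψ.mul (SmoothFun.reflect t χ)

theorem windowed_apply (χ ψ : SmoothFun d) (t x : EuclideanSpace ℝ (Fin d)) :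
    (windowed χ ψ t).1 x = ψ.1 x * χ.1 (t - x) := rfl

variable {χ : SmoothFun d} {r : ℝ}

/-- The window decays faster than every exponential in `t - x`, which for fixed `t` outweighs the
growth of `ψ` in `x`. -/
theorem ExpGrowth.dirExpDecay_windowed {ψ : SmoothFun d} (hψ : ExpGrowth M r ψ)
    (hχ : IsWindow M χ) (hM : IsWeightSequence M) (hr : 0 < r) (t : EuclideanSpace ℝ (Fin d)) :
    (windowed χ ψ t).DirExpDecay := by
  obtain ⟨A, c, hA, hψ⟩ := hψ
  refine .of_dirBound hM fun c' => ?_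
  set m := |c| + |c'| with hm
  obtain ⟨D, hD, hb⟩ := hχ.exists_dirBound r hr m
  refine ⟨A * D * Real.exp (m * ‖t‖), 2 * r, by positivity,
    (hψ.mul hM hr.le (hb.reflect t)).mono_right hM (by positivity) fun x => ?_⟩
  have h1 : ‖x‖ ≤ ‖t‖ + ‖t - x‖ := by
    have := norm_sub_le t (t - x)
    rwa [sub_sub_cancel] at this
  have h2 : m * ‖x‖ ≤ m * (‖t‖ + ‖t - x‖) := by gcongr
  have h3 : c * ‖x‖ ≤ |c| * ‖x‖ := by gcongr; exact le_abs_self c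
  have h4 : c' * ‖x‖ ≤ |c'| * ‖x‖ := by gcongr; exact le_abs_self c'
  calc _ = A * D * (Real.exp (c * ‖x‖) * Real.exp (-m * ‖t - x‖)) := by ring
    _ = A * D * Real.exp (c * ‖x‖ + -m * ‖t - x‖) := by rw [Real.exp_add]
    _ ≤ A * D * Real.exp (m * ‖t‖ + -c' * ‖x‖) := by
      refine mul_le_mul_of_nonneg_left (Real.exp_le_exp.2 ?_) (by positivity)
      nlinarith
    _ = _ := by rw [Real.exp_add]; ring

/-- The Fourier–Laplace transform of a windowed function. -/
theorem IsWindow.exists_norm_laplace_windowed_le (hχ : IsWindow M χ) (hM : IsWeightSequence M)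
    (hd : 0 < d) (hr : 0 < r) (c a : ℝ) :
    ∃ K, 0 ≤ K ∧ ∀ (ψ : SmoothFun d) (A : ℝ), 0 ≤ A →
      (ψ.DirBound M r fun x => A * Real.exp (c * ‖x‖)) → ∀ (t : EuclideanSpace ℝ (Fin d))
      (z : EuclideanSpace ℂ (Fin d)), ‖imVec z‖ ≤ a → ‖laplace (windowed χ ψ t).1 z‖ ≤
        A * K * Real.exp (c * ‖t‖ + 2 * π * inner ℝ t (imVec z)) *
          Real.exp (-assocFun M (π / (√(d : ℝ) * r) * ‖reVec z‖)) := by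
  -- `|c|` and `2πa` pay for replacing `x` by `t` in `e^{c‖x‖}` and in the kernel; the 1 leaves an
  -- integrable factor. Keeping the exact `e^{2π t · Im z}` is essential for the later shift.
  set m := |c| + 2 * π * a + 1 with hm
  obtain ⟨D, hD, hb⟩ := hχ.exists_dirBound r hr m
  set J := ∫ x : EuclideanSpace ℝ (Fin d), Real.exp (-1 * ‖x‖) with hJ
  have hJ0 : 0 ≤ J := integral_nonneg fun x => (Real.exp_pos _).le
  refine ⟨D * J, by positivity, fun ψ A hA hψ t z hz => ?_⟩
  have hB := hψ.mul hM hr.le (hb.reflect t)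
  have hle : ∀ x, A * Real.exp (c * ‖x‖) * (D * Real.exp (-m * ‖t - x‖)) *
      Real.exp (2 * π * inner ℝ x (imVec z)) ≤
      A * D * Real.exp (c * ‖t‖ + 2 * π * inner ℝ t (imVec z)) * Real.exp (-1 * ‖t - x‖) :=
    fun x => by
    have h1 : c * ‖x‖ ≤ c * ‖t‖ + |c| * ‖t - x‖ := by
      have h2 : c * (‖x‖ - ‖t‖) ≤ |c| * |‖x‖ - ‖t‖| := by
        rw [← abs_mul]; exact le_abs_self _
      have h3 : |‖x‖ - ‖t‖| ≤ ‖t - x‖ := by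
        rw [← norm_sub_rev x t]; exact abs_norm_sub_norm_le x t
      nlinarith [mul_le_mul_of_nonneg_left h3 (abs_nonneg c)]
    have h2 : inner ℝ x (imVec z) ≤ inner ℝ t (imVec z) + ‖t - x‖ * a := by
      have h3 : inner ℝ x (imVec z) = inner ℝ t (imVec z) + inner ℝ (x - t) (imVec z) := by
        rw [inner_sub_left]; ring
      rw [h3, norm_sub_rev]
      gcongr
      exact (real_inner_le_norm _ _).trans (by gcongr)
    have h3 : 2 * π * inner ℝ x (imVec z) ≤
        2 * π * (inner ℝ t (imVec z) + ‖t - x‖ * a) := by gcongr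
    calc _ = A * D * (Real.exp (c * ‖x‖) * Real.exp (-m * ‖t - x‖) *
          Real.exp (2 * π * inner ℝ x (imVec z))) := by ring
      _ = A * D * Real.exp (c * ‖x‖ + -m * ‖t - x‖ + 2 * π * inner ℝ x (imVec z)) := by
        rw [Real.exp_add, Real.exp_add]
      _ ≤ A * D * Real.exp ((c * ‖t‖ + 2 * π * inner ℝ t (imVec z)) + -1 * ‖t - x‖) := by
        refine mul_le_mul_of_nonneg_left (Real.exp_le_exp.2 ?_) (by positivity)
        rw [hm]
        linarith
      _ = _ := by rw [Real.exp_add (c * ‖t‖ + _)]; ring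
  have hint : Integrable fun x : EuclideanSpace ℝ (Fin d) =>
      A * D * Real.exp (c * ‖t‖ + 2 * π * inner ℝ t (imVec z)) * Real.exp (-1 * ‖t - x‖) :=
    ((integrable_exp_neg_mul_norm one_pos).comp_sub_left t).const_mul _
  have hint' : Integrable fun x : EuclideanSpace ℝ (Fin d) =>
      A * Real.exp (c * ‖x‖) * (D * Real.exp (-m * ‖t - x‖)) *
        Real.exp (2 * π * inner ℝ x (imVec z)) :=
    hint.mono' (by fun_prop) (Eventually.of_forall fun x => by
      rw [Real.norm_of_nonneg (by positivity)]
      exact hle x)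
  have h1 := hB.norm_laplace_mul_exp_le
    (ExpGrowth.dirExpDecay_windowed ⟨A, c, hA, hψ⟩ hχ hM hr t) hM (by positivity) hd z hint'
  -- The window is taken with the same ratio `r` as `ψ`; the product has ratio `2r`.
  rw [show 2 * π / (√(d : ℝ) * (2 * r)) = π / (√(d : ℝ) * r) by
    rw [mul_left_comm, mul_div_mul_left _ _ two_ne_zero]] at h1
  rw [Real.exp_neg, ← div_eq_mul_inv, le_div_iff₀ (Real.exp_pos _)]
  refine h1.trans ((integral_mono hint' hint hle).trans_eq ?_)
  rw [integral_const_mul,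
    integral_sub_left_eq_self (fun x : EuclideanSpace ℝ (Fin d) => Real.exp (-1 * ‖x‖)) volume t]
  ring

end Window

/-! # The pairing -/

section Pairing

variable {d : ℕ} {M : ℕ → ℝ}

/-- The integral of `P` against the Fourier transform of a windowed function. -/
noncomputable def windowIntegral (χ : SmoothFun d) (P : EntireFun d) (ψ : SmoothFun d)
    (t : EuclideanSpace ℝ (Fin d)) : ℂ :=
  ∫ ξ, P.1 (ofRealVec ξ) * laplace (windowed χ ψ t).1 (ofRealVec ξ)

/-- The pairing of the Fourier transform of `P` with `ψ`. -/
noncomputable def windowPairing (χ : SmoothFun d) (P : EntireFun d) (ψ : SmoothFun d) : ℂ :=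
  ∫ t, windowIntegral χ P ψ t

theorem stronglyMeasurable_laplace_windowed (χ ψ : SmoothFun d) :
    StronglyMeasurable fun p : EuclideanSpace ℝ (Fin d) × EuclideanSpace ℝ (Fin d) =>
      laplace (windowed χ ψ p.1).1 (ofRealVec p.2) := by
  refine StronglyMeasurable.integral_prod_right
    (f := fun (p : EuclideanSpace ℝ (Fin d) × EuclideanSpace ℝ (Fin d)) x =>
      (windowed χ ψ p.1).1 x * laplaceKernel x (ofRealVec p.2)) (Continuous.stronglyMeasurable ?_)
  have h1 := ψ.continuous
  have h2 := χ.continuous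
  have h3 := continuous_laplaceKernel (d := d)
  have h4 := continuous_ofRealVec (d := d)
  have h5 : Continuous fun q : (EuclideanSpace ℝ (Fin d) × EuclideanSpace ℝ (Fin d)) ×
      EuclideanSpace ℝ (Fin d) => laplaceKernel q.2 (ofRealVec q.1.2) :=
    h3.comp (continuous_snd.prodMk (h4.comp (continuous_snd.comp continuous_fst)))
  have h6 : Continuous fun q : (EuclideanSpace ℝ (Fin d) × EuclideanSpace ℝ (Fin d)) ×
      EuclideanSpace ℝ (Fin d) => ψ.1 q.2 * χ.1 (q.1.1 - q.2) := by fun_prop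
  exact h6.mul h5

theorem stronglyMeasurable_mul_laplace_windowed (χ ψ : SmoothFun d) (P : EntireFun d) :
    StronglyMeasurable fun p : EuclideanSpace ℝ (Fin d) × EuclideanSpace ℝ (Fin d) =>
      P.1 (ofRealVec p.2) * laplace (windowed χ ψ p.1).1 (ofRealVec p.2) :=
  ((differentiable_entire P).continuous.comp
    (continuous_ofRealVec.comp continuous_snd)).stronglyMeasurable.mul
    (stronglyMeasurable_laplace_windowed χ ψ)

theorem stronglyMeasurable_windowIntegral (χ ψ : SmoothFun d) (P : EntireFun d) :
    StronglyMeasurable (windowIntegral χ P ψ) :=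
  StronglyMeasurable.integral_prod_right (f := fun t ξ =>
    P.1 (ofRealVec ξ) * laplace (windowed χ ψ t).1 (ofRealVec ξ))
    (stronglyMeasurable_mul_laplace_windowed χ ψ P)

variable {C₀ H : ℝ} {χ : SmoothFun d}

/-- The index `2 √d H h / π`. -/
noncomputable abbrev dualIndex (d : ℕ) (H h : ℝ) : ℝ := 2 * √(d : ℝ) * H * h / π

theorem dualIndex_pos (hd : 0 < d) (hM2 : ConditionM2 M C₀ H) {h : ℝ} (hh : 0 < h) :
    0 < dualIndex d H h := by
  have hH : 0 < H := zero_lt_one.trans_le hM2.one_le_H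
  have hds : 0 < √(d : ℝ) := Real.sqrt_pos.2 (by exact_mod_cast hd)
  unfold dualIndex
  positivity

/-- With `r` the reciprocal of `dualIndex`, `π / (√d r) = 2Hh`. Hence the transform decays like
`e^{-ν_M(2Hh|Re z|)}`, and after multiplication by `P` there remains `e^{-ν_M(h|Re z|)}`, which
dominates the integrable power. -/
theorem IsWindow.exists_norm_mul_laplace_windowed_le (hχ : IsWindow M χ) (hM : IsWeightSequence M)
    (hM2 : ConditionM2 M C₀ H) (hd : 0 < d) {h : ℝ} (hh : 0 < h) (c a : ℝ) :
    ∃ K, 0 ≤ K ∧ ∃ N : ℕ, ∀ (P : PSpace d M h) (ψ : SmoothFun d) (A : ℝ), 0 ≤ A →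
      (ψ.DirBound M (dualIndex d H h)⁻¹ fun x => A * Real.exp (c * ‖x‖)) →
      ∀ (t : EuclideanSpace ℝ (Fin d)) (z : EuclideanSpace ℂ (Fin d)), ‖imVec z‖ ≤ a →
        ‖P.val.1 z * laplace (windowed χ ψ t).1 z‖ ≤
          K * SupSpace.seminorm _ N P * A * Real.exp (c * ‖t‖ + 2 * π * inner ℝ t (imVec z)) *
            ((1 + ‖reVec z‖) ^ (d + 1))⁻¹ := by
  have hH : 0 < H := zero_lt_one.trans_le hM2.one_le_H
  have hC₀ : 0 < C₀ := zero_lt_one.trans_le hM2.one_le_C₀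
  have hds : 0 < √(d : ℝ) := Real.sqrt_pos.2 (by exact_mod_cast hd)
  have hpos := dualIndex_pos hd hM2 hh
  obtain ⟨K, hK, hKb⟩ := hχ.exists_norm_laplace_windowed_le hM hd (inv_pos.2 hpos) c a
  obtain ⟨C₁, hC₁, hCb⟩ := hM.exists_one_add_pow_le hh (d + 1)
  obtain ⟨N, hN⟩ := exists_nat_gt a
  refine ⟨K * C₀ * C₁, by positivity, N, fun P ψ A hA hψ t z hz => ?_⟩
  have h1 := hKb ψ A hA hψ t z hz
  have hzN : z ∈ tube d (N : ℝ) := hz.trans_lt hN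
  have h2 := (norm_weightedGrowth_le_iff h _ _ ⟨z, hzN⟩ P.val).1 (P.norm_le_seminorm N ⟨z, hzN⟩)
  rw [show π / (√(d : ℝ) * (dualIndex d H h)⁻¹) = 2 * H * h by
    unfold dualIndex; field_simp, mul_assoc (2 * H)] at h1
  set s := ‖reVec z‖
  have hs : 0 ≤ s := norm_nonneg _
  set S := SupSpace.seminorm (fun n : ℕ => weightedGrowth d M h (n : ℝ)) N P
  have hS : 0 ≤ S := apply_nonneg _ _
  set E := Real.exp (c * ‖t‖ + 2 * π * inner ℝ t (imVec z))
  have h3 := hM2.exp_mul_exp_neg_le hM (t := h * s) (by positivity)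
  have h4 : Real.exp (-assocFun M (h * s)) ≤ C₁ * ((1 + s) ^ (d + 1))⁻¹ := by
    rw [Real.exp_neg, ← div_eq_mul_inv, le_div_iff₀ (by positivity),
      inv_mul_le_iff₀ (Real.exp_pos _), mul_comm]
    exact hCb s hs
  rw [norm_mul]
  calc _ ≤ (S * Real.exp (assocFun M (h * s))) *
        (A * K * E * Real.exp (-assocFun M (2 * H * (h * s)))) :=
        mul_le_mul h2 h1 (norm_nonneg _) (by positivity)
    _ = S * A * K * E * (Real.exp (assocFun M (h * s)) *
        Real.exp (-assocFun M (2 * H * (h * s)))) := by ring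
    _ ≤ S * A * K * E * (C₀ * (C₁ * ((1 + s) ^ (d + 1))⁻¹)) := by
        refine mul_le_mul_of_nonneg_left (h3.trans ?_) (by positivity)
        gcongr
    _ = _ := by ring

/-- On `ℝ^d` the integral is only bounded by `e^{c‖t‖}`. Moving it to `ℝ^d + iη` with `η` opposite
to `t` and of length `(|c| + 1) / (2π)` gains `e^{-(|c| + 1)‖t‖}`. -/
theorem IsWindow.exists_norm_windowIntegral_le (hχ : IsWindow M χ) (hM : IsWeightSequence M)
    (hM2 : ConditionM2 M C₀ H) (hd : 0 < d) {h : ℝ} (hh : 0 < h) (c : ℝ) :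
    ∃ K, 0 ≤ K ∧ ∃ N : ℕ, ∀ (P : PSpace d M h) (ψ : SmoothFun d) (A : ℝ), 0 ≤ A →
      (ψ.DirBound M (dualIndex d H h)⁻¹ fun x => A * Real.exp (c * ‖x‖)) →
      ∀ t : EuclideanSpace ℝ (Fin d), ‖windowIntegral χ P.val ψ t‖ ≤
        K * SupSpace.seminorm _ N P * A * Real.exp (-1 * ‖t‖) := by
  have hpos := dualIndex_pos hd hM2 hh
  have ha : 0 ≤ (|c| + 1) / (2 * π) := by positivity
  obtain ⟨K, hK, N, hKb⟩ := hχ.exists_norm_mul_laplace_windowed_le hM hM2 hd hh c ((|c| + 1) / (2 * π))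
  set J : ℝ := ∫ x : EuclideanSpace ℝ (Fin d), ((1 + ‖x‖) ^ (d + 1))⁻¹ with hJ
  have hJ0 : 0 ≤ J := integral_nonneg fun x => by positivity
  refine ⟨K * J, by positivity, N, fun P ψ A hA hψ t => ?_⟩
  obtain ⟨η, hη, hηt⟩ := exists_norm_le_inner_eq ha t
  have hQ : Differentiable ℂ fun z => P.val.1 z * laplace (windowed χ ψ t).1 z :=
    (differentiable_entire P.val).mul ((ExpGrowth.dirExpDecay_windowed ⟨A, c, hA, hψ⟩ hχ hM
      (inv_pos.2 hpos) t).expDecay hd).differentiable_laplace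
  have hshift := integral_shift_eq hQ (fun L => by
    obtain ⟨K', hK', N', hKb'⟩ :=
      hχ.exists_norm_mul_laplace_windowed_le hM hM2 hd hh c |L|
    have hS : 0 ≤ SupSpace.seminorm _ N' P := apply_nonneg _ _
    refine ⟨K' * SupSpace.seminorm _ N' P * A * Real.exp (c * ‖t‖ + 2 * π * (‖t‖ * |L|)),
      by positivity, fun z hz => ?_⟩
    have hz' := hz.trans (le_abs_self L)
    refine (hKb' P ψ A hA hψ t z hz').trans ?_
    gcongr
    exact (real_inner_le_norm _ _).trans (by gcongr)) η
  rw [windowIntegral, ← hshift]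
  have hS : 0 ≤ SupSpace.seminorm _ N P := apply_nonneg _ _
  calc _ ≤ ∫ x : EuclideanSpace ℝ (Fin d), K * SupSpace.seminorm _ N P * A *
        Real.exp (-1 * ‖t‖) * ((1 + ‖x‖) ^ (d + 1))⁻¹ := by
        refine norm_integral_le_of_norm_le (integrable_inv_one_add_norm_pow.const_mul _)
          (Eventually.of_forall fun x => ?_)
        have h2 := hKb P ψ A hA hψ t (ofRealVec x + Complex.I • ofRealVec η) (by simpa using hη)
        rw [reVec_shift, Complex.I_re, zero_smul, add_zero, imVec_shift, Complex.I_im, one_smul,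
          hηt] at h2
        refine h2.trans ?_
        gcongr
        have h3 : 2 * π * -((|c| + 1) / (2 * π) * ‖t‖) = -(|c| + 1) * ‖t‖ := by
          field_simp
        rw [h3]
        nlinarith [mul_le_mul_of_nonneg_right (le_abs_self c) (norm_nonneg t)]
    _ = _ := by rw [integral_const_mul, ← hJ]; ring

theorem IsWindow.integrable_mul_laplace_windowed (hχ : IsWindow M χ) (hM : IsWeightSequence M)
    (hM2 : ConditionM2 M C₀ H) (hd : 0 < d) {h : ℝ} (hh : 0 < h) (P : PSpace d M h)
    {ψ : SmoothFun d} (hψ : ExpGrowth M (dualIndex d H h)⁻¹ ψ) (t : EuclideanSpace ℝ (Fin d)) :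
    Integrable fun ξ => P.val.1 (ofRealVec ξ) * laplace (windowed χ ψ t).1 (ofRealVec ξ) := by
  obtain ⟨A, c, hA, hψ⟩ := hψ
  obtain ⟨K, hK, N, hKb⟩ := hχ.exists_norm_mul_laplace_windowed_le hM hM2 hd hh c 0
  refine (integrable_inv_one_add_norm_pow.const_mul (K * SupSpace.seminorm _ N P * A *
    Real.exp (c * ‖t‖))).mono' ((stronglyMeasurable_mul_laplace_windowed χ ψ P.val).comp_measurable
      measurable_prodMk_left).aestronglyMeasurable (Eventually.of_forall fun ξ => ?_)
  simpa using hKb P ψ A hA hψ t (ofRealVec ξ) (by simp)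

theorem IsWindow.integrable_windowIntegral (hχ : IsWindow M χ) (hM : IsWeightSequence M)
    (hM2 : ConditionM2 M C₀ H) (hd : 0 < d) {h : ℝ} (hh : 0 < h) (P : PSpace d M h)
    {ψ : SmoothFun d} (hψ : ExpGrowth M (dualIndex d H h)⁻¹ ψ) :
    Integrable (windowIntegral χ P.val ψ) := by
  obtain ⟨A, c, hA, hψ⟩ := hψ
  obtain ⟨K, hK, N, hKb⟩ := hχ.exists_norm_windowIntegral_le hM hM2 hd hh c
  exact ((integrable_exp_neg_mul_norm one_pos).const_mul _).mono'
    (stronglyMeasurable_windowIntegral χ ψ P.val).aestronglyMeasurable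
    (Eventually.of_forall (hKb P ψ A hA hψ))

end Pairing


/-! # The Fourier transform into the strong dual -/

section Spaces

variable {d : ℕ} {M : ℕ → ℝ}

theorem weightedDeriv_eq_smul (h c c' : ℝ) (j : (Fin d → ℕ) × EuclideanSpace ℝ (Fin d)) :
    weightedDeriv d M h c j =
      ((Real.exp ((c - c') * ‖j.2‖) : ℝ) : ℂ) • weightedDeriv d M h c' j := by
  rw [weightedDeriv, weightedDeriv, smul_smul, ← Complex.ofReal_mul]
  congr 2
  rw [sub_mul, Real.exp_sub]
  field_simp

theorem norm_weightedDeriv_eq (h c c' : ℝ) (j : (Fin d → ℕ) × EuclideanSpace ℝ (Fin d))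
    (u : SmoothFun d) : ‖weightedDeriv d M h c j u‖ =
      Real.exp ((c - c') * ‖j.2‖) * ‖weightedDeriv d M h c' j u‖ := by
  rw [weightedDeriv_eq_smul h c c', LinearMap.smul_apply, norm_smul, Complex.norm_real,
    Real.norm_of_nonneg (Real.exp_pos _).le]

theorem norm_weightedDeriv_mono (h : ℝ) {m n : ℕ} (hmn : m ≤ n)
    (j : (Fin d → ℕ) × EuclideanSpace ℝ (Fin d)) (u : SmoothFun d) :
    ‖weightedDeriv d M h (-(n : ℝ)) j u‖ ≤ ‖weightedDeriv d M h (-(m : ℝ)) j u‖ := by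
  rw [norm_weightedDeriv_eq h (-(n : ℝ)) (-(m : ℝ))]
  refine mul_le_of_le_one_left (norm_nonneg _) (Real.exp_le_one_iff.2 ?_)
  have : (m : ℝ) ≤ n := by exact_mod_cast hmn
  exact mul_nonpos_of_nonpos_of_nonneg (by linarith) (norm_nonneg _)

theorem dirBound_of_growth (hM : IsWeightSequence M) {k : ℝ} (hk : 0 < k) {n : ℕ} {S : ℝ}
    {u : SmoothFun d} (h : ∀ j, ‖weightedDeriv d M k (-(n : ℝ)) j u‖ ≤ S) :
    u.DirBound M k⁻¹ fun x => S * Real.exp (n * ‖x‖) := by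
  have := SmoothFun.DirBound.of_weightedDeriv hM hk h
  rwa [neg_neg] at this

theorem OC.exists_ofStep {k : ℝ} (ψ : OC d M k) : ∃ (n : ℕ) (w : OCStep d M k n),
    ψ = IndSpace.ofStep (fun (n : ℕ) (_ : Unit) => weightedDeriv d M k (-(n : ℝ))) n w := by
  have hmono : Monotone fun n : ℕ =>
      boundedSubmodule fun _ : Unit => weightedDeriv d M k (-(n : ℝ)) := fun m n hmn v hv => by
    refine SupSpace.mem_boundedSubmodule fun i => ?_
    obtain ⟨C, hC⟩ := hv i
    exact ⟨C, fun j => (norm_weightedDeriv_mono k hmn j v).trans (hC ⟨j, rfl⟩)⟩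
  exact IndSpace.exists_ofStep hmono.directed_le ψ

theorem OC.expGrowth (hM : IsWeightSequence M) {k : ℝ} (hk : 0 < k) (ψ : OC d M k) :
    ExpGrowth M k⁻¹ ψ.val := by
  obtain ⟨n, w, rfl⟩ := ψ.exists_ofStep
  exact ⟨_, n, apply_nonneg _ _, dirBound_of_growth hM hk fun j => w.norm_le_seminorm () j⟩

theorem OC.exists_bound_of_isVonNBounded {k : ℝ} {B : Set (OC d M k)}
    (hB : Bornology.IsVonNBounded ℂ B) : ∃ (n : ℕ) (C : ℝ), 0 ≤ C ∧
      ∀ ψ ∈ B, ∀ j, ‖weightedDeriv d M k (-(n : ℝ)) j ψ.val‖ ≤ C := by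
  obtain ⟨n, C, h⟩ := IndSpace.exists_bound_of_isVonNBounded
    (fun n m j => ⟨_, fun v => (norm_weightedDeriv_eq k (-(n : ℝ)) (-(m : ℝ)) j v).le⟩)
    (fun m n j hmn v => norm_weightedDeriv_mono k hmn j v) hB
  exact ⟨n, |C|, abs_nonneg C, fun ψ hψ j => (h ψ hψ j).trans (le_abs_self C)⟩

theorem exists_continuous_seminorm_const_mul {I : Type} [Nonempty I] {J : I → Type} {V : Type}
    [AddCommGroup V] [Module ℂ V] (l : ∀ i, J i → V →ₗ[ℂ] ℂ) (i : I) {C : ℝ} (hC : 0 ≤ C) :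
    ∃ p : Seminorm ℂ (SupSpace l), Continuous p ∧ ∀ v, p v = C * SupSpace.seminorm l i v :=
  ⟨C.toNNReal • SupSpace.seminorm l i, (SupSpace.continuous_seminorm i).const_smul C.toNNReal,
    fun v => by
      change ((C.toNNReal : NNReal) : ℝ) * _ = _
      rw [Real.coe_toNNReal C hC]⟩

end Spaces

/-! ### Continuity and bilinearity of the pairing. -/

section FourierDual

variable {d : ℕ} {M : ℕ → ℝ} {C₀ H : ℝ} {χ : SmoothFun d}

/-- `K` and `N` depend only on the step `n`, and the bound is linear in both arguments: it serves
both for continuity of each functional and for uniformity over bounded sets of `𝒪_C`. -/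
theorem IsWindow.exists_norm_windowPairing_le (hχ : IsWindow M χ) (hM : IsWeightSequence M)
    (hM2 : ConditionM2 M C₀ H) (hd : 0 < d) {h : ℝ} (hh : 0 < h) (n : ℕ) :
    ∃ K, 0 ≤ K ∧ ∃ N : ℕ, ∀ (P : PSpace d M h) (ψ : SmoothFun d) (A : ℝ), 0 ≤ A →
      (∀ j, ‖weightedDeriv d M (dualIndex d H h) (-(n : ℝ)) j ψ‖ ≤ A) →
      ‖windowPairing χ P.val ψ‖ ≤ K * SupSpace.seminorm _ N P * A := by
  obtain ⟨K, hK, N, hKb⟩ := hχ.exists_norm_windowIntegral_le hM hM2 hd hh n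
  set J := ∫ x : EuclideanSpace ℝ (Fin d), Real.exp (-1 * ‖x‖) with hJ
  have hJ0 : 0 ≤ J := integral_nonneg fun x => (Real.exp_pos _).le
  refine ⟨K * J, by positivity, N, fun P ψ A hA hψ => ?_⟩
  have h1 := hKb P ψ A hA (dirBound_of_growth hM (dualIndex_pos hd hM2 hh) hψ)
  refine (norm_integral_le_of_norm_le ((integrable_exp_neg_mul_norm one_pos).const_mul _)
    (Eventually.of_forall h1)).trans_eq ?_
  rw [integral_const_mul, ← hJ]
  ring

theorem IsWindow.windowPairing_add_right (hχ : IsWindow M χ) (hM : IsWeightSequence M)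
    (hM2 : ConditionM2 M C₀ H) (hd : 0 < d) {h : ℝ} (hh : 0 < h) (P : PSpace d M h)
    {ψ ψ' : SmoothFun d} (hψ : ExpGrowth M (dualIndex d H h)⁻¹ ψ)
    (hψ' : ExpGrowth M (dualIndex d H h)⁻¹ ψ') :
    windowPairing χ P.val (ψ + ψ') = windowPairing χ P.val ψ + windowPairing χ P.val ψ' := by
  have hr := inv_pos.2 (dualIndex_pos hd hM2 hh)
  rw [windowPairing, windowPairing, windowPairing,
    ← integral_add (hχ.integrable_windowIntegral hM hM2 hd hh P hψ)
      (hχ.integrable_windowIntegral hM hM2 hd hh P hψ')]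
  refine integral_congr_ae (Eventually.of_forall fun t => ?_)
  simp only [windowIntegral]
  rw [← integral_add (hχ.integrable_mul_laplace_windowed hM hM2 hd hh P hψ t)
      (hχ.integrable_mul_laplace_windowed hM hM2 hd hh P hψ' t)]
  refine integral_congr_ae (Eventually.of_forall fun ξ => ?_)
  simp only
  rw [← mul_add, ← laplace_add ((hψ.dirExpDecay_windowed hχ hM hr t).expDecay hd)
    ((hψ'.dirExpDecay_windowed hχ hM hr t).expDecay hd)]
  congr 2
  funext x
  exact add_mul _ _ _

theorem windowPairing_smul_right (P : EntireFun d) (c : ℂ) (ψ : SmoothFun d) :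
    windowPairing χ P (c • ψ) = c * windowPairing χ P ψ := by
  simp only [windowPairing, windowIntegral]
  rw [← integral_const_mul]
  refine integral_congr_ae (Eventually.of_forall fun t => ?_)
  simp only
  rw [← integral_const_mul]
  refine integral_congr_ae (Eventually.of_forall fun ξ => ?_)
  simp only
  rw [mul_left_comm c, ← laplace_smul c]
  refine congrArg (fun f => P.1 (ofRealVec ξ) * laplace f (ofRealVec ξ)) (funext fun x => ?_)
  exact mul_assoc _ _ _

theorem IsWindow.windowPairing_add_left (hχ : IsWindow M χ) (hM : IsWeightSequence M)
    (hM2 : ConditionM2 M C₀ H) (hd : 0 < d) {h : ℝ} (hh : 0 < h) (P P' : PSpace d M h)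
    {ψ : SmoothFun d} (hψ : ExpGrowth M (dualIndex d H h)⁻¹ ψ) :
    windowPairing χ (P + P').val ψ = windowPairing χ P.val ψ + windowPairing χ P'.val ψ := by
  rw [windowPairing, windowPairing, windowPairing,
    ← integral_add (hχ.integrable_windowIntegral hM hM2 hd hh P hψ)
      (hχ.integrable_windowIntegral hM hM2 hd hh P' hψ)]
  refine integral_congr_ae (Eventually.of_forall fun t => ?_)
  simp only [windowIntegral]
  rw [← integral_add (hχ.integrable_mul_laplace_windowed hM hM2 hd hh P hψ t)
      (hχ.integrable_mul_laplace_windowed hM hM2 hd hh P' hψ t)]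
  exact integral_congr_ae (Eventually.of_forall fun ξ => add_mul _ _ _)

theorem windowPairing_smul_left (P : EntireFun d) (c : ℂ) (ψ : SmoothFun d) :
    windowPairing χ (c • P) ψ = c * windowPairing χ P ψ := by
  simp only [windowPairing, windowIntegral]
  rw [← integral_const_mul]
  refine integral_congr_ae (Eventually.of_forall fun t => ?_)
  simp only
  rw [← integral_const_mul]
  exact integral_congr_ae (Eventually.of_forall fun ξ => mul_assoc _ _ _)

/-- The pairing with the Fourier transform of an element of `𝒫^{M,h}`, as a linear map on
`𝒪_C`. -/
noncomputable def windowPairingLinear (hχ : IsWindow M χ) (hM : IsWeightSequence M)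
    (hM2 : ConditionM2 M C₀ H) (hd : 0 < d) {h : ℝ} (hh : 0 < h) (P : PSpace d M h) :
    OC d M (dualIndex d H h) →ₗ[ℂ] ℂ where
  toFun ψ := windowPairing χ P.val ψ.val
  map_add' ψ ψ' := by
    rw [map_add]
    exact hχ.windowPairing_add_right hM hM2 hd hh P (ψ.expGrowth hM (dualIndex_pos hd hM2 hh))
      (ψ'.expGrowth hM (dualIndex_pos hd hM2 hh))
  map_smul' c ψ := by
    rw [map_smul]
    exact windowPairing_smul_right _ c _

/-- The Fourier transform of an element of `𝒫^{M,h}`, as a functional on `𝒪_C`. -/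
noncomputable def fourierFunctional (hχ : IsWindow M χ) (hM : IsWeightSequence M)
    (hM2 : ConditionM2 M C₀ H) (hd : 0 < d) {h : ℝ} (hh : 0 < h) (P : PSpace d M h) :
    OCDual d M (dualIndex d H h) where
  toLinearMap := windowPairingLinear hχ hM hM2 hd hh P
  cont := IndSpace.continuous_of_bound (norm_withSeminorms ℂ ℂ) _ fun n _ => by
    obtain ⟨K, hK, N, hKb⟩ := hχ.exists_norm_windowPairing_le hM hM2 hd hh n
    exact ⟨(), K * SupSpace.seminorm _ N P, fun w =>
      hKb P w.val _ (apply_nonneg _ _) fun j => w.norm_le_seminorm () j⟩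

/-- The Fourier transform on `𝒫^{M,h}` as a linear map. -/
noncomputable def fourierDualLinear (hχ : IsWindow M χ) (hM : IsWeightSequence M)
    (hM2 : ConditionM2 M C₀ H) (hd : 0 < d) {h : ℝ} (hh : 0 < h) :
    PSpace d M h →ₗ[ℂ] OCDual d M (dualIndex d H h) where
  toFun := fourierFunctional hχ hM hM2 hd hh
  map_add' P P' := ContinuousLinearMap.ext fun ψ =>
    hχ.windowPairing_add_left hM hM2 hd hh P P' (ψ.expGrowth hM (dualIndex_pos hd hM2 hh))
  map_smul' c P := ContinuousLinearMap.ext fun ψ => windowPairing_smul_left P.val c ψ.val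

/-- The Fourier transform `𝒫^{M,h}(ℂ^d) → 𝒪'_C(ℝ^d)`. -/
noncomputable def fourierDual (hχ : IsWindow M χ) (hM : IsWeightSequence M)
    (hM2 : ConditionM2 M C₀ H) (hd : 0 < d) {h : ℝ} (hh : 0 < h) :
    PSpace d M h →L[ℂ] OCDual d M (dualIndex d H h) where
  toLinearMap := fourierDualLinear hχ hM hM2 hd hh
  cont := StrongDual.continuous_of_bound _ fun B hB => by
    obtain ⟨n, C, hC, hb⟩ := OC.exists_bound_of_isVonNBounded hB
    obtain ⟨K, hK, N, hKb⟩ := hχ.exists_norm_windowPairing_le hM hM2 hd hh n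
    obtain ⟨p, hp, hpe⟩ := exists_continuous_seminorm_const_mul
      (fun n : ℕ => weightedGrowth d M h (n : ℝ)) N (mul_nonneg hK hC)
    refine ⟨p, hp, fun P ψ hψ => ?_⟩
    rw [hpe, mul_right_comm]
    exact hKb P ψ.val C hC (hb ψ hψ)

theorem fourierDual_apply (hχ : IsWindow M χ) (hM : IsWeightSequence M)
    (hM2 : ConditionM2 M C₀ H) (hd : 0 < d) {h : ℝ} (hh : 0 < h) (P : PSpace d M h)
    (ψ : OC d M (dualIndex d H h)) :
    fourierDual hχ hM hM2 hd hh P ψ = windowPairing χ P.val ψ.val := rfl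

end FourierDual


/-! # Inclusions -/

section Inclusions

variable {d : ℕ} {M : ℕ → ℝ}

theorem norm_weightedDeriv_zero (hM : IsWeightSequence M) (h c : ℝ) (x : EuclideanSpace ℝ (Fin d))
    (u : SmoothFun d) : ‖weightedDeriv d M h c (0, x) u‖ = Real.exp (c * ‖x‖) * ‖u.1 x‖ := by
  have h0 : multiDeriv (0 : Fin d → ℕ) u = u := by simp [multiDeriv]
  have h1 : weightedDeriv d M h c (0, x) u =
      ((h ^ (∑ i, (0 : Fin d → ℕ) i) * Real.exp (c * ‖x‖) / M (∑ i, (0 : Fin d → ℕ) i) : ℝ) : ℂ) *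
        (multiDeriv (0 : Fin d → ℕ) u).1 x := rfl
  rw [h1, h0, norm_mul, Complex.norm_real]
  simp [hM.zero]

/-- The map which remembers only the exponential decay of an element of `𝒦^{{M}}`. -/
noncomputable def decayMap (hM : IsWeightSequence M) (m : ℕ) : KRoumieu d M →L[ℂ]
    SupSpace (fun (_ : Unit) (x : EuclideanSpace ℝ (Fin d)) => weightedDeriv d M 1 (m : ℝ) (0, x)) :=
  IndSpace.liftSup IndSpace.val fun h _ => ⟨m, 1, fun v x => by
    rw [one_mul, norm_weightedDeriv_zero hM, ← norm_weightedDeriv_zero hM (h : ℝ)]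
    exact v.norm_le_seminorm m (0, x)⟩

/-- The seminorm `sup_x |φ(x)| e^{m|x|}` on `𝒦^{{M}}`. -/
noncomputable def decaySeminorm (hM : IsWeightSequence M) (m : ℕ) : Seminorm ℂ (KRoumieu d M) :=
  (SupSpace.seminorm _ ()).comp (decayMap hM m).toLinearMap

theorem continuous_decaySeminorm (hM : IsWeightSequence M) (m : ℕ) :
    Continuous (decaySeminorm (d := d) hM m) :=
  (SupSpace.continuous_seminorm ()).comp (decayMap hM m).continuous

theorem norm_le_decaySeminorm (hM : IsWeightSequence M) (m : ℕ) (φ : KRoumieu d M)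
    (x : EuclideanSpace ℝ (Fin d)) :
    ‖φ.val.1 x‖ ≤ decaySeminorm hM m φ * Real.exp (-m * ‖x‖) := by
  have h1 := SupSpace.norm_le_seminorm (decayMap hM m φ) () x
  have h2 : ‖weightedDeriv d M 1 (m : ℝ) (0, x) φ.val‖ ≤ decaySeminorm hM m φ := h1
  rw [norm_weightedDeriv_zero hM] at h2
  rw [neg_mul, Real.exp_neg, ← div_eq_mul_inv, le_div_iff₀ (Real.exp_pos _), mul_comm]
  exact h2

theorem norm_mul_le_of_growth (hM : IsWeightSequence M) (φ : KRoumieu d M) {ψ : SmoothFun d}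
    {A : ℝ} {n : ℕ} (hψ : ∀ x, ‖ψ.1 x‖ ≤ A * Real.exp (n * ‖x‖))
    (x : EuclideanSpace ℝ (Fin d)) :
    ‖φ.val.1 x * ψ.1 x‖ ≤ decaySeminorm hM (n + 1) φ * A * Real.exp (-1 * ‖x‖) := by
  have hp : 0 ≤ decaySeminorm hM (n + 1) φ := apply_nonneg _ _
  rw [norm_mul]
  calc _ ≤ (decaySeminorm hM (n + 1) φ * Real.exp (-((n + 1 : ℕ) : ℝ) * ‖x‖)) *
        (A * Real.exp (n * ‖x‖)) :=
        mul_le_mul (norm_le_decaySeminorm hM (n + 1) φ x) (hψ x) (norm_nonneg _) (by positivity)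
    _ = decaySeminorm hM (n + 1) φ * A *
        (Real.exp (-((n + 1 : ℕ) : ℝ) * ‖x‖) * Real.exp (n * ‖x‖)) := by ring
    _ = _ := by
      rw [← Real.exp_add]
      push_cast
      ring_nf

theorem integrable_mul_of_growth (hM : IsWeightSequence M) (φ : KRoumieu d M) {ψ : SmoothFun d}
    {A : ℝ} {n : ℕ} (hψ : ∀ x, ‖ψ.1 x‖ ≤ A * Real.exp (n * ‖x‖)) :
    Integrable fun x => φ.val.1 x * ψ.1 x :=
  ((integrable_exp_neg_mul_norm one_pos).const_mul _).mono'
    (φ.val.continuous.mul ψ.continuous).aestronglyMeasurable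
    (Eventually.of_forall (norm_mul_le_of_growth hM φ hψ))

theorem norm_integral_mul_le_of_growth (hM : IsWeightSequence M) (φ : KRoumieu d M)
    {ψ : SmoothFun d} {A : ℝ} {n : ℕ} (hψ : ∀ x, ‖ψ.1 x‖ ≤ A * Real.exp (n * ‖x‖)) :
    ‖∫ x, φ.val.1 x * ψ.1 x‖ ≤ decaySeminorm hM (n + 1) φ * A *
      ∫ x : EuclideanSpace ℝ (Fin d), Real.exp (-1 * ‖x‖) := by
  rw [← integral_const_mul]
  exact norm_integral_le_of_norm_le ((integrable_exp_neg_mul_norm one_pos).const_mul _)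
    (Eventually.of_forall (norm_mul_le_of_growth hM φ hψ))

theorem norm_le_of_weightedDeriv (hM : IsWeightSequence M) {k A : ℝ} {n : ℕ} {ψ : SmoothFun d}
    (h : ∀ j, ‖weightedDeriv d M k (-(n : ℝ)) j ψ‖ ≤ A) (x : EuclideanSpace ℝ (Fin d)) :
    ‖ψ.1 x‖ ≤ A * Real.exp (n * ‖x‖) := by
  have h2 := h (0, x)
  rwa [norm_weightedDeriv_zero hM, neg_mul, Real.exp_neg, inv_mul_le_iff₀ (Real.exp_pos _),
    mul_comm] at h2

theorem integrable_mul_OC (hM : IsWeightSequence M) {k : ℝ} (φ : KRoumieu d M) (ψ : OC d M k) :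
    Integrable fun x => φ.val.1 x * ψ.val.1 x := by
  obtain ⟨n, w, rfl⟩ := ψ.exists_ofStep
  exact integrable_mul_of_growth hM φ
    (norm_le_of_weightedDeriv hM fun j => w.norm_le_seminorm () j)

/-- Integration against `φ` as a linear form on `𝒪_C`. -/
noncomputable def integralLinear (hM : IsWeightSequence M) (k : ℝ) (φ : KRoumieu d M) :
    OC d M k →ₗ[ℂ] ℂ where
  toFun ψ := ∫ x, φ.val.1 x * ψ.val.1 x
  map_add' ψ ψ' := by
    rw [← integral_add (integrable_mul_OC hM φ ψ) (integrable_mul_OC hM φ ψ')]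
    exact integral_congr_ae (Eventually.of_forall fun x => mul_add _ _ _)
  map_smul' c ψ := by
    rw [RingHom.id_apply, smul_eq_mul, ← integral_const_mul]
    exact integral_congr_ae (Eventually.of_forall fun x => mul_left_comm _ _ _)

/-- Integration against `φ` as a functional on `𝒪_C`. -/
noncomputable def integralFunctional (hM : IsWeightSequence M) (k : ℝ) (φ : KRoumieu d M) :
    OCDual d M k where
  toLinearMap := integralLinear hM k φ
  cont := IndSpace.continuous_of_bound (norm_withSeminorms ℂ ℂ) _ fun n _ =>
    ⟨(), decaySeminorm hM (n + 1) φ * ∫ x : EuclideanSpace ℝ (Fin d), Real.exp (-1 * ‖x‖),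
      fun w => by
        rw [mul_right_comm]
        exact norm_integral_mul_le_of_growth hM φ
          (norm_le_of_weightedDeriv hM fun j => w.norm_le_seminorm () j)⟩

/-- The inclusion `𝒦^{{M}} → 𝒪'_C` as a linear map. -/
noncomputable def dualInclusionLinear (hM : IsWeightSequence M) (k : ℝ) :
    KRoumieu d M →ₗ[ℂ] OCDual d M k where
  toFun := integralFunctional hM k
  map_add' φ φ' := ContinuousLinearMap.ext fun ψ => by
    change ∫ x, (φ + φ').val.1 x * ψ.val.1 x =
      (∫ x, φ.val.1 x * ψ.val.1 x) + ∫ x, φ'.val.1 x * ψ.val.1 x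
    rw [← integral_add (integrable_mul_OC hM φ ψ) (integrable_mul_OC hM φ' ψ)]
    exact integral_congr_ae (Eventually.of_forall fun x => add_mul _ _ _)
  map_smul' c φ := ContinuousLinearMap.ext fun ψ => by
    change ∫ x, (c • φ).val.1 x * ψ.val.1 x = c * ∫ x, φ.val.1 x * ψ.val.1 x
    rw [← integral_const_mul]
    exact integral_congr_ae (Eventually.of_forall fun x => mul_assoc _ _ _)

/-- The inclusion `𝒦^{{M}}(ℝ^d) → 𝒪'_C(ℝ^d)`. -/
noncomputable def dualInclusion (hM : IsWeightSequence M) (k : ℝ) :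
    KRoumieu d M →L[ℂ] OCDual d M k where
  toLinearMap := dualInclusionLinear hM k
  cont := StrongDual.continuous_of_bound _ fun B hB => by
    obtain ⟨n, C, hC, hb⟩ := OC.exists_bound_of_isVonNBounded hB
    set J := ∫ x : EuclideanSpace ℝ (Fin d), Real.exp (-1 * ‖x‖) with hJ
    have hJ0 : 0 ≤ J := integral_nonneg fun x => (Real.exp_pos _).le
    refine ⟨(C * J).toNNReal • decaySeminorm hM (n + 1),
      (continuous_decaySeminorm hM (n + 1)).const_smul (C * J).toNNReal, fun φ ψ hψ => ?_⟩
    change ‖∫ x, φ.val.1 x * ψ.val.1 x‖ ≤ (((C * J).toNNReal : NNReal) : ℝ) * _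
    rw [Real.coe_toNNReal _ (mul_nonneg hC hJ0), mul_comm, ← mul_assoc]
    exact norm_integral_mul_le_of_growth hM φ (norm_le_of_weightedDeriv hM (hb ψ hψ))

theorem isDualInclusion_dualInclusion (hM : IsWeightSequence M) (k : ℝ) :
    IsDualInclusion (dualInclusion (d := d) hM k) :=
  fun φ ψ => ⟨integrable_mul_OC hM φ ψ, rfl⟩

/-- The inclusion `𝒰^{{M}} ⊆ 𝒫^{M,k}`. -/
noncomputable def inclusionRoumieuGrowth (hM : IsWeightSequence M) {k : ℝ} (hk : 0 < k) :
    URoumieu d M →L[ℂ] PSpace d M k :=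
  IndSpace.liftSup IndSpace.val fun h n => ⟨n, 1, fun v z => by
    have hh : 0 < (h : ℝ) := h.2
    have h1 := (norm_weightedDecay_le_iff (h : ℝ) _ _ z v.val).1 (v.norm_le_seminorm n z)
    have h2 : 0 ≤ SupSpace.seminorm (fun n : ℕ => weightedDecay d M (h : ℝ) (n : ℝ)) n v :=
      apply_nonneg _ _
    rw [norm_weightedGrowth_le_iff, one_mul]
    refine h1.trans (mul_le_mul_of_nonneg_left (Real.exp_le_exp.2 ?_) h2)
    have h3 := hM.assocFun_nonneg (t := h * ‖reVec z.1‖) (by positivity)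
    have h4 := hM.assocFun_nonneg (t := k * ‖reVec z.1‖) (by positivity)
    linarith⟩

/-- The inclusion `𝒫^{M,k} ⊆ 𝒫^{M,h}`. -/
noncomputable def inclusionGrowth (hM : IsWeightSequence M) {k h : ℝ} (hk : 0 < k) (hkh : k ≤ h) :
    PSpace d M k →L[ℂ] PSpace d M h :=
  SupSpace.lift SupSpace.val fun n => ⟨n, 1, fun v z => by
    have h1 := (norm_weightedGrowth_le_iff k _ _ z v.val).1 (v.norm_le_seminorm n z)
    have h2 : 0 ≤ SupSpace.seminorm (fun n : ℕ => weightedGrowth d M k (n : ℝ)) n v :=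
      apply_nonneg _ _
    rw [norm_weightedGrowth_le_iff, one_mul]
    refine h1.trans (mul_le_mul_of_nonneg_left (Real.exp_le_exp.2 ?_) h2)
    exact hM.assocFun_mono (by positivity) (by gcongr)⟩

/-- The inclusion `𝒪_C^{M,h} ⊆ 𝒪_C^{M,k}`. -/
noncomputable def inclusionOC (hM : IsWeightSequence M) {k h : ℝ} (hk : 0 < k) (hkh : k ≤ h) :
    OC d M h →L[ℂ] OC d M k :=
  IndSpace.lift IndSpace.val fun n => ⟨n, fun _ => ⟨(), 1, fun v j => by
    have hh : 0 < h := hk.trans_le hkh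
    have h1 := (norm_weightedDeriv_le_iff hM hh (-(n : ℝ)) _ j.1 j.2 v.val).1
      (v.norm_le_seminorm () j)
    have h2 : 0 ≤ SupSpace.seminorm (fun _ : Unit => weightedDeriv d M h (-(n : ℝ))) () v :=
      apply_nonneg _ _
    have h3 := hM.pos (∑ i, j.1 i)
    rw [one_mul, norm_weightedDeriv_le_iff hM hk]
    refine h1.trans ?_
    gcongr⟩⟩

end Inclusions

/-! # Identities for the pairing -/

section Identities

variable {d : ℕ} {M : ℕ → ℝ} {C₀ H : ℝ} {χ : SmoothFun d}

/-- The translates `χ(t - ·)` form a continuous partition of unity, since `∫ χ = 1`. -/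
theorem IsWindow.integral_convolution_eq (hχ : IsWindow M χ) (hM : IsWeightSequence M) (hd : 0 < d)
    {f : EuclideanSpace ℝ (Fin d) → ℂ} (hf : Integrable f) :
    ∫ t, ∫ x, f x * χ.1 (t - x) = ∫ x, f x := by
  have h := integral_convolution (μ := volume) (ν := volume) (ContinuousLinearMap.mul ℝ ℂ) hf
    ((hχ.dirExpDecay hM).expDecay hd).integrable
  rw [ContinuousLinearMap.mul_apply', hχ.integral_eq_one, mul_one] at h
  exact h

/-- On functions of exponential decay, the pairing is an absolutely convergent integral. -/
theorem IsWindow.windowPairing_eq_integral (hχ : IsWindow M χ) (hM : IsWeightSequence M)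
    (hM2 : ConditionM2 M C₀ H) (hd : 0 < d) {h : ℝ} (hh : 0 < h) (P : PSpace d M h)
    {φ : SmoothFun d} {A : ℝ} (hA : 0 ≤ A) (hφ' : ExpDecay φ.1)
    (hφ : φ.DirBound M (dualIndex d H h)⁻¹ fun x => A * Real.exp (-1 * ‖x‖)) :
    windowPairing χ P.val φ = ∫ ξ, P.val.1 (ofRealVec ξ) * laplace φ.1 (ofRealVec ξ) := by
  -- For decaying `φ` (`c = -1`) the factor `e^{-‖t‖}` is present already at real `ξ` (`a = 0`). So
  -- the double integral converges absolutely, without a shift, and may be interchanged.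
  obtain ⟨K, hK, N, hKb⟩ := hχ.exists_norm_mul_laplace_windowed_le hM hM2 hd hh (-1) 0
  have hint : Integrable (Function.uncurry fun (t ξ : EuclideanSpace ℝ (Fin d)) =>
      P.val.1 (ofRealVec ξ) * laplace (windowed χ φ t).1 (ofRealVec ξ)) := by
    have h1 : Integrable (fun p : EuclideanSpace ℝ (Fin d) × EuclideanSpace ℝ (Fin d) =>
        Real.exp (-1 * ‖p.1‖) * ((1 + ‖p.2‖) ^ (d + 1))⁻¹) :=
      (integrable_exp_neg_mul_norm one_pos).mul_prod integrable_inv_one_add_norm_pow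
    refine (h1.const_mul (K * SupSpace.seminorm _ N P * A)).mono'
      (stronglyMeasurable_mul_laplace_windowed χ φ P.val).aestronglyMeasurable
      (Eventually.of_forall fun p => ?_)
    have := hKb P φ A hA hφ p.1 (ofRealVec p.2) (by simp)
    change ‖P.val.1 (ofRealVec p.2) * laplace (windowed χ φ p.1).1 (ofRealVec p.2)‖ ≤ _
    simpa [mul_assoc] using this
  simp only [windowPairing, windowIntegral]
  rw [integral_integral_swap hint]
  refine integral_congr_ae (Eventually.of_forall fun ξ => ?_)
  simp only
  rw [integral_const_mul]
  congr 1
  rw [laplace, ← hχ.integral_convolution_eq hM hd (hφ'.mul_laplaceKernel (ofRealVec ξ)).integrable]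
  refine integral_congr_ae (Eventually.of_forall fun t => ?_)
  refine integral_congr_ae (Eventually.of_forall fun x => ?_)
  exact mul_right_comm _ _ _

theorem laplaceKernel_add (x y : EuclideanSpace ℝ (Fin d)) (z : EuclideanSpace ℂ (Fin d)) :
    laplaceKernel (x + y) z = laplaceKernel x z * laplaceKernel y z := by
  simp only [laplaceKernel]
  rw [← Complex.exp_add, ← mul_add, ← Finset.sum_add_distrib]
  simp [add_mul]

theorem laplaceKernel_ofRealVec_comm (x y : EuclideanSpace ℝ (Fin d)) :
    laplaceKernel x (ofRealVec y) = laplaceKernel y (ofRealVec x) := by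
  simp only [laplaceKernel, ofRealVec_apply, mul_comm]

theorem laplace_reflect (φ : SmoothFun d) (x : EuclideanSpace ℝ (Fin d))
    (z : EuclideanSpace ℂ (Fin d)) :
    laplace (SmoothFun.reflect x φ).1 z = laplace (SmoothFun.reflect 0 φ).1 z * laplaceKernel x z := by
  simp only [laplace]
  rw [← integral_add_right_eq_self _ x, ← integral_mul_const]
  refine integral_congr_ae (Eventually.of_forall fun s => ?_)
  simp only [SmoothFun.reflect_apply, laplaceKernel_add, zero_sub, sub_add_cancel_right]
  ring

/-- The functions `φ(x - ·)`, `φ ∈ 𝒦^{(M)}`, as elements of `𝒪_C`. -/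
theorem KBeurling.exists_OC_reflect (hM : IsWeightSequence M) {k : ℝ} (hk : 0 < k)
    (φ : KBeurling d M) (x : EuclideanSpace ℝ (Fin d)) :
    ∃ ψ : OC d M k, ψ.val = SmoothFun.reflect x φ.val := by
  refine ⟨IndSpace.ofStep _ 0 (SupSpace.mk (SmoothFun.reflect x φ.val)
    (SupSpace.mem_boundedSubmodule fun _ => ⟨SupSpace.seminorm _ (⟨k, hk⟩, 0) φ, fun j => ?_⟩)), rfl⟩
  rw [norm_weightedDeriv_le_iff hM hk, SmoothFun.norm_multiDeriv_reflect]
  have := (norm_weightedDeriv_le_iff hM hk _ _ j.1 (x - j.2) φ.val).1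
    (φ.norm_le_seminorm (⟨k, hk⟩, 0) (j.1, x - j.2))
  simpa using this

/-- This is `g ∗ φ = F(P · F(φˇ))`: the transform of `φ(x - ·)` is that of `φˇ` times `e^{-2πi
x·ξ}`, so the pairing is a Fourier integral evaluated at `x`. -/
theorem IsWindow.windowPairing_reflect (hχ : IsWindow M χ) (hM : IsWeightSequence M)
    (hM2 : ConditionM2 M C₀ H) (hd : 0 < d) {h : ℝ} (hh : 0 < h) (P : PSpace d M h)
    (φ : KBeurling d M) (x : EuclideanSpace ℝ (Fin d)) :
    windowPairing χ P.val (SmoothFun.reflect x φ.val) = (fourierBeurling hM hM2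
      (mulBeurling hM hM2 hh P (laplaceBeurling hd hM (reflectBeurling hM φ)))).val.1 x := by
  have hr := inv_pos.2 (dualIndex_pos hd hM2 hh)
  have hred : ∀ {r : ℝ}, 0 < r → ∀ c : ℝ, ∃ A, 0 ≤ A ∧
      (SmoothFun.reflect x φ.val).DirBound M r fun t => A * Real.exp (-c * ‖t‖) := fun hr c => by
    obtain ⟨A, hA, hb⟩ := φ.exists_dirBound hM hr |c|
    refine ⟨A * Real.exp (|c| * ‖x‖), by positivity,
      (hb.reflect x).mono_right hM hr.le fun t => ?_⟩
    rw [mul_assoc, ← Real.exp_add]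
    refine mul_le_mul_of_nonneg_left (Real.exp_le_exp.2 ?_) hA
    have h1 : ‖t‖ ≤ ‖x‖ + ‖x - t‖ := by
      have := norm_sub_le x (x - t)
      rwa [sub_sub_cancel] at this
    have h2 : |c| * ‖t‖ ≤ |c| * (‖x‖ + ‖x - t‖) := by gcongr
    have h3 : c * ‖t‖ ≤ |c| * ‖t‖ := by gcongr; exact le_abs_self c
    linarith
  have hdec : (SmoothFun.reflect x φ.val).DirExpDecay := .of_dirBound hM fun c => by
    obtain ⟨A, -, h⟩ := hred one_pos c
    exact ⟨A, 1, zero_le_one, h⟩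
  obtain ⟨A, hA, hb⟩ := hred hr 1
  rw [hχ.windowPairing_eq_integral hM hM2 hd hh P hA (hdec.expDecay hd) hb, fourierBeurling_apply,
    ← laplace_ofRealVec, laplace]
  refine integral_congr_ae (Eventually.of_forall fun ξ => ?_)
  simp only
  rw [laplace_reflect, laplaceKernel_ofRealVec_comm x, ← mul_assoc]
  rfl

/-- On `𝒰^{{M}}` the pairing is integration against the Fourier transform. -/
theorem IsWindow.windowPairing_roumieu (hχ : IsWindow M χ) (hM : IsWeightSequence M)
    (hM2 : ConditionM2 M C₀ H) (hd : 0 < d) {k : ℝ} (hk : 0 < k) (φ : URoumieu d M)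
    (ψ : OC d M k) :
    windowPairing χ φ.val ψ.val = ∫ x, (fourierRoumieu hM hM2 φ).val.1 x * ψ.val.1 x := by
  have hφ : Integrable fun x => φ.val.1 (ofRealVec x) :=
    integrable_of_mem_rapid (realRestrict_mem_rapid_of_roumieu hM φ)
  rw [← hχ.integral_convolution_eq hM hd (integrable_mul_OC hM (fourierRoumieu hM hM2 φ) ψ)]
  refine integral_congr_ae (Eventually.of_forall fun t => ?_)
  have hw : Integrable (windowed χ ψ.val t).1 :=
    (((ψ.expGrowth hM hk).dirExpDecay_windowed hχ hM (inv_pos.2 hk) t).expDecay hd).integrable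
  -- For fixed `t` both factors are integrable on `ℝ^d`, so the Fourier transform moves from the
  -- windowed function to `φ`.
  have h1 := VectorFourier.integral_fourierIntegral_smul_eq_flip (μ := volume) (ν := volume)
    (L := innerₗ (EuclideanSpace ℝ (Fin d))) Real.continuous_fourierChar continuous_inner hφ hw
  rw [flip_innerₗ] at h1
  simp only [windowIntegral, laplace_ofRealVec]
  refine h1.symm.trans (integral_congr_ae (Eventually.of_forall fun x => ?_))
  exact (mul_assoc _ _ _).symm

end Identities


/-! ### The convolution operator, the exchange formula and the diagram. -/

section Diagram

variable {d : ℕ} {M : ℕ → ℝ} {C₀ H : ℝ} {χ : SmoothFun d}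

theorem val_inclusionRoumieuGrowth (hM : IsWeightSequence M) {k : ℝ} (hk : 0 < k)
    (φ : URoumieu d M) : (inclusionRoumieuGrowth hM hk φ).val = φ.val :=
  IndSpace.val_liftSup _ _ _

theorem val_inclusionGrowth (hM : IsWeightSequence M) {k h : ℝ} (hk : 0 < k) (hkh : k ≤ h)
    (P : PSpace d M k) : (inclusionGrowth hM hk hkh P).val = P.val :=
  SupSpace.val_lift _ _ _

theorem val_inclusionOC (hM : IsWeightSequence M) {k h : ℝ} (hk : 0 < k) (hkh : k ≤ h)
    (ψ : OC d M h) : (inclusionOC hM hk hkh ψ).val = ψ.val :=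
  IndSpace.val_lift _ _ _

theorem dualInclusion_apply (hM : IsWeightSequence M) {k : ℝ} (φ : KRoumieu d M) (ψ : OC d M k) :
    dualInclusion hM k φ ψ = ∫ x, φ.val.1 x * ψ.val.1 x := rfl

/-- The transpose of the inclusion of `𝒪_C` spaces. -/
noncomputable def transposeInclusionOC (hM : IsWeightSequence M) {k h : ℝ} (hk : 0 < k)
    (hkh : k ≤ h) : OCDual d M k →L[ℂ] OCDual d M h :=
  ContinuousLinearMap.precomp ℂ (inclusionOC hM hk hkh)

theorem transposeInclusionOC_eq (hM : IsWeightSequence M) {k h : ℝ} (hk : 0 < k)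
    (hkh : k ≤ h) (g : OCDual d M k) :
    transposeInclusionOC hM hk hkh g = g ∘L inclusionOC hM hk hkh := rfl

theorem transposeInclusionOC_apply (hM : IsWeightSequence M) {k h : ℝ} (hk : 0 < k)
    (hkh : k ≤ h) (g : OCDual d M k) (ψ : OC d M h) :
    transposeInclusionOC hM hk hkh g ψ = g (inclusionOC hM hk hkh ψ) := rfl

theorem transposeInclusionOC_comp_dualInclusion (hM : IsWeightSequence M) {k h : ℝ} (hk : 0 < k)
    (hkh : k ≤ h) :
    transposeInclusionOC (d := d) hM hk hkh ∘L dualInclusion hM k = dualInclusion hM h :=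
  ContinuousLinearMap.ext fun φ => ContinuousLinearMap.ext fun ψ => by
    rw [ContinuousLinearMap.comp_apply, transposeInclusionOC_apply, dualInclusion_apply,
      dualInclusion_apply, val_inclusionOC]

theorem fourierDual_comp_inclusionGrowth (hχ : IsWindow M χ) (hM : IsWeightSequence M)
    (hM2 : ConditionM2 M C₀ H) (hd : 0 < d) {k h : ℝ} (hk : 0 < k) (hh : 0 < h) (hkh : k ≤ h)
    (hdk : 0 < dualIndex d H k) (hdkh : dualIndex d H k ≤ dualIndex d H h) :
    fourierDual hχ hM hM2 hd hh ∘L inclusionGrowth hM hk hkh =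
      transposeInclusionOC hM hdk hdkh ∘L fourierDual hχ hM hM2 hd hk :=
  ContinuousLinearMap.ext fun P => ContinuousLinearMap.ext fun ψ => by
    rw [ContinuousLinearMap.comp_apply, ContinuousLinearMap.comp_apply, transposeInclusionOC_apply,
      fourierDual_apply, fourierDual_apply, val_inclusionOC, val_inclusionGrowth]

theorem fourierDual_comp_inclusionRoumieuGrowth (hχ : IsWindow M χ) (hM : IsWeightSequence M)
    (hM2 : ConditionM2 M C₀ H) (hd : 0 < d) {k : ℝ} (hk : 0 < k) :
    fourierDual hχ hM hM2 hd hk ∘L inclusionRoumieuGrowth hM hk =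
      dualInclusion hM (dualIndex d H k) ∘L fourierRoumieu hM hM2 :=
  ContinuousLinearMap.ext fun φ => ContinuousLinearMap.ext fun ψ => by
    rw [ContinuousLinearMap.comp_apply, ContinuousLinearMap.comp_apply, fourierDual_apply,
      dualInclusion_apply, val_inclusionRoumieuGrowth]
    exact hχ.windowPairing_roumieu hM hM2 hd (dualIndex_pos hd hM2 hk) φ ψ

/-- The maps `𝒫^{M,h}(ℂ^d) → 𝒪'_C(ℝ^d)` for all `h`, with the value `0` for `h ≤ 0`. -/
noncomputable def fourierDualFamily (hχ : IsWindow M χ) (hM : IsWeightSequence M)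
    (hM2 : ConditionM2 M C₀ H) (hd : 0 < d) (h : ℝ) :
    PSpace d M h →L[ℂ] OCDual d M (dualIndex d H h) :=
  if hh : 0 < h then fourierDual hχ hM hM2 hd hh else 0

theorem fourierDualFamily_of_pos (hχ : IsWindow M χ) (hM : IsWeightSequence M)
    (hM2 : ConditionM2 M C₀ H) (hd : 0 < d) {h : ℝ} (hh : 0 < h) :
    fourierDualFamily hχ hM hM2 hd h = fourierDual hχ hM hM2 hd hh := dif_pos hh

/-- Convolution with the Fourier transform of `P`. -/
noncomputable def convBeurling (hM : IsWeightSequence M) (hM2 : ConditionM2 M C₀ H) (hd : 0 < d)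
    {h : ℝ} (hh : 0 < h) (P : PSpace d M h) : KBeurling d M →L[ℂ] KBeurling d M :=
  fourierBeurling hM hM2 ∘L mulBeurling hM hM2 hh P ∘L laplaceBeurling hd hM ∘L reflectBeurling hM

theorem convBeurling_apply (hM : IsWeightSequence M) (hM2 : ConditionM2 M C₀ H) (hd : 0 < d)
    {h : ℝ} (hh : 0 < h) (P : PSpace d M h) (φ : KBeurling d M) :
    convBeurling hM hM2 hd hh P φ = fourierBeurling hM hM2
      (mulBeurling hM hM2 hh P (laplaceBeurling hd hM (reflectBeurling hM φ))) := rfl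

theorem isConvolution_convBeurling (hχ : IsWindow M χ) (hM : IsWeightSequence M)
    (hM2 : ConditionM2 M C₀ H) (hd : 0 < d) {h : ℝ} (hh : 0 < h) (P : PSpace d M h) :
    IsConvolution (fourierDual hχ hM hM2 hd hh P) (convBeurling hM hM2 hd hh P) := by
  intro φ x
  obtain ⟨ψ, hψ⟩ := KBeurling.exists_OC_reflect hM (dualIndex_pos hd hM2 hh) φ x
  refine ⟨ψ, fun t => by rw [hψ]; rfl, ?_⟩
  rw [fourierDual_apply, hψ, hχ.windowPairing_reflect hM hM2 hd hh P φ x, convBeurling_apply]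

theorem reflectBeurling_reflectBeurling (hM : IsWeightSequence M) (φ : KBeurling d M) :
    reflectBeurling hM (reflectBeurling hM φ) = φ :=
  SupSpace.val_injective <| Subtype.ext <| funext fun x => by
    rw [isReflection_reflectBeurling, isReflection_reflectBeurling, neg_neg]

/-- The exchange formula on test functions: in `F(P · F(φˇ))` with `φ` replaced by `φˇ` the inner
reflections cancel, and Fourier inversion removes the outer transforms. -/
theorem laplace_reflect_convBeurling_reflect (hM : IsWeightSequence M) (hM2 : ConditionM2 M C₀ H)
    (hd : 0 < d) {h : ℝ} (hh : 0 < h) (P : PSpace d M h) (φ : KBeurling d M) :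
    laplaceBeurling hd hM (reflectBeurling hM
      (convBeurling hM hM2 hd hh P (reflectBeurling hM φ))) =
      mulBeurling hM hM2 hh P (laplaceBeurling hd hM φ) := by
  rw [convBeurling_apply, laplace_reflect_fourier, reflectBeurling_reflectBeurling]

end Diagram

theorem mainTheorem10 {d : ℕ} (hd : 0 < d) (M : ℕ → ℝ) (hM : IsWeightSequence M)
    (C₀ H : ℝ) (hM2 : ConditionM2 M C₀ H) (hK : ∃ φ : KBeurling d M, φ ≠ 0) :
    ∃ Ft : ∀ h : ℝ, PSpace d M h →L[ℂ] OCDual d M (2 * √(d : ℝ) * H * h / π),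
      -- the exchange formula `F(P · f) = Ft_h(P) ∗ F(f)` in `𝒦'^{(M)}(ℝ^d; E)`; by duality,
      -- `P · f = f ∘ mul`, `F(f) = f ∘ F` and `⟨g ∗ T, φ⟩ = ⟨T, (g ∗ φˇ)ˇ⟩`
      (∃ (F : KBeurling d M →L[ℂ] UBeurling d M) (refl : KBeurling d M →L[ℂ] KBeurling d M),
        IsFourierBeurling F ∧ IsReflection refl ∧
        ∀ h : ℝ, 0 < h → ∀ P : PSpace d M h,
          ∃ (mul : UBeurling d M →L[ℂ] UBeurling d M) (conv : KBeurling d M →L[ℂ] KBeurling d M),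
            IsMultiplication P mul ∧ IsConvolution (Ft h P) conv ∧
            ∀ (E : Type*) [AddCommGroup E] [Module ℂ E] [Module ℝ E] [IsScalarTower ℝ ℂ E]
              [UniformSpace E] [IsUniformAddGroup E] [ContinuousSMul ℂ E]
              [LocallyConvexSpace ℝ E] [T2Space E],
              (∀ u : ℕ → E, CauchySeq u → ∃ e, Tendsto u atTop (𝓝 e)) →
              ∀ f : UBeurling d M →L[ℂ] E,
                (f ∘L mul) ∘L F = (f ∘L F) ∘L (refl ∘L conv ∘L refl)) ∧
      -- the commutative diagram of continuous maps
      (∃ F : URoumieu d M →L[ℂ] KRoumieu d M, IsFourierRoumieu F ∧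
        ∀ k h : ℝ, 0 < k → k < h →
          ∃ (inclUP : URoumieu d M →L[ℂ] PSpace d M k)
            (inclPP : PSpace d M k →L[ℂ] PSpace d M h)
            (inclOO : OC d M (2 * √(d : ℝ) * H * h / π) →L[ℂ] OC d M (2 * √(d : ℝ) * H * k / π))
            (transpose : OCDual d M (2 * √(d : ℝ) * H * k / π) →L[ℂ]
              OCDual d M (2 * √(d : ℝ) * H * h / π))
            (incK : KRoumieu d M →L[ℂ] OCDual d M (2 * √(d : ℝ) * H * k / π))
            (incH : KRoumieu d M →L[ℂ] OCDual d M (2 * √(d : ℝ) * H * h / π)),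
            (∀ φ, (inclUP φ).val = φ.val) ∧ (∀ P, (inclPP P).val = P.val) ∧
            (∀ φ, (inclOO φ).val = φ.val) ∧ (∀ g, transpose g = g ∘L inclOO) ∧
            IsDualInclusion incK ∧ IsDualInclusion incH ∧
            (Ft k ∘L inclUP = incK ∘L F) ∧
            (Ft h ∘L inclPP = transpose ∘L Ft k) ∧
            (transpose ∘L incK = incH)) := by
  obtain ⟨χ, hχ⟩ := exists_isWindow hM hd hK
  refine ⟨fourierDualFamily hχ hM hM2 hd,
    ⟨laplaceBeurling hd hM, reflectBeurling hM, isFourierBeurling_laplaceBeurling hd hM,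
      isReflection_reflectBeurling hM, fun h hh P => ?_⟩,
    ⟨fourierRoumieu hM hM2, isFourierRoumieu_fourierRoumieu hM hM2, fun k h hk hkh => ?_⟩⟩
  · refine ⟨mulBeurling hM hM2 hh P, convBeurling hM hM2 hd hh P,
      isMultiplication_mulBeurling hM hM2 hh P, ?_, ?_⟩
    · rw [fourierDualFamily_of_pos hχ hM hM2 hd hh]
      exact isConvolution_convBeurling hχ hM hM2 hd hh P
    · intro E _ _ _ _ _ _ _ _ _ _ f
      -- All operations on `f` are precompositions, so the vector-valued identity is `f` applied to
      -- the identity on test functions.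
      exact ContinuousLinearMap.ext fun φ =>
        congrArg f (laplace_reflect_convBeurling_reflect hM hM2 hd hh P φ).symm
  · have hh : 0 < h := hk.trans hkh
    have hdk := dualIndex_pos hd hM2 hk
    have hdkh : dualIndex d H k ≤ dualIndex d H h := by
      have hH : 0 < H := zero_lt_one.trans_le hM2.one_le_H
      unfold dualIndex
      gcongr
    rw [fourierDualFamily_of_pos hχ hM hM2 hd hk, fourierDualFamily_of_pos hχ hM hM2 hd hh]
    exact ⟨inclusionRoumieuGrowth hM hk, inclusionGrowth hM hk hkh.le, inclusionOC hM hdk hdkh,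
      transposeInclusionOC hM hdk hdkh, dualInclusion hM _, dualInclusion hM _,
      val_inclusionRoumieuGrowth hM hk, val_inclusionGrowth hM hk hkh.le,
      val_inclusionOC hM hdk hdkh, transposeInclusionOC_eq hM hdk hdkh,
      isDualInclusion_dualInclusion hM _, isDualInclusion_dualInclusion hM _,
      fourierDual_comp_inclusionRoumieuGrowth hχ hM hM2 hd hk,
      fourierDual_comp_inclusionGrowth hχ hM hM2 hd hk hh hkh.le hdk hdkh,
      transposeInclusionOC_comp_dualInclusion hM hdk hdkh⟩
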